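/- Let $q\in\mathbb C$ with $0<|q|<1$, fix a square root $q^{1/2}$, and write $t=q^{1/2}s$, $\overline{h}=h(qt)$, $\underline{h}=h(t/q)$ (so $\overline t=qt$, $\overline s=qs$). Let $b_1,\dots,b_8\in\mathbb C$ satisfy $$q\,b_1b_3b_5b_7=1,\qquad b_2b_4b_6b_8=q$$ (hence $b_1\cdots b_8=1$), and let $m_k$ be the $k$-th elementary symmetric function of $b_1,\dots,b_8$. The $q$-Painlevé equation of type $E_8^{(1)}$ for $f=f(t)$, $g=g(t)$ is $$\frac{(\overline g\,\overline s t-f)(gst-f)-(\overline s^2t^2-1)(s^2t^2-1)}{\left(\frac{\overline g}{\overline s t}-f\right)\left(\frac{g}{st}-f\right)-\left(1-\frac1{\overline s^2t^2}\right)\left(1-\frac1{s^2t^2}\right)}=\frac{P(f,t,m_1,\dots,m_7)}{P(f,t^{-1},m_7,\dots,m_1)},$$ $$\frac{(\underline f s\underline t-g)(fst-g)-(s^2\underline t^2-1)(s^2t^2-1)}{\left(\frac{\underline f}{s\underline t}-g\right)\left(\frac{f}{st}-g\right)-\left(1-\frac1{s^2\underline t^2}\right)\left(1-\frac1{s^2t^2}\right)}=\frac{P(g,s,m_7,\dots,m_1)}{P(g,s^{-1},m_1,\dots,m_7)},$$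 where $P(f,t,m_1,\dots,m_7)=f^4-m_1tf^3+(m_2t^2-3-t^8)f^2+(m_7t^7-m_3t^3+2m_1t)f+(t^8-m_6t^6+m_4t^4-m_2t^2+1)$. Put $f_i=b_it+\frac1{b_it}$, $g_i=\frac s{b_i}+\frac{b_i}s$, and $$a_0=\frac1{qb_1b_2b_8^2},\quad a_1=\frac{q^2}{b_2b_8t^2},\quad a_2=\frac{s^2}{b_2b_8},\quad a_i=\frac{b_i}{b_8}\ (i=3,5,7),\quad a_i=\frac{b_i}{b_1}\ (i=4,6),$$ $$\lambda=\frac{b_1b_4b_6}{b_8s^2}\,\frac{\left(1-\frac{b_4b_6}{b_1b_8}\right)\left(1-q^2\frac{b_4b_6}{b_1b_8}\right)(1-b_3b_5t^2)(1-b_3b_7t^2)(1-b_5b_7t^2)\prod_{i=2,4,6}\left(1-\frac{b_i}{b_1}\right)}{\left(1-\frac{s^2}{b_1b_8}\right)\left(1-\frac{q^2s^2}{b_1b_8}\right)\left(1-\frac{b_4}{b_8}\right)\left(1-\frac{b_6}{b_8}\right)\left(1-\frac q{b_1b_8s^2}\right)\prod_{i=3,5,7}\left(1-\frac{b_4b_6}{b_1b_i}\right)},$$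 $$\Phi(a_0;a_1,\dots,a_7)={}_{10}W_9(a_0;a_1,\dots,a_7;q^2,q^2)+\frac{\left(q^2a_0,\frac{a_7}{a_0};q^2\right)_\infty}{\left(\frac{a_0}{a_7},\frac{q^2a_7^2}{a_0};q^2\right)_\infty}\prod_{k=1}^6\frac{\left(a_k,\frac{q^2a_7}{a_k};q^2\right)_\infty}{\left(\frac{q^2a_0}{a_k},\frac{a_ka_7}{a_0};q^2\right)_\infty}\;{}_{10}W_9\!\left(\frac{a_7^2}{a_0};\frac{a_1a_7}{a_0},\dots,\frac{a_6a_7}{a_0},a_7;q^2,q^2\right),$$ where ${}_{10}W_9$ is the very-well-poised basic hypergeometric series. Define $g(t)$ by $$z=\frac{g-g_1}{g-g_8}=\lambda\,\frac{\Phi(q^4a_0;a_1,q^2a_2,\dots,q^2a_7)}{\Phi(a_0;a_1,\dots,a_7)}$$ and $f(t)$ as the solution of the equation, affine in $f$, $$\begin{vmatrix}1&f&g&fg\\1&f_1&g_1&f_1g_1\\1&f_3&g_3&f_3g_3\\1&f_5&g_5&f_5g_5\end{vmatrix}=0 .$$ Call $t\neq0$ regular if at $t$ the denominators in these formulas (in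 both values of $\Phi$, in $z$, in $g=\frac{g_1-zg_8}{1-z}$, and the coefficient of $f$ in the determinant) are nonzero and $g_1\ne g_8$. Then, at every regular $t$, both values of $\Phi$ are combinations of convergent balanced ${}_{10}W_9$ series, $g\neq g_8$, and $f,g$ satisfy the two displayed defining relations. If moreover $qt$ is regular, then $$\begin{vmatrix}1&f&\overline g&f\overline g\\1&f_8&\overline g_8&f_8\overline g_8\\1&f_6&\overline g_6&f_6\overline g_6\\1&f_4&\overline g_4&f_4\overline g_4\end{vmatrix}=0$$ and the first Painlevé equation holds at $t$; if moreover $t/q$ is regular, then the second one holds at $t$. Each Painlevé equation holds after clearing denominators, and literally wherever its two denominators are nonzero. In particular $(f,g)$ solves $q$-P$(E_8^{(1)})$ along every orbit $\{q^nt\}$ of regular points on which the denominators of the equation do not vanish. -/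

import Mathlib

noncomputable section

namespace QPE8

/-! ### Basic hypergeometric series -/

/-- The finite `q`-shifted factorial `(a;q)_n = (1 - a)(1 - q a) ⋯ (1 - q^(n-1) a)`. -/
def qPoch (a q : ℂ) (n : ℕ) : ℂ := ∏ k ∈ Finset.range n, (1 - q ^ k * a)

/-- The infinite `q`-shifted factorial `(a;q)_∞`. -/
def qPochInf (a q : ℂ) : ℂ := ∏' k : ℕ, (1 - q ^ k * a)

/-- The `n`-th term of the basic hypergeometric series `_rφ_s` with upper parameters `as`
and lower parameters `bs`. -/
def phiTerm (as bs : List ℂ) (q z : ℂ) (n : ℕ) : ℂ :=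
  (as.map fun a => qPoch a q n).prod / ((bs.map fun b => qPoch b q n).prod * qPoch q q n)
    * ((-1) ^ n * q ^ n.choose 2) ^ ((1 : ℤ) + bs.length - as.length) * z ^ n

/-- The basic hypergeometric series `_rφ_s(as; bs; q, z)`. -/
def basicPhi (as bs : List ℂ) (q z : ℂ) : ℂ := ∑' n : ℕ, phiTerm as bs q z n

/-- Upper parameters `a, q a^(1/2), -q a^(1/2), c_1, c_2, …` of a very-well-poised series. -/
def vwpUpper (a : ℂ) (cs : List ℂ) (q : ℂ) : List ℂ :=
  a :: q * a ^ (1 / 2 : ℂ) :: -(q * a ^ (1 / 2 : ℂ)) :: cs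

/-- Lower parameters `a^(1/2), -a^(1/2), q a / c_1, q a / c_2, …` of a very-well-poised
series. -/
def vwpLower (a : ℂ) (cs : List ℂ) (q : ℂ) : List ℂ :=
  a ^ (1 / 2 : ℂ) :: -(a ^ (1 / 2 : ℂ)) :: cs.map fun c => q * a / c

/-- The very-well-poised series `_{r+1}W_r(a; cs; q, z)`, where `cs` has length `r - 2`. -/
def vwpW (a : ℂ) (cs : List ℂ) (q z : ℂ) : ℂ :=
  basicPhi (vwpUpper a cs q) (vwpLower a cs q) q z

/-- A very-well-poised series with argument `z` in base `q` is *proper and balanced*: no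
denominator factor vanishes, the series converges, and it is balanced, that is, `q` times the
product of its upper parameters is the product of its lower ones, and `z = q`. -/
def VwpBalanced (a : ℂ) (cs : List ℂ) (q z : ℂ) : Prop :=
  (∀ x ∈ vwpLower a cs q, ∀ n : ℕ, qPoch x q n ≠ 0) ∧
  Summable (phiTerm (vwpUpper a cs q) (vwpLower a cs q) q z) ∧
  q * (vwpUpper a cs q).prod = (vwpLower a cs q).prod ∧ z = q

/-! ### The function `Φ(a_0; a_1, …, a_7)` -/

/-- The parameters `a_1, …, a_7` of the first series in `Φ`. -/
def phiParams (a : Fin 8 → ℂ) : List ℂ := [a 1, a 2, a 3, a 4, a 5, a 6, a 7]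

/-- The parameters `a_1 a_7 / a_0, …, a_6 a_7 / a_0, a_7` of the second series in `Φ`. -/
def phiParams' (a : Fin 8 → ℂ) : List ℂ :=
  [a 1 * a 7 / a 0, a 2 * a 7 / a 0, a 3 * a 7 / a 0, a 4 * a 7 / a 0, a 5 * a 7 / a 0,
    a 6 * a 7 / a 0, a 7]

/-- Numerator of the coefficient of the second series in `Φ` (base `p`). -/
def phiCoeffNum (p : ℂ) (a : Fin 8 → ℂ) : ℂ :=
  qPochInf (p * a 0) p * qPochInf (a 7 / a 0) p *
    ∏ k ∈ ({1, 2, 3, 4, 5, 6} : Finset (Fin 8)),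
      (qPochInf (a k) p * qPochInf (p * a 7 / a k) p)

/-- Denominator of the coefficient of the second series in `Φ` (base `p`). -/
def phiCoeffDen (p : ℂ) (a : Fin 8 → ℂ) : ℂ :=
  qPochInf (a 0 / a 7) p * qPochInf (p * a 7 ^ 2 / a 0) p *
    ∏ k ∈ ({1, 2, 3, 4, 5, 6} : Finset (Fin 8)),
      (qPochInf (p * a 0 / a k) p * qPochInf (a k * a 7 / a 0) p)

/-- `Φ(a_0; a_1, …, a_7)`, with both `_10W_9` series in base `q^2` and argument `q^2`. -/
def Phi (q : ℂ) (a : Fin 8 → ℂ) : ℂ :=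
  vwpW (a 0) (phiParams a) (q ^ 2) (q ^ 2) +
    phiCoeffNum (q ^ 2) a / phiCoeffDen (q ^ 2) a *
      vwpW (a 7 ^ 2 / a 0) (phiParams' a) (q ^ 2) (q ^ 2)

/-- None of the denominators that occur in the definition of `Φ(a_0; a_1, …, a_7)`
vanishes. -/
structure PhiDefined (q : ℂ) (a : Fin 8 → ℂ) : Prop where
  param_ne : ∀ i, a i ≠ 0
  lower_ne : ∀ x ∈ vwpLower (a 0) (phiParams a) (q ^ 2), ∀ n : ℕ, qPoch x (q ^ 2) n ≠ 0
  lower_ne' : ∀ x ∈ vwpLower (a 7 ^ 2 / a 0) (phiParams' a) (q ^ 2), ∀ n : ℕ,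
    qPoch x (q ^ 2) n ≠ 0
  coeffDen_ne : phiCoeffDen (q ^ 2) a ≠ 0

/-- Both series in `Φ(a_0; a_1, …, a_7)` are convergent balanced `_10W_9` series. -/
def PhiBalanced (q : ℂ) (a : Fin 8 → ℂ) : Prop :=
  VwpBalanced (a 0) (phiParams a) (q ^ 2) (q ^ 2) ∧
  VwpBalanced (a 7 ^ 2 / a 0) (phiParams' a) (q ^ 2) (q ^ 2)

/-- The parameters `(q^4 a_0; a_1, q^2 a_2, …, q^2 a_7)`. -/
def shiftParams (q : ℂ) (a : Fin 8 → ℂ) : Fin 8 → ℂ :=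
  ![q ^ 4 * a 0, a 1, q ^ 2 * a 2, q ^ 2 * a 3, q ^ 2 * a 4, q ^ 2 * a 5, q ^ 2 * a 6,
    q ^ 2 * a 7]

/-! ### The `q`-Painlevé equation of type `E_8^{(1)}`

The parameters `b_1, …, b_8` are the values at `1, …, 8` of a function `b : ℕ → ℂ`; its other
values are never used. -/

/-- `m_k`, the `k`-th elementary symmetric function of `b_1, …, b_8`. -/
def mSym (b : ℕ → ℂ) (k : ℕ) : ℂ := ((Finset.Icc 1 8).val.map b).esymm k

/-- The quartic `P(f, t, m_1, …, m_7)`. -/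
def quarticP (f t : ℂ) (m : ℕ → ℂ) : ℂ :=
  f ^ 4 - m 1 * t * f ^ 3 + (m 2 * t ^ 2 - 3 - t ^ 8) * f ^ 2
    + (m 7 * t ^ 7 - m 3 * t ^ 3 + 2 * m 1 * t) * f
    + (t ^ 8 - m 6 * t ^ 6 + m 4 * t ^ 4 - m 2 * t ^ 2 + 1)

/-- The reversed tuple `(m_7, …, m_1)`. -/
def revM (m : ℕ → ℂ) (k : ℕ) : ℂ := m (8 - k)

/-- Numerator of the left-hand side of both equations. For the first equation `x = f`,
`y = g`, `y' = ḡ`, `u = s t`, `u' = s̄ t`; for the second one `x = g`, `y = f`, `y' = f̲`,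
`u = s t`, `u' = s t̲`. -/
def lhsNum (x y y' u u' : ℂ) : ℂ :=
  (y' * u' - x) * (y * u - x) - (u' ^ 2 - 1) * (u ^ 2 - 1)

/-- Denominator of the left-hand side of both equations (same conventions). -/
def lhsDen (x y y' u u' : ℂ) : ℂ :=
  (y' / u' - x) * (y / u - x) - (1 - 1 / u' ^ 2) * (1 - 1 / u ^ 2)

/-- `num / den = num' / den'`, where the equation is understood in cleared form
`num * den' = num' * den` and literally, as an equation of fractions, as soon as both
denominators are nonzero. -/
def FracEq (num den num' den' : ℂ) : Prop :=
  num * den' = num' * den ∧ (den ≠ 0 → den' ≠ 0 → num / den = num' / den')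

/-- The first equation, relating `f = f(t)`, `g = g(t)` and `gbar = g(q t)`. -/
def FirstEq (q : ℂ) (b : ℕ → ℂ) (s t f g gbar : ℂ) : Prop :=
  FracEq (lhsNum f g gbar (s * t) (q * s * t)) (lhsDen f g gbar (s * t) (q * s * t))
    (quarticP f t (mSym b)) (quarticP f t⁻¹ (revM (mSym b)))

/-- The second equation, relating `g = g(t)`, `f = f(t)` and `funder = f(t / q)`. -/
def SecondEq (q : ℂ) (b : ℕ → ℂ) (s t g f funder : ℂ) : Prop :=
  FracEq (lhsNum g f funder (s * t) (s * (t / q))) (lhsDen g f funder (s * t) (s * (t / q)))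
    (quarticP g s (revM (mSym b))) (quarticP g s⁻¹ (mSym b))

/-- `f_i = b_i t + 1 / (b_i t)`. -/
def fPt (b : ℕ → ℂ) (t : ℂ) (i : ℕ) : ℂ := b i * t + 1 / (b i * t)

/-- `g_i = s / b_i + b_i / s`. -/
def gPt (b : ℕ → ℂ) (s : ℂ) (i : ℕ) : ℂ := s / b i + b i / s

/-- The determinant with first row `(w, x, y, z)` and further rows
`(1, f_l, g_l, f_l g_l)` for `l = i, j, k`, where `f_l`, `g_l` are taken at `t` and `s`. -/
def riccatiDet (b : ℕ → ℂ) (s t : ℂ) (i j k : ℕ) (w x y z : ℂ) : ℂ :=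
  Matrix.det !![w, x, y, z;
    1, fPt b t i, gPt b s i, fPt b t i * gPt b s i;
    1, fPt b t j, gPt b s j, fPt b t j * gPt b s j;
    1, fPt b t k, gPt b s k, fPt b t k * gPt b s k]

/-! ### The hypergeometric solution

Throughout `r` is a fixed square root of `q`, and `s = t / r`, that is, `t = q^(1/2) s`. -/

/-- The parameters `a_0, …, a_7`. -/
def aParams (q : ℂ) (b : ℕ → ℂ) (s t : ℂ) : Fin 8 → ℂ :=
  ![1 / (q * b 1 * b 2 * b 8 ^ 2), q ^ 2 / (b 2 * b 8 * t ^ 2), s ^ 2 / (b 2 * b 8),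
    b 3 / b 8, b 4 / b 1, b 5 / b 8, b 6 / b 1, b 7 / b 8]

/-- The factor `λ`. -/
def lam (q : ℂ) (b : ℕ → ℂ) (s t : ℂ) : ℂ :=
  b 1 * b 4 * b 6 / (b 8 * s ^ 2) *
    (((1 - b 4 * b 6 / (b 1 * b 8)) * (1 - q ^ 2 * (b 4 * b 6 / (b 1 * b 8)))
        * (1 - b 3 * b 5 * t ^ 2) * (1 - b 3 * b 7 * t ^ 2) * (1 - b 5 * b 7 * t ^ 2)
        * ∏ i ∈ ({2, 4, 6} : Finset ℕ), (1 - b i / b 1)) /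
      ((1 - s ^ 2 / (b 1 * b 8)) * (1 - q ^ 2 * s ^ 2 / (b 1 * b 8))
        * (1 - b 4 / b 8) * (1 - b 6 / b 8) * (1 - q / (b 1 * b 8 * s ^ 2))
        * ∏ i ∈ ({3, 5, 7} : Finset ℕ), (1 - b 4 * b 6 / (b 1 * b i))))

/-- `z(t) = λ Φ(q^4 a_0; a_1, q^2 a_2, …, q^2 a_7) / Φ(a_0; a_1, …, a_7)`. -/
def zSol (q r : ℂ) (b : ℕ → ℂ) (t : ℂ) : ℂ :=
  lam q b (t / r) t * (Phi q (shiftParams q (aParams q b (t / r) t)) /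
    Phi q (aParams q b (t / r) t))

/-- `g(t)`, obtained by solving `(g - g_1) / (g - g_8) = z` for `g`. -/
def gSol (q r : ℂ) (b : ℕ → ℂ) (t : ℂ) : ℂ :=
  (gPt b (t / r) 1 - zSol q r b t * gPt b (t / r) 8) / (1 - zSol q r b t)

/-- The determinant with first row `(1, f, g, f g)` is affine in `f`; this is the coefficient
of `f`, for `g = g(t)` and the indices `1, 3, 5`. -/
def fSolDen (q r : ℂ) (b : ℕ → ℂ) (t : ℂ) : ℂ :=
  riccatiDet b (t / r) t 1 3 5 0 1 0 (gSol q r b t)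

/-- `f(t)`, obtained by solving the first determinantal equation for `f`, with `g = g(t)`. -/
def fSol (q r : ℂ) (b : ℕ → ℂ) (t : ℂ) : ℂ :=
  -riccatiDet b (t / r) t 1 3 5 1 0 (gSol q r b t) 0 / fSolDen q r b t

/-- The point `t` is regular: the formulas for `z(t)`, `g(t)` and `f(t)` have nonzero
denominators, and `g_1 ≠ g_8`, so that `g ↦ (g - g_1) / (g - g_8)` is a coordinate. -/
structure Regular (q r : ℂ) (b : ℕ → ℂ) (t : ℂ) : Prop where
  t_ne : t ≠ 0
  phi_defined : PhiDefined q (aParams q b (t / r) t)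
  phi_shift_defined : PhiDefined q (shiftParams q (aParams q b (t / r) t))
  phi_ne : Phi q (aParams q b (t / r) t) ≠ 0
  g_one_ne_g_eight : gPt b (t / r) 1 ≠ gPt b (t / r) 8
  z_ne : zSol q r b t ≠ 1
  fSolDen_ne : fSolDen q r b t ≠ 0

end QPE8

end

noncomputable section

namespace QPE8

open Filter Topology

/-! The points `(b t + 1/(b t), s/b + b/s)` trace a rational curve of bidegree (2,2). A curve of
bidegree (1,1) meets it in four points whose parameters multiply to `s²/t²`. Since `t² = q s²`, the
two constraints on the `b_i` say that at `(t, s)` the (1,1)-curve through points 1, 3, 5 also passes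
through 7, and that at `(t, q s)` the one through 8, 6, 4 also passes through 2. If `(f, g)` lies on
the odd curve and `(f, ḡ)` on the even one, each curve gives an explicit fraction for a factor of
the Painlevé equation. Multiplying these fractions yields the first equation
(`cleared_eq_of_curves`, `fracEq_of_curves`). The second equation comes from the even curve at `t/q`
and the odd curve at `t`, with each `b_i` replaced by its inverse.

By construction `(f, g)` lies on the odd curve, so it remains to put `(f, ḡ)` on the even one.
Eliminating `f` turns this into a discrete Riccati equation, bilinear in `z(t)` and `z(q t)`, where
`z` is the coordinate on the `g`-line with zero at `g_1` and pole at `g_8` (`bilinear_of_curves`,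
`riccati_identity`). Write `z = λ V / U` with `U`, `V` the two values of `Φ`, and primes for their
values at `q t`. The Riccati equation then follows from two linear relations: `U' - U` is a multiple
of `V` (`Phi_up`), and a combination of `V'` and `V` is a multiple of `U'` (`Phi_down`). Both are
combined in `zRelation`.

For the contiguity relations, `Φ` is multiplied by a factor that clears its lower parameters
(`normFactor_mul_Phi`). The two series become sums of essentially one function, over the
progressions `p ^ n` and `(a₇/a₀) p ^ n` with `p = q²`. The minus sign in `secondTerm` is `(1 -
y)/(1 - 1/y) = -y` with `y = a₇/a₀`. Its factors for `a₀` and `a₇` are paired so that, because `a₀ x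
= a₇ p ^ n`, the quotient `(a₇)_∞/(a₀ x)_∞` appears as the finite product `(a₇)_n` and no possibly
vanishing `(a₀ x)_∞` is divided by. `Phi_up` holds term by term. `Phi_down` holds up to telescoping:
each series leaves a limit at infinity, and the two limits are opposite, so they cancel in `Φ`.
Balancing is what makes the telescoping identity true. -/

lemma qPoch_zero (a p : ℂ) : qPoch a p 0 = 1 := by simp [qPoch]

lemma qPoch_succ (a p : ℂ) (n : ℕ) : qPoch a p (n + 1) = qPoch a p n * (1 - p ^ n * a) := by
  simp [qPoch, Finset.prod_range_succ]

lemma qPoch_succ' (a p : ℂ) (n : ℕ) : qPoch a p (n + 1) = (1 - a) * qPoch (p * a) p n := by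
  simp only [qPoch, Finset.prod_range_succ', pow_zero, one_mul]
  rw [mul_comm]
  congr 1
  refine Finset.prod_congr rfl fun k _ => ?_
  ring

lemma one_sub_mul_qPoch (a p : ℂ) (n : ℕ) :
    (1 - a) * qPoch (p * a) p n = qPoch a p n * (1 - p ^ n * a) := by
  rw [← qPoch_succ', qPoch_succ]

lemma one_sub_ne_zero_of_qPoch {a p : ℂ} (h : ∀ n, qPoch a p n ≠ 0) (k : ℕ) :
    1 - p ^ k * a ≠ 0 := by
  have := h (k + 1)
  rw [qPoch_succ] at this
  exact right_ne_zero_of_mul this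

lemma qPoch_ne_zero {a p : ℂ} (h : ∀ k : ℕ, 1 - p ^ k * a ≠ 0) (n : ℕ) : qPoch a p n ≠ 0 :=
  Finset.prod_ne_zero_iff.2 fun k _ => h k

/-! ### Infinite `q`-shifted factorials. -/

section Infinite

variable {p : ℂ} (hp : ‖p‖ < 1)
include hp

lemma summable_norm_pow_mul (a : ℂ) : Summable fun k : ℕ => ‖-(p ^ k * a)‖ := by
  simp only [norm_neg, norm_mul, norm_pow]
  exact (summable_geometric_of_lt_one (norm_nonneg p) hp).mul_right _

lemma multipliable_qPoch (a : ℂ) : Multipliable fun k : ℕ => 1 - p ^ k * a := by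
  simpa [sub_eq_add_neg] using multipliable_one_add_of_summable (summable_norm_pow_mul hp a)

lemma tendsto_qPoch (a : ℂ) : Tendsto (qPoch a p) atTop (𝓝 (qPochInf a p)) :=
  (multipliable_qPoch hp a).tendsto_prod_tprod_nat

lemma qPochInf_succ (a : ℂ) : qPochInf a p = (1 - a) * qPochInf (p * a) p := by
  refine tendsto_nhds_unique ((tendsto_add_atTop_iff_nat 1).2 (tendsto_qPoch hp a)) ?_
  simp only [qPoch_succ']
  exact (tendsto_qPoch hp (p * a)).const_mul _

lemma qPoch_mul_qPochInf (a : ℂ) (n : ℕ) :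
    qPoch a p n * qPochInf (p ^ n * a) p = qPochInf a p := by
  induction n with
  | zero => simp [qPoch_zero]
  | succ n ih =>
    rw [← ih, qPoch_succ, qPochInf_succ hp (p ^ n * a), pow_succ', mul_assoc, mul_assoc]

lemma qPochInf_ne_zero {a : ℂ} (h : ∀ k : ℕ, 1 - p ^ k * a ≠ 0) : qPochInf a p ≠ 0 := by
  have := tprod_one_add_ne_zero_of_summable (f := fun k : ℕ => -(p ^ k * a))
    (fun k => by simpa [sub_eq_add_neg] using h k) (summable_norm_pow_mul hp a)
  simpa [qPochInf, sub_eq_add_neg] using this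

lemma one_sub_ne_zero_of_qPochInf {a : ℂ} (h : qPochInf a p ≠ 0) (k : ℕ) :
    1 - p ^ k * a ≠ 0 := by
  rw [← qPoch_mul_qPochInf hp a (k + 1), qPoch_succ] at h
  exact right_ne_zero_of_mul (left_ne_zero_of_mul h)

lemma qPochInf_ne_zero_of_qPoch {a : ℂ} (h : ∀ n, qPoch a p n ≠ 0) : qPochInf a p ≠ 0 :=
  qPochInf_ne_zero hp (one_sub_ne_zero_of_qPoch h)

lemma qPochInf_pow_ne_zero {a : ℂ} (h : qPochInf a p ≠ 0) (n : ℕ) :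
    qPochInf (p ^ n * a) p ≠ 0 := by
  rw [← qPoch_mul_qPochInf hp a n] at h
  exact right_ne_zero_of_mul h

lemma qPoch_ne_zero_of_qPochInf {a : ℂ} (h : qPochInf a p ≠ 0) (n : ℕ) : qPoch a p n ≠ 0 :=
  qPoch_ne_zero (one_sub_ne_zero_of_qPochInf hp h) n

/-- The tail `(p^n a)_∞` is the full product divided by a partial product. The full product may be
zero, so the argument starts from `p^N a` of modulus less than 1, where no factor vanishes. -/
lemma tendsto_qPochInf_pow (a : ℂ) :
    Tendsto (fun n : ℕ => qPochInf (p ^ n * a) p) atTop (𝓝 1) := by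
  have h0 : Tendsto (fun n : ℕ => p ^ n * a) atTop (𝓝 0) := by
    simpa using (tendsto_pow_atTop_nhds_zero_of_norm_lt_one hp).mul_const a
  obtain ⟨N, hN⟩ : ∃ N : ℕ, ‖p ^ N * a‖ < 1 := by
    have := (h0.norm).eventually (gt_mem_nhds (show ‖(0 : ℂ)‖ < 1 by simp))
    exact this.exists
  have hne : qPochInf (p ^ N * a) p ≠ 0 := by
    refine qPochInf_ne_zero hp fun k h => ?_
    have h1 : ‖p ^ k * (p ^ N * a)‖ < 1 := by
      rw [norm_mul, norm_pow]
      exact mul_lt_one_of_nonneg_of_lt_one_right (pow_le_one₀ (norm_nonneg _) hp.le)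
        (norm_nonneg _) hN
    rw [← sub_eq_zero.1 h] at h1
    simp at h1
  rw [← tendsto_add_atTop_iff_nat N]
  have h2 := (tendsto_const_nhds (x := qPochInf (p ^ N * a) p)).div
    (tendsto_qPoch hp (p ^ N * a)) hne
  rw [div_self hne] at h2
  refine h2.congr fun n => ?_
  rw [Pi.div_apply, div_eq_iff (qPoch_ne_zero_of_qPochInf hp hne n),
    ← qPoch_mul_qPochInf hp (p ^ N * a) n, pow_add]
  ring_nf

end Infinite

/-! ### Terms, convergence and balancing of very-well-poised series. -/

lemma qPoch_mul_neg {a c p : ℂ} (hc : c * c = a) (h1 : ∀ n, qPoch c p n ≠ 0)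
    (h2 : ∀ n, qPoch (-c) p n ≠ 0) (n : ℕ) :
    qPoch (p * c) p n * qPoch (-(p * c)) p n / (qPoch c p n * qPoch (-c) p n) =
      (1 - a * (p ^ n) ^ 2) / (1 - a) := by
  have e1 := one_sub_mul_qPoch c p n
  have e2 := one_sub_mul_qPoch (-c) p n
  have n1 : 1 - c ≠ 0 := by simpa using one_sub_ne_zero_of_qPoch h1 0
  have n2 : 1 - -c ≠ 0 := by simpa using one_sub_ne_zero_of_qPoch h2 0
  have ha : 1 - a = (1 - c) * (1 - -c) := by rw [← hc]; ring
  have hb : 1 - a * (p ^ n) ^ 2 = (1 - p ^ n * c) * (1 - p ^ n * -c) := by rw [← hc]; ring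
  rw [div_eq_div_iff (mul_ne_zero (h1 n) (h2 n)) (ha ▸ mul_ne_zero n1 n2), ha, hb,
    show -(p * c) = p * -c by ring]
  linear_combination ((1 - -c) * qPoch (p * -c) p n) * e1 +
    (qPoch c p n * (1 - p ^ n * c)) * e2

lemma vwp_sqrt_mul_self (a : ℂ) : a ^ (1 / 2 : ℂ) * a ^ (1 / 2 : ℂ) = a := by
  rw [← sq]
  simp

/-- The terms of a very-well-poised series with seven free parameters. -/
lemma phiTerm_vwp {a p : ℂ} {cs : List ℂ} (hlen : cs.length = 7)
    (h : ∀ x ∈ vwpLower a cs p, ∀ n : ℕ, qPoch x p n ≠ 0) (n : ℕ) :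
    phiTerm (vwpUpper a cs p) (vwpLower a cs p) p p n =
      (1 - a * (p ^ n) ^ 2) / (1 - a) * (qPoch a p n * (cs.map fun c => qPoch c p n).prod /
        ((cs.map fun c => qPoch (p * a / c) p n).prod * qPoch p p n)) * p ^ n := by
  -- The parameters `±p √a` over `±√a` collapse to a rational function of `p ^ n`, after which the
  -- choice of square root no longer matters.
  have key := qPoch_mul_neg (vwp_sqrt_mul_self a) (h _ (by simp [vwpLower]))
    (h _ (by simp [vwpLower])) n
  have hl : (1 : ℤ) + (vwpLower a cs p).length - (vwpUpper a cs p).length = 0 := by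
    simp [vwpLower, vwpUpper, hlen]
  rw [phiTerm, hl, zpow_zero, mul_one, ← key]
  simp only [vwpUpper, vwpLower, List.map_cons, List.prod_cons, List.map_map, Function.comp_def]
  congr 1
  rw [div_mul_div_comm]
  congr 1 <;> ring

lemma summable_phiTerm_vwp {a p : ℂ} (hp : ‖p‖ < 1) {cs : List ℂ} (hlen : cs.length = 7)
    (hpp : qPochInf p p ≠ 0)
    (h : ∀ x ∈ vwpLower a cs p, ∀ n : ℕ, qPoch x p n ≠ 0) :
    Summable (phiTerm (vwpUpper a cs p) (vwpLower a cs p) p p) := by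
  have hlim : Tendsto (fun n : ℕ => (1 - a * (p ^ n) ^ 2) / (1 - a) *
      (qPoch a p n * (cs.map fun c => qPoch c p n).prod /
        ((cs.map fun c => qPoch (p * a / c) p n).prod * qPoch p p n))) atTop
      (𝓝 ((1 - a * 0) / (1 - a) * (qPochInf a p * (cs.map fun c => qPochInf c p).prod /
        ((cs.map fun c => qPochInf (p * a / c) p).prod * qPochInf p p)))) := by
    have h0 : Tendsto (fun n : ℕ => (p ^ n) ^ 2) atTop (𝓝 0) := by
      simp only [← pow_mul, mul_comm _ 2]
      simp only [pow_mul]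
      apply tendsto_pow_atTop_nhds_zero_of_norm_lt_one
      rw [norm_pow]
      exact pow_lt_one₀ (norm_nonneg _) hp (by norm_num)
    refine (((h0.const_mul a).const_sub 1).div_const (1 - a)).mul (Tendsto.div ?_ ?_ ?_)
    · exact (tendsto_qPoch hp a).mul (tendsto_list_prod cs fun c _ => tendsto_qPoch hp c)
    · exact (tendsto_list_prod cs fun c _ => tendsto_qPoch hp (p * a / c)).mul (tendsto_qPoch hp p)
    · refine mul_ne_zero (List.prod_ne_zero fun h0 => ?_) hpp
      obtain ⟨c, hc, hc0⟩ := List.mem_map.1 h0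
      refine qPochInf_ne_zero_of_qPoch hp (h _ ?_) hc0
      simp only [vwpLower, List.mem_cons, List.mem_map]
      exact Or.inr (Or.inr ⟨c, hc, rfl⟩)
  -- A convergent, hence bounded, sequence times `p ^ n` is dominated by a geometric series.
  have hO := (hlim.isBigO_one ℂ).mul (Asymptotics.isBigO_refl (fun n : ℕ => p ^ n) atTop)
  simp only [one_mul] at hO
  refine summable_of_isBigO_nat
    (summable_geometric_of_lt_one (norm_nonneg p) hp) (g := fun n => ‖p‖ ^ n) ?_
  have : (fun n => phiTerm (vwpUpper a cs p) (vwpLower a cs p) p p n) =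
    fun n => (1 - a * (p ^ n) ^ 2) / (1 - a) * (qPoch a p n * (cs.map fun c => qPoch c p n).prod /
        ((cs.map fun c => qPoch (p * a / c) p n).prod * qPoch p p n)) * p ^ n :=
    funext (phiTerm_vwp hlen h)
  simp only [← norm_pow]
  rw [Asymptotics.isBigO_norm_right]
  rw [← this] at hO
  exact hO

lemma qPochInf_self_ne_zero {p : ℂ} (hp : ‖p‖ < 1) : qPochInf p p ≠ 0 := by
  refine qPochInf_ne_zero hp fun k h => ?_
  have h1 : ‖p ^ (k + 1)‖ < 1 := by
    rw [norm_pow]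
    exact pow_lt_one₀ (norm_nonneg _) hp (by omega)
  rw [pow_succ, ← sub_eq_zero.1 h] at h1
  simp at h1

/-- Each lower parameter is `p a / c`, so the product of the `c` occurs inverted below. Clearing it
leaves a condition on the square of that product only. -/
lemma vwpBalanced_of_prod {a p : ℂ} (hp : ‖p‖ < 1) {cs : List ℂ} (hlen : cs.length = 7)
    (h : ∀ x ∈ vwpLower a cs p, ∀ n : ℕ, qPoch x p n ≠ 0) (h0 : cs.prod ≠ 0)
    (hprod : cs.prod ^ 2 = p ^ 4 * a ^ 6) : VwpBalanced a cs p p := by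
  refine ⟨h, summable_phiTerm_vwp hp hlen (qPochInf_self_ne_zero hp) h, ?_, rfl⟩
  have hs := vwp_sqrt_mul_self a
  obtain ⟨c1, c2, c3, c4, c5, c6, c7, rfl⟩ : ∃ c1 c2 c3 c4 c5 c6 c7,
      cs = [c1, c2, c3, c4, c5, c6, c7] := by
    rcases cs with _ | ⟨c1, _ | ⟨c2, _ | ⟨c3, _ | ⟨c4, _ | ⟨c5, _ | ⟨c6, _ | ⟨c7, _ | _⟩⟩⟩⟩⟩⟩⟩ <;>
      simp_all
  simp only [List.prod_cons, List.prod_nil, mul_one, vwpUpper, vwpLower, List.map_cons,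
    List.map_nil] at *
  set w := a ^ (1 / 2 : ℂ)
  simp only [ne_eq, mul_eq_zero, not_or] at h0
  obtain ⟨g1, g2, g3, g4, g5, g6, g7⟩ := h0
  field_simp
  linear_combination (-p ^ 3 * a * w * w) * hprod

/-! ### `Φ`, suitably normalised, as a sum over two geometric progressions. -/

/-- Regularised terms of the first series of `Φ`. -/
def firstTerm (p a₀ a₁ a₂ : ℂ) (d : Fin 5 → ℂ) (n : ℕ) : ℂ :=
  p ^ n * (1 - a₀ * (p ^ n) ^ 2) * (qPoch a₀ p n * qPochInf (p * p ^ n) p) *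
    (qPoch a₁ p n * qPochInf (p * a₀ * p ^ n / a₁) p) *
    (qPoch a₂ p n * qPochInf (p * a₀ * p ^ n / a₂) p) *
    ((∏ i, qPoch (d i) p n) * ∏ i, qPochInf (p * a₀ * p ^ n / d i) p)

/-- Regularised terms of the second series of `Φ`; here `x` stands for `(a₇ / a₀) p ^ n`. -/
def secondTerm (p a₀ a₁ a₂ : ℂ) (d : Fin 5 → ℂ) (n : ℕ) (x : ℂ) : ℂ :=
  -(x * (1 - a₀ * x ^ 2)) * (qPochInf a₀ p / qPochInf (d 4 * x) p * qPochInf (p * x) p) *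
    (qPochInf a₁ p / qPochInf (a₁ * x) p * qPochInf (p * a₀ * x / a₁) p) *
    (qPochInf a₂ p / qPochInf (a₂ * x) p * qPochInf (p * a₀ * x / a₂) p) *
    ((∏ i : Fin 4, qPochInf (d i.castSucc) p / qPochInf (d i.castSucc * x) p) * qPoch (d 4) p n *
      ∏ i, qPochInf (p * a₀ * x / d i) p)

/-- The normalising factor of `Φ`. -/
def normFactor (p a₀ a₁ a₂ : ℂ) (d : Fin 5 → ℂ) : ℂ :=
  (1 - a₀) * qPochInf p p * qPochInf (p * a₀ / a₁) p * qPochInf (p * a₀ / a₂) p *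
    ∏ i, qPochInf (p * a₀ / d i) p

/-- The parameters as a single vector. -/
def paramVec (a₀ a₁ a₂ : ℂ) (d : Fin 5 → ℂ) : Fin 8 → ℂ :=
  ![a₀, a₁, a₂, d 0, d 1, d 2, d 3, d 4]

section NormalForm

variable {q a₀ a₁ a₂ : ℂ} {d : Fin 5 → ℂ}

lemma norm_sq_lt_one (hq : ‖q‖ < 1) : ‖q ^ 2‖ < 1 := by
  rw [norm_pow]
  exact pow_lt_one₀ (norm_nonneg _) hq (by norm_num)

/-- The nonvanishing conditions contained in `PhiDefined`, spelled out. -/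
structure PhiNonzero (p a₀ a₁ a₂ : ℂ) (d : Fin 5 → ℂ) : Prop where
  a₀_ne : a₀ ≠ 0
  a₁_ne : a₁ ≠ 0
  a₂_ne : a₂ ≠ 0
  d_ne : ∀ i, d i ≠ 0
  one_sub_ne : 1 - a₀ ≠ 0
  one_sub_ne' : 1 - d 4 ^ 2 / a₀ ≠ 0
  y_ne : d 4 / a₀ ≠ 1
  lower₁ : qPochInf (p * a₀ / a₁) p ≠ 0
  lower₂ : qPochInf (p * a₀ / a₂) p ≠ 0
  lower_d : ∀ i, qPochInf (p * a₀ / d i) p ≠ 0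
  lower₀' : qPochInf (p * (d 4 / a₀)) p ≠ 0
  lower₁' : qPochInf (p * d 4 / a₁) p ≠ 0
  lower₂' : qPochInf (p * d 4 / a₂) p ≠ 0
  lower_d' : ∀ i, qPochInf (p * d 4 / d i) p ≠ 0
  upper₁' : qPochInf (a₁ * (d 4 / a₀)) p ≠ 0
  upper₂' : qPochInf (a₂ * (d 4 / a₀)) p ≠ 0
  upper_d' : ∀ i, qPochInf (d i * (d 4 / a₀)) p ≠ 0

lemma PhiDefined.phiNonzero (hq : ‖q‖ < 1) (h : PhiDefined q (paramVec a₀ a₁ a₂ d)) :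
    PhiNonzero (q ^ 2) a₀ a₁ a₂ d := by
  have hp := norm_sq_lt_one hq
  have c0 : a₀ ≠ 0 := h.param_ne 0
  have c1 : a₁ ≠ 0 := h.param_ne 1
  have c2 : a₂ ≠ 0 := h.param_ne 2
  have e0 : d 0 ≠ 0 := h.param_ne 3
  have e1 : d 1 ≠ 0 := h.param_ne 4
  have e2 : d 2 ≠ 0 := h.param_ne 5
  have e3 : d 3 ≠ 0 := h.param_ne 6
  have e4 : d 4 ≠ 0 := h.param_ne 7
  have hd : ∀ i, d i ≠ 0 := by intro i; fin_cases i <;> assumption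
  have sq_ne : ∀ {a : ℂ} {cs : List ℂ},
      (∀ x ∈ vwpLower a cs (q ^ 2), ∀ n : ℕ, qPoch x (q ^ 2) n ≠ 0) → 1 - a ≠ 0 := by
    intro a cs h
    have h1 := one_sub_ne_zero_of_qPoch (h (a ^ (1 / 2 : ℂ)) (by simp [vwpLower])) 0
    have h2 := one_sub_ne_zero_of_qPoch (h (-(a ^ (1 / 2 : ℂ))) (by simp [vwpLower])) 0
    have h3 := vwp_sqrt_mul_self a
    have : 1 - a = (1 - (q ^ 2) ^ 0 * a ^ (1 / 2 : ℂ)) * (1 - (q ^ 2) ^ 0 * -(a ^ (1 / 2 : ℂ))) := by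
      linear_combination h3
    rw [this]
    exact mul_ne_zero h1 h2
  have hlow : ∀ c ∈ phiParams (paramVec a₀ a₁ a₂ d), qPochInf (q ^ 2 * a₀ / c) (q ^ 2) ≠ 0 := by
    intro c hc
    refine qPochInf_ne_zero_of_qPoch hp (h.lower_ne _ ?_)
    simp only [vwpLower, List.mem_cons, List.mem_map]
    exact Or.inr (Or.inr ⟨c, hc, rfl⟩)
  have hlow' : ∀ c ∈ phiParams' (paramVec a₀ a₁ a₂ d),
      qPochInf (q ^ 2 * (d 4 ^ 2 / a₀) / c) (q ^ 2) ≠ 0 := by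
    intro c hc
    refine qPochInf_ne_zero_of_qPoch hp (h.lower_ne' _ ?_)
    simp only [vwpLower, List.mem_cons, List.mem_map]
    exact Or.inr (Or.inr ⟨c, hc, rfl⟩)
  simp only [phiParams, phiParams', paramVec, List.mem_cons, List.not_mem_nil, or_false,
    forall_eq_or_imp, forall_eq, Matrix.cons_val] at hlow hlow'
  obtain ⟨l1, l2, l3, l4, l5, l6, l7⟩ := hlow
  obtain ⟨m1, m2, m3, m4, m5, m6, m7⟩ := hlow'
  have hc := h.coeffDen_ne
  simp only [phiCoeffDen, paramVec, Matrix.cons_val] at hc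
  rw [Finset.prod_insert (by decide), Finset.prod_insert (by decide),
    Finset.prod_insert (by decide), Finset.prod_insert (by decide),
    Finset.prod_insert (by decide), Finset.prod_singleton] at hc
  simp only [Matrix.cons_val, ne_eq, mul_eq_zero, not_or] at hc
  obtain ⟨⟨k0, k7⟩, ⟨_, k1⟩, ⟨_, k2⟩, ⟨_, k3⟩, ⟨_, k4⟩, ⟨_, k5⟩, ⟨_, k6⟩⟩ := hc
  have key : ∀ c ≠ 0, q ^ 2 * (d 4 ^ 2 / a₀) / (c * d 4 / a₀) = q ^ 2 * d 4 / c := by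
    intro c hc; field_simp
  rw [key _ ‹_›] at m1 m2 m3 m4 m5 m6
  have hpp := qPochInf_self_ne_zero hp
  refine ⟨c0, c1, c2, hd, sq_ne h.lower_ne, sq_ne h.lower_ne', ?_, l1, l2, ?_, ?_, m1, m2, ?_,
    by rwa [← mul_div_assoc], by rwa [← mul_div_assoc], ?_⟩
  -- If `a₇ = a₀`, the factor `(a₀/a₇)_∞` of the coefficient's denominator starts with zero.
  · intro hy
    refine one_sub_ne_zero_of_qPochInf hp k0 0 ?_
    rw [div_eq_one_iff_eq c0] at hy
    simp [hy, c0]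
  · intro i; fin_cases i <;> assumption
  · convert m7 using 2; field_simp
  · intro i; fin_cases i
    · exact m3
    · exact m4
    · exact m5
    · exact m6
    · simpa [e4, mul_div_assoc] using hpp
  · intro i; rw [← mul_div_assoc]; fin_cases i
    · exact k3
    · exact k4
    · exact k5
    · exact k6
    -- The product `(a₇²/a₀)_∞` is not among the six factors of the coefficient. Its first factor is
    -- nonzero because of the lower parameters `±√(a₇²/a₀)` of the second series, and the rest is
    -- `(p a₇²/a₀)_∞`.
    · have h1 := sq_ne h.lower_ne'
      simp only [paramVec, Matrix.cons_val] at h1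
      change qPochInf (d 4 * d 4 / a₀) (q ^ 2) ≠ 0
      rw [← sq, qPochInf_succ hp, ← mul_div_assoc]
      exact mul_ne_zero h1 k7

/-- The `u` are upper finite products, the `v` lower ones and the `w` the infinite tails, so that
each `v * w` is a full infinite product from `normFactor`. -/
lemma firstTerm_algebra {P A B u₀ u₁ u₂ u₃ u₄ u₅ u₆ u₇ v₀ v₁ v₂ v₃ v₄ v₅ v₆ v₇
    w₀ w₁ w₂ w₃ w₄ w₅ w₆ w₇ : ℂ} (hB : B ≠ 0) (h₀ : v₀ ≠ 0) (h₁ : v₁ ≠ 0) (h₂ : v₂ ≠ 0)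
    (h₃ : v₃ ≠ 0) (h₄ : v₄ ≠ 0) (h₅ : v₅ ≠ 0) (h₆ : v₆ ≠ 0) (h₇ : v₇ ≠ 0) :
    P * (1 - A * P ^ 2) * (u₀ * w₀) * (u₁ * w₁) * (u₂ * w₂) *
        (u₃ * u₄ * u₅ * u₆ * u₇ * (w₃ * w₄ * w₅ * w₆ * w₇)) =
      B * (v₀ * w₀) * (v₁ * w₁) * (v₂ * w₂) *
        (v₃ * w₃ * (v₄ * w₄) * (v₅ * w₅) * (v₆ * w₆) * (v₇ * w₇)) *
      ((1 - A * P ^ 2) / B * (u₀ * (u₁ * (u₂ * (u₃ * (u₄ * (u₅ * (u₆ * u₇)))))) /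
        (v₁ * (v₂ * (v₃ * (v₄ * (v₅ * (v₆ * v₇))))) * v₀)) * P) := by
  have key : ∀ {u v w : ℂ}, v ≠ 0 → u * w = v * w * (u / v) := by
    intro u v w hv
    field_simp
  rw [key h₀, key h₁, key h₂, show u₃ * u₄ * u₅ * u₆ * u₇ * (w₃ * w₄ * w₅ * w₆ * w₇) =
    (u₃ * w₃) * (u₄ * w₄) * (u₅ * w₅) * (u₆ * w₆) * (u₇ * w₇) by ring, key h₃, key h₄, key h₅,
    key h₆, key h₇, show (1 - A * P ^ 2) = B * ((1 - A * P ^ 2) / B) by field_simp]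
  generalize (1 - A * P ^ 2) / B = R
  rw [mul_div_cancel_left₀ _ hB]
  ring

/-- With `y = a₇/a₀` and `D = 1 - a₀/a₇`, the hypothesis `hy` produces the sign of `secondTerm`. The
hypothesis `hiv` splits `(a₇²/a₀)_∞` in two ways, after `n` factors and after one. -/
lemma secondTerm_algebra {P Q Q' y D u v w r i j c g h A L m n e f l z : ℂ} (hQ : Q' ≠ 0)
    (hD : D ≠ 0) (hl : l ≠ 0) (hj : j ≠ 0) (hr : r ≠ 0) (hv : v ≠ 0)
    (hz : z ≠ 0) (hL : L ≠ 0) (hm : m ≠ 0) (he : e ≠ 0) (hf : f ≠ 0) (hy : -y * D = 1 - y)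
    (hiv : i * v = Q' * z) :
    -(y * P * Q) * (c * u / v * g) * (A / f * n) * (h * w) =
      c * (r * w) * L * l * ((u * ((1 - y) * (j * g)) * (A * (m * n))) /
        (D * l * z * (L * (e * f)))) *
      (Q / Q' * (i * (e * h) / (m * j * r)) * P) := by
  have hi : i = Q' * z / v := by rw [eq_div_iff hv, hiv]
  rw [← hy, hi]
  field_simp

lemma prod_one_to_six (F : Fin 8 → ℂ) :
    ∏ k ∈ ({1, 2, 3, 4, 5, 6} : Finset (Fin 8)), F k = F 1 * F 2 * F 3 * F 4 * F 5 * F 6 := by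
  rw [Finset.prod_insert (by decide), Finset.prod_insert (by decide),
    Finset.prod_insert (by decide), Finset.prod_insert (by decide),
    Finset.prod_insert (by decide), Finset.prod_singleton]
  ring

/-- The normalised function `Φ` is a sum over two geometric progressions. -/
theorem normFactor_mul_Phi (hq : ‖q‖ < 1) (h : PhiDefined q (paramVec a₀ a₁ a₂ d)) :
    Summable (firstTerm (q ^ 2) a₀ a₁ a₂ d) ∧
    Summable (fun n => secondTerm (q ^ 2) a₀ a₁ a₂ d n (d 4 / a₀ * (q ^ 2) ^ n)) ∧
    normFactor (q ^ 2) a₀ a₁ a₂ d * Phi q (paramVec a₀ a₁ a₂ d) =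
      ∑' n, firstTerm (q ^ 2) a₀ a₁ a₂ d n +
        ∑' n, secondTerm (q ^ 2) a₀ a₁ a₂ d n (d 4 / a₀ * (q ^ 2) ^ n) := by
  have hp := norm_sq_lt_one hq
  have hz := h.phiNonzero hq
  have hpp := qPochInf_self_ne_zero hp
  have s1 := summable_phiTerm_vwp hp (cs := phiParams (paramVec a₀ a₁ a₂ d)) rfl hpp h.lower_ne
  have s2 := summable_phiTerm_vwp hp (cs := phiParams' (paramVec a₀ a₁ a₂ d)) rfl hpp h.lower_ne'
  have t1 := phiTerm_vwp (cs := phiParams (paramVec a₀ a₁ a₂ d)) rfl h.lower_ne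
  have t2 := phiTerm_vwp (cs := phiParams' (paramVec a₀ a₁ a₂ d)) rfl h.lower_ne'
  have u1 : ∀ n, firstTerm (q ^ 2) a₀ a₁ a₂ d n = normFactor (q ^ 2) a₀ a₁ a₂ d *
      phiTerm (vwpUpper (paramVec a₀ a₁ a₂ d 0) (phiParams (paramVec a₀ a₁ a₂ d)) (q ^ 2))
        (vwpLower (paramVec a₀ a₁ a₂ d 0) (phiParams (paramVec a₀ a₁ a₂ d)) (q ^ 2))
        (q ^ 2) (q ^ 2) n := by
    intro n
    rw [t1]
    simp only [phiParams, paramVec, Matrix.cons_val, List.map_cons, List.map_nil, List.prod_cons,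
      List.prod_nil, mul_one, firstTerm, normFactor, Fin.prod_univ_five]
    -- Each lower infinite product is split after `n` factors: the finite part cancels the
    -- denominator of the term and the tail stays in `firstTerm`.
    generalize q ^ 2 = p at *
    have key : ∀ c, qPochInf (p * a₀ / c) p =
        qPoch (p * a₀ / c) p n * qPochInf (p * a₀ * p ^ n / c) p := by
      intro c
      rw [← qPoch_mul_qPochInf hp _ n]; ring_nf
    have key' : qPochInf p p = qPoch p p n * qPochInf (p * p ^ n) p := by
      rw [← qPoch_mul_qPochInf hp _ n]; ring_nf
    have z1 := hz.lower₁
    have z2 := hz.lower₂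
    have z3 := hz.lower_d 0
    have z4 := hz.lower_d 1
    have z5 := hz.lower_d 2
    have z6 := hz.lower_d 3
    have z7 := hz.lower_d 4
    have z0 := hz.one_sub_ne
    have zp := hpp
    rw [key] at z1 z2 z3 z4 z5 z6 z7
    rw [key'] at zp
    rw [key a₁, key a₂, key (d 0), key (d 1), key (d 2), key (d 3), key (d 4), key']
    exact firstTerm_algebra z0 (left_ne_zero_of_mul zp) (left_ne_zero_of_mul z1)
      (left_ne_zero_of_mul z2) (left_ne_zero_of_mul z3) (left_ne_zero_of_mul z4)
      (left_ne_zero_of_mul z5) (left_ne_zero_of_mul z6) (left_ne_zero_of_mul z7)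
  have u2 : ∀ n, secondTerm (q ^ 2) a₀ a₁ a₂ d n (d 4 / a₀ * (q ^ 2) ^ n) =
      normFactor (q ^ 2) a₀ a₁ a₂ d *
      (phiCoeffNum (q ^ 2) (paramVec a₀ a₁ a₂ d) / phiCoeffDen (q ^ 2) (paramVec a₀ a₁ a₂ d)) *
      phiTerm (vwpUpper (paramVec a₀ a₁ a₂ d 7 ^ 2 / paramVec a₀ a₁ a₂ d 0)
          (phiParams' (paramVec a₀ a₁ a₂ d)) (q ^ 2))
        (vwpLower (paramVec a₀ a₁ a₂ d 7 ^ 2 / paramVec a₀ a₁ a₂ d 0)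
          (phiParams' (paramVec a₀ a₁ a₂ d)) (q ^ 2))
        (q ^ 2) (q ^ 2) n := by
    intro n
    rw [t2]
    generalize q ^ 2 = p at *
    have hy0 := hz.a₀_ne
    have hd4 := hz.d_ne 4
    have hD : 1 - a₀ / d 4 ≠ 0 := fun h0 =>
      hz.y_ne (by rw [sub_eq_zero, eq_div_iff hd4] at h0; rw [div_eq_one_iff_eq hy0]; simpa using h0)
    have hn : ∀ k ∈ ({1, 2, 3, 4, 5, 6} : Finset (Fin 8)), paramVec a₀ a₁ a₂ d k ≠ 0 ∧
        qPochInf (p * a₀ / paramVec a₀ a₁ a₂ d k) p ≠ 0 ∧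
        qPochInf (p * d 4 / paramVec a₀ a₁ a₂ d k) p ≠ 0 ∧
        qPochInf (paramVec a₀ a₁ a₂ d k * (d 4 / a₀)) p ≠ 0 := by
      intro k hk
      simp only [Finset.mem_insert, Finset.mem_singleton] at hk
      rcases hk with rfl | rfl | rfl | rfl | rfl | rfl
      · exact ⟨hz.a₁_ne, hz.lower₁, hz.lower₁', hz.upper₁'⟩
      · exact ⟨hz.a₂_ne, hz.lower₂, hz.lower₂', hz.upper₂'⟩
      · exact ⟨hz.d_ne 0, hz.lower_d 0, hz.lower_d' 0, hz.upper_d' 0⟩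
      · exact ⟨hz.d_ne 1, hz.lower_d 1, hz.lower_d' 1, hz.upper_d' 1⟩
      · exact ⟨hz.d_ne 2, hz.lower_d 2, hz.lower_d' 2, hz.upper_d' 2⟩
      · exact ⟨hz.d_ne 3, hz.lower_d 3, hz.lower_d' 3, hz.upper_d' 3⟩
    set S : Finset (Fin 8) := {1, 2, 3, 4, 5, 6} with hS
    set α := paramVec a₀ a₁ a₂ d with hα
    set y := d 4 / a₀ with hy
    set x := y * p ^ n with hx
    have split : ∀ c, qPoch c p n * qPochInf (c * p ^ n) p = qPochInf c p := by
      intro c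
      rw [mul_comm c, qPoch_mul_qPochInf hp]
    have x1 : d 4 * x = d 4 ^ 2 / a₀ * p ^ n := by rw [hx, hy]; ring
    have x2 : ∀ c, p * a₀ * x / c = p * d 4 / c * p ^ n := by
      intro c; rw [hx, hy]; field_simp
    have x3 : p * a₀ * x / d 4 = p * p ^ n := by rw [hx, hy]; field_simp
    have x4 : p * x = p * y * p ^ n := by rw [hx]; ring
    have x5 : ∀ c, c * x = c * y * p ^ n := by intro c; rw [hx]; ring
    have e1 : secondTerm p a₀ a₁ a₂ d n x = -(x * (1 - a₀ * x ^ 2)) *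
        (qPochInf a₀ p / qPochInf (d 4 * x) p * qPochInf (p * x) p) *
        ((∏ k ∈ S, qPochInf (α k) p) / (∏ k ∈ S, qPochInf (α k * x) p) *
          ∏ k ∈ S, qPochInf (p * a₀ * x / α k) p) *
        (qPoch (d 4) p n * qPochInf (p * a₀ * x / d 4) p) := by
      rw [← Finset.prod_div_distrib, ← Finset.prod_mul_distrib, hS, prod_one_to_six]
      simp only [hα, paramVec, Matrix.cons_val, secondTerm, Fin.prod_univ_five,
        Fin.prod_univ_four]
      change _ * (qPochInf (d 0) p / qPochInf (d 0 * x) p *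
        (qPochInf (d 1) p / qPochInf (d 1 * x) p) * (qPochInf (d 2) p / qPochInf (d 2 * x) p) *
        (qPochInf (d 3) p / qPochInf (d 3 * x) p) * _ * _) = _
      ring
    have e2 : normFactor p a₀ a₁ a₂ d = (1 - a₀) * qPochInf p p *
        (∏ k ∈ S, qPochInf (p * a₀ / α k) p) * qPochInf (p * a₀ / d 4) p := by
      rw [hS, prod_one_to_six]
      simp only [hα, paramVec, Matrix.cons_val, normFactor, Fin.prod_univ_five]
      ring
    have m1 : ∀ k ∈ S, qPoch (p * (d 4 ^ 2 / a₀) / (α k * d 4 / a₀)) p n =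
        qPoch (p * d 4 / α k) p n := by
      intro k hk
      have := (hn k hk).1
      congr 1; field_simp
    have e3 : ((phiParams' α).map fun c => qPoch c p n).prod =
        (∏ k ∈ S, qPoch (α k * y) p n) * qPoch (d 4) p n := by
      rw [hS, prod_one_to_six]
      simp only [phiParams', List.map_cons, List.map_nil, List.prod_cons, List.prod_nil, hα,
        paramVec, Matrix.cons_val, hy, mul_div_assoc]
      ring
    have e4 : ((phiParams' α).map fun c => qPoch (p * (α 7 ^ 2 / α 0) / c) p n).prod =
        (∏ k ∈ S, qPoch (p * d 4 / α k) p n) * qPoch (p * y) p n := by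
      rw [← Finset.prod_congr rfl m1, hS, prod_one_to_six]
      have : p * y = p * (d 4 ^ 2 / a₀) / d 4 := by rw [hy]; field_simp
      rw [this]
      simp only [phiParams', List.map_cons, List.map_nil, List.prod_cons, List.prod_nil, hα,
        paramVec, Matrix.cons_val, mul_one, mul_assoc]
    have e5 : phiCoeffNum p α = qPochInf (p * a₀) p * qPochInf y p *
        ((∏ k ∈ S, qPochInf (α k) p) * ∏ k ∈ S, qPochInf (p * d 4 / α k) p) := by
      rw [phiCoeffNum, Finset.prod_mul_distrib]; rfl
    have e6 : phiCoeffDen p α = qPochInf (a₀ / d 4) p * qPochInf (p * (d 4 ^ 2 / a₀)) p *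
        ((∏ k ∈ S, qPochInf (p * a₀ / α k) p) * ∏ k ∈ S, qPochInf (α k * y) p) := by
      rw [phiCoeffDen, Finset.prod_mul_distrib]
      simp only [hy, ← mul_div_assoc]
      rfl
    have f1 : ∏ k ∈ S, qPochInf (p * d 4 / α k) p = (∏ k ∈ S, qPoch (p * d 4 / α k) p n) *
        ∏ k ∈ S, qPochInf (p * a₀ * x / α k) p := by
      rw [← Finset.prod_mul_distrib]
      exact Finset.prod_congr rfl fun k _ => by rw [x2, split]
    have f2 : ∏ k ∈ S, qPochInf (α k * y) p = (∏ k ∈ S, qPoch (α k * y) p n) *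
        ∏ k ∈ S, qPochInf (α k * x) p := by
      rw [← Finset.prod_mul_distrib]
      exact Finset.prod_congr rfl fun k _ => by rw [x5, split]
    -- The coefficient contains `(y)_∞` while the series only has `(p y)_n` below, so one factor `1
    -- - y` is left over. It is matched with `1 - a₀/a₇` in `f4`.
    have f3 : qPochInf y p = (1 - y) * (qPoch (p * y) p n * qPochInf (p * x) p) := by
      rw [x4, split, ← qPochInf_succ hp]
    have f4 : qPochInf (a₀ / d 4) p = (1 - a₀ / d 4) * qPochInf (p * a₀ / d 4) p := by
      rw [qPochInf_succ hp, ← mul_div_assoc]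
    have f5 : qPochInf p p = qPoch p p n * qPochInf (p * a₀ * x / d 4) p := by
      rw [x3, split]
    have f6 : qPochInf a₀ p = (1 - a₀) * qPochInf (p * a₀) p := qPochInf_succ hp a₀
    have f7 : qPoch (d 4 ^ 2 / a₀) p n * qPochInf (d 4 * x) p =
        (1 - d 4 ^ 2 / a₀) * qPochInf (p * (d 4 ^ 2 / a₀)) p := by
      rw [x1, split, ← qPochInf_succ hp]
    have q1 : 1 - a₀ * x ^ 2 = 1 - d 4 ^ 2 / a₀ * (p ^ n) ^ 2 := by
      rw [hx, hy]; field_simp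
    have g1 : qPochInf (d 4 * (d 4 / a₀)) p ≠ 0 := hz.upper_d' 4
    have g2 : qPochInf (d 4 ^ 2 / a₀) p ≠ 0 := by convert g1 using 2; ring
    have g3 : qPochInf (p * (d 4 ^ 2 / a₀)) p ≠ 0 := by
      rw [qPochInf_succ hp] at g2; exact right_ne_zero_of_mul g2
    rw [e1, e2, e3, e4, e5, e6, f1, f2, f3, f4, f5, f6, q1]
    refine secondTerm_algebra hz.one_sub_ne' hD (hz.lower_d 4)
      (qPoch_ne_zero_of_qPochInf hp hz.lower₀' n) (qPoch_ne_zero_of_qPochInf hp hpp n)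
      ?_ g3 (Finset.prod_ne_zero_iff.2 fun k hk => (hn k hk).2.1)
      (Finset.prod_ne_zero_iff.2 fun k hk =>
        qPoch_ne_zero_of_qPochInf hp (hn k hk).2.2.1 n)
      (Finset.prod_ne_zero_iff.2 fun k hk =>
        qPoch_ne_zero_of_qPochInf hp (hn k hk).2.2.2 n)
      (Finset.prod_ne_zero_iff.2 fun k hk => ?_) ?_ f7
    · rw [x1, mul_comm]
      exact qPochInf_pow_ne_zero hp g2 n
    · rw [x5, mul_comm]
      exact qPochInf_pow_ne_zero hp (hn k hk).2.2.2 n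
    · rw [hy]; field_simp; ring
  refine ⟨?_, ?_, ?_⟩
  · rw [funext u1]
    exact s1.mul_left _
  · simp only [u2]
    exact s2.mul_left _
  · rw [Phi, vwpW, vwpW, basicPhi, basicPhi, mul_add, ← mul_assoc, ← tsum_mul_left,
      ← tsum_mul_left]
    simp only [u1, u2]

end NormalForm

/-! ### The upward contiguity relation, term by term. -/

section Upward

variable {p a₀ a₁ a₂ : ℂ} {d : Fin 5 → ℂ}

lemma firstTerm_zero : firstTerm p a₀ a₁ a₂ d 0 = normFactor p a₀ a₁ a₂ d := by
  simp only [firstTerm, normFactor, pow_zero, qPoch_zero, Finset.prod_const_one, mul_one, one_mul]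
  ring

lemma prod_qPoch_succ (d : Fin 5 → ℂ) (n : ℕ) : ∏ i, qPoch (d i) p (n + 1) =
    (∏ i, (1 - d i)) * ∏ i, qPoch (p * d i) p n := by
  rw [← Finset.prod_mul_distrib]
  exact Finset.prod_congr rfl fun i _ => qPoch_succ' _ _ _

/-- On the left stands a polynomial of degree at most two in `X`, invariant under `X ↦ 1/(a₀ X)` up
to the factor `a₀ X²` and zero at `X = 1`. It is therefore a multiple of `(1 - X)(1 - a₀ X)`, and `X
= 0` gives the constant. -/
lemma up_identity {X a₁ a₂ : ℂ} (hp0 : p ≠ 0) (h₁ : a₁ ≠ 0) (h₂ : a₂ ≠ 0) :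
    (1 - p * a₀ / a₁) * ((1 - a₁ / p) * ((1 - a₂ * X) * (1 - a₀ * X / a₂))) -
      (1 - a₀ / a₂) * ((1 - a₂) * ((1 - a₁ * X / p) * (1 - p * a₀ * X / a₁))) =
    (a₂ + a₀ / a₂ - p * a₀ / a₁ - a₁ / p) * ((1 - X) * (1 - a₀ * X)) := by
  field_simp
  ring

variable (hp : ‖p‖ < 1)
include hp

lemma prod_qPochInf_succ {ι : Type*} [Fintype ι] (d : ι → ℂ) : ∏ i, qPochInf (d i) p =
    (∏ i, (1 - d i)) * ∏ i, qPochInf (p * d i) p := by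
  rw [← Finset.prod_mul_distrib]
  exact Finset.prod_congr rfl fun i _ => qPochInf_succ hp _

/-- By `firstTerm_zero` this is the cancellation of the two zeroth terms in the upward relation. -/
lemma normFactor_up (hp0 : p ≠ 0) (h₁ : a₁ ≠ 0) (h₂ : a₂ ≠ 0) :
    (1 - p * a₀ / a₁) * normFactor p a₀ (a₁ / p) (p * a₂) d =
      (1 - a₀ / a₂) * normFactor p a₀ a₁ a₂ d := by
  rw [normFactor, normFactor, show p * a₀ / (a₁ / p) = p * (p * a₀ / a₁) by field_simp,
    show p * a₀ / (p * a₂) = a₀ / a₂ by field_simp, qPochInf_succ hp (a₀ / a₂),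
    qPochInf_succ hp (p * a₀ / a₁), show p * (a₀ / a₂) = p * a₀ / a₂ by ring]
  ring

/-- Compares the normalisations before and after the shift, to return from the regularised sums to
`Φ` itself. -/
lemma normFactor_shift (hp0 : p ≠ 0) :
    (1 - p ^ 2 * a₀) * normFactor p a₀ a₁ a₂ d =
      (1 - a₀) * (1 - p * a₀ / a₁) * (1 - p ^ 2 * a₀ / a₁) * (1 - p * a₀ / a₂) *
        (∏ i, (1 - p * a₀ / d i)) *
        normFactor p (p ^ 2 * a₀) a₁ (p * a₂) (fun i => p * d i) := by
  have e : ∀ c, p * (p ^ 2 * a₀) / (p * c) = p * (p * a₀ / c) := by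
    intro c
    rw [mul_div_mul_left _ _ hp0]; ring
  simp only [normFactor, e]
  rw [qPochInf_succ hp (p * a₀ / a₁), qPochInf_succ hp (p * (p * a₀ / a₁)),
    qPochInf_succ hp (p * a₀ / a₂), prod_qPochInf_succ hp fun i => p * a₀ / d i,
    show p * (p * (p * a₀ / a₁)) = p * (p ^ 2 * a₀) / a₁ by ring]
  ring

lemma firstTerm_up (hp0 : p ≠ 0) (h₁ : a₁ ≠ 0) (h₂ : a₂ ≠ 0) (n : ℕ) :
    (1 - p * a₀ / a₁) * firstTerm p a₀ (a₁ / p) (p * a₂) d (n + 1) -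
      (1 - a₀ / a₂) * firstTerm p a₀ a₁ a₂ d (n + 1) =
    (a₂ + a₀ / a₂ - p * a₀ / a₁ - a₁ / p) * p * (1 - a₀) * (1 - p * a₀) * (∏ i, (1 - d i)) *
      firstTerm p (p ^ 2 * a₀) a₁ (p * a₂) (fun i => p * d i) n := by
  have hX : p ^ n = p ^ (n + 1) / p := by rw [pow_succ]; field_simp
  have e0 : (1 - p * a₀) * qPoch (p ^ 2 * a₀) p n = qPoch (p * a₀) p n * (1 - a₀ * p ^ (n + 1)) := by
    have := one_sub_mul_qPoch (p * a₀) p n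
    rw [show p * (p * a₀) = p ^ 2 * a₀ by ring] at this
    rw [this]; ring
  have e1 : qPoch (a₁ / p) p (n + 1) = (1 - a₁ / p) * qPoch a₁ p n := by
    rw [qPoch_succ', mul_div_cancel₀ _ hp0]
  have e2 : qPoch a₁ p (n + 1) = qPoch a₁ p n * (1 - a₁ * p ^ (n + 1) / p) := by
    rw [qPoch_succ, pow_succ]; field_simp
  have e3 : qPoch (p * a₂) p (n + 1) = qPoch (p * a₂) p n * (1 - a₂ * p ^ (n + 1)) := by
    rw [qPoch_succ, pow_succ]; ring
  simp only [firstTerm, hX, prod_qPoch_succ, e1, e2, e3, qPoch_succ' a₂, qPoch_succ' a₀]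
  set X := p ^ (n + 1)
  have c : ∀ c, p * (p ^ 2 * a₀) * (X / p) / (p * c) = p * a₀ * X / c := by
    intro c; rw [← mul_div_mul_left _ c hp0]; congr 1; field_simp
  simp only [c]
  rw [show p * (p ^ 2 * a₀) * (X / p) / a₁ = p * (p * a₀ * X / a₁) by field_simp,
    show p * a₀ * X / (a₁ / p) = p * (p * a₀ * X / a₁) by field_simp,
    show p * a₀ * X / (p * a₂) = a₀ * X / a₂ by field_simp,
    show p * (X / p) = X by field_simp, qPochInf_succ hp X,
    qPochInf_succ hp (p * a₀ * X / a₁), qPochInf_succ hp (a₀ * X / a₂),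
    show p * (a₀ * X / a₂) = p * a₀ * X / a₂ by ring,
    show X / p * (1 - p ^ 2 * a₀ * (X / p) ^ 2) = X / p * (1 - a₀ * X ^ 2) by field_simp]
  have hid := up_identity (a₀ := a₀) (X := X) hp0 h₁ h₂
  have hpp : p * (X / p) = X := by field_simp
  generalize X / p = Z at *
  generalize qPochInf (p * (p * a₀ * X / a₁)) p = r1
  generalize qPochInf (p * a₀ * X / a₂) p = r2
  generalize ∏ i, qPochInf (p * a₀ * X / d i) p = r3
  generalize ∏ i, qPoch (p * d i) p n = r4
  generalize ∏ i, (1 - d i) = r5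
  generalize qPochInf (p * X) p = r6
  generalize a₂ + a₀ / a₂ - p * a₀ / a₁ - a₁ / p = k at *
  linear_combination (X * (1 - a₀ * X ^ 2) * (1 - a₀) * qPoch (p * a₀) p n * r6 * qPoch a₁ p n *
    qPoch (p * a₂) p n * r1 * r2 * r3 * r4 * r5) * hid -
    (k * (1 - a₀) * r5 * X * (1 - a₀ * X ^ 2) * (1 - X) * r6 * qPoch a₁ p n *
    qPoch (p * a₂) p n * r1 * r2 * r3 * r4) * e0 -
    (k * (1 - a₀) * (1 - p * a₀) * r5 * qPoch (p ^ 2 * a₀) p n * (1 - a₀ * X ^ 2) * (1 - X) * r6 *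
      qPoch a₁ p n * qPoch (p * a₂) p n * r1 * r2 * r3 * r4) * hpp

/-- Same mechanism as for `firstTerm_up`, with `up_identity` evaluated at `x` instead of a power of
`p`. The relation `hx` converts the factor `1 - p ^ n d₄` into `1 - a₀ x`. -/
lemma secondTerm_up (hp0 : p ≠ 0) (h₁ : a₁ ≠ 0) (h₂ : a₂ ≠ 0) (n : ℕ) {x : ℂ}
    (hx : d 4 * p ^ n = a₀ * x) (u₁ : qPochInf (a₁ / p * x) p ≠ 0)
    (u₂ : qPochInf (a₂ * x) p ≠ 0) :
    (1 - p * a₀ / a₁) * secondTerm p a₀ (a₁ / p) (p * a₂) d n x -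
      (1 - a₀ / a₂) * secondTerm p a₀ a₁ a₂ d n x =
    (a₂ + a₀ / a₂ - p * a₀ / a₁ - a₁ / p) * p * (1 - a₀) * (1 - p * a₀) * (∏ i, (1 - d i)) *
      secondTerm p (p ^ 2 * a₀) a₁ (p * a₂) (fun i => p * d i) n (x / p) := by
  have e0 : qPochInf a₀ p = (1 - a₀) * (1 - p * a₀) * qPochInf (p ^ 2 * a₀) p := by
    rw [qPochInf_succ hp, qPochInf_succ hp (p * a₀), show p * (p * a₀) = p ^ 2 * a₀ by ring]; ring
  have e1 : qPochInf (a₁ / p) p = (1 - a₁ / p) * qPochInf a₁ p := by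
    rw [qPochInf_succ hp, mul_div_cancel₀ _ hp0]
  have e2 : qPochInf (a₁ / p * x) p = (1 - a₁ / p * x) * qPochInf (a₁ * x) p := by
    rw [qPochInf_succ hp]; congr 2; field_simp
  have e3 : qPochInf (a₂ * x) p = (1 - a₂ * x) * qPochInf (p * a₂ * x) p := by
    rw [qPochInf_succ hp, mul_assoc]
  have e4 : (1 - d 4) * qPoch (p * d 4) p n = qPoch (d 4) p n * (1 - a₀ * x) := by
    rw [one_sub_mul_qPoch, ← hx]; ring
  have e5 : ∏ i : Fin 4, qPochInf (d i.castSucc) p / qPochInf (d i.castSucc * x) p =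
      (∏ i : Fin 4, (1 - d i.castSucc)) *
        ∏ i : Fin 4, qPochInf (p * d i.castSucc) p / qPochInf (d i.castSucc * x) p := by
    rw [← Finset.prod_mul_distrib]
    refine Finset.prod_congr rfl fun i _ => ?_
    rw [qPochInf_succ hp (d i.castSucc)]; ring
  have e6 : ∏ i, (1 - d i) = (∏ i : Fin 4, (1 - d i.castSucc)) * (1 - d 4) :=
    Fin.prod_univ_castSucc _
  have c1 : ∀ c, p * c * (x / p) = c * x := by intro c; field_simp
  have c2 : ∀ c, p ^ 2 * a₀ * x / (p * c) = p * a₀ * x / c := by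
    intro c; rw [← mul_div_mul_left _ c hp0]; congr 1; ring
  simp only [secondTerm, c1, c2, e5, e6]
  rw [show p ^ 2 * a₀ * x / a₁ = p * (p * a₀ * x / a₁) by ring,
    show p * a₀ * x / (a₁ / p) = p * (p * a₀ * x / a₁) by field_simp,
    show p * a₀ * x / (p * a₂) = a₀ * x / a₂ by field_simp,
    show p * (x / p) = x by field_simp, qPochInf_succ hp x,
    qPochInf_succ hp (p * a₀ * x / a₁), qPochInf_succ hp (a₀ * x / a₂),
    show p * (a₀ * x / a₂) = p * a₀ * x / a₂ by ring,
    show x / p * (1 - p ^ 2 * a₀ * (x / p) ^ 2) = x / p * (1 - a₀ * x ^ 2) by field_simp,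
    show a₁ * (x / p) = a₁ / p * x by ring, e1, e0, qPochInf_succ hp a₂]
  have v1 : 1 / qPochInf (a₁ * x) p = (1 - a₁ / p * x) / qPochInf (a₁ / p * x) p := by
    have := right_ne_zero_of_mul (e2 ▸ u₁)
    rw [div_eq_div_iff this u₁, e2]; ring
  have v2 : 1 / qPochInf (p * a₂ * x) p = (1 - a₂ * x) / qPochInf (a₂ * x) p := by
    have := right_ne_zero_of_mul (e3 ▸ u₂)
    rw [div_eq_div_iff this u₂, e3]; ring
  rw [div_eq_mul_one_div _ (qPochInf (a₁ * x) p), v1,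
    div_eq_mul_one_div _ (qPochInf (p * a₂ * x) p), v2]
  have hid := up_identity (a₀ := a₀) (X := x) hp0 h₁ h₂
  have hpp : p * (x / p) = x := by field_simp
  rw [show a₁ * x / p = a₁ / p * x by ring] at hid
  generalize x / p = z at *
  generalize qPochInf (a₁ / p * x) p = t1 at *
  generalize qPochInf (a₂ * x) p = t2 at *
  generalize qPochInf (p * (p * a₀ * x / a₁)) p = r1
  generalize qPochInf (p * a₀ * x / a₂) p = r2
  generalize ∏ i, qPochInf (p * a₀ * x / d i) p = r3
  generalize ∏ i : Fin 4, qPochInf (p * d i.castSucc) p / qPochInf (d i.castSucc * x) p = r4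
  generalize ∏ i : Fin 4, (1 - d i.castSucc) = r5
  generalize qPochInf (p * x) p = r6
  generalize qPochInf (p ^ 2 * a₀) p = r7
  generalize qPochInf (d 4 * x) p = r8
  generalize qPochInf (p * a₂) p = r9
  generalize qPochInf a₁ p = r10
  generalize a₂ + a₀ / a₂ - p * a₀ / a₁ - a₁ / p = k at *
  generalize a₁ / p * x = m at *
  linear_combination (-(x * (1 - a₀ * x ^ 2)) * (1 - a₀) * (1 - p * a₀) * r7 / r8 * r6 * r10 / t1 *
    r9 / t2 * r1 * r2 * r3 * r4 * r5 * qPoch (d 4) p n) * hid +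
    (k * (1 - a₀) * (1 - p * a₀) * r5 * x * (1 - a₀ * x ^ 2) * r7 / r8 * (1 - x) * r6 *
    r10 / t1 * r1 * r9 / t2 * r2 * r4 * r3) * e4 +
    (k * (1 - a₀) * (1 - p * a₀) * r5 * (1 - d 4) * (1 - a₀ * x ^ 2) * r7 / r8 * (1 - x) * r6 *
    r10 / t1 * r1 * r9 / t2 * r2 * r4 * qPoch (p * d 4) p n * r3) * hpp

end Upward

/-- The contiguity relation between `Φ(a₀; a₁ / p, p a₂, …)`, `Φ(a₀; a₁, a₂, …)` and
`Φ(p² a₀; a₁, p a₂, p a₃, …)`, with `p = q ^ 2`. -/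
theorem Phi_up {q a₀ a₁ a₂ : ℂ} {d : Fin 5 → ℂ} (hq0 : q ≠ 0) (hq : ‖q‖ < 1)
    (hU : PhiDefined q (paramVec a₀ a₁ a₂ d))
    (hU' : PhiDefined q (paramVec a₀ (a₁ / q ^ 2) (q ^ 2 * a₂) d))
    (hV : PhiDefined q (paramVec ((q ^ 2) ^ 2 * a₀) a₁ (q ^ 2 * a₂) fun i => q ^ 2 * d i)) :
    (1 - a₀ / a₂) * (1 - q ^ 2 * a₀ / a₁) * (1 - (q ^ 2) ^ 2 * a₀ / a₁) * (1 - q ^ 2 * a₀ / a₂) *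
      (∏ i, (1 - q ^ 2 * a₀ / d i)) *
      (Phi q (paramVec a₀ (a₁ / q ^ 2) (q ^ 2 * a₂) d) - Phi q (paramVec a₀ a₁ a₂ d)) =
    q ^ 2 * (a₂ + a₀ / a₂ - q ^ 2 * a₀ / a₁ - a₁ / q ^ 2) * (1 - q ^ 2 * a₀) *
      (1 - (q ^ 2) ^ 2 * a₀) * (∏ i, (1 - d i)) *
      Phi q (paramVec ((q ^ 2) ^ 2 * a₀) a₁ (q ^ 2 * a₂) fun i => q ^ 2 * d i) := by
  have hp := norm_sq_lt_one hq
  have zU := hU.phiNonzero hq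
  have zU' := hU'.phiNonzero hq
  have zV := hV.phiNonzero hq
  obtain ⟨s1, t1, n1⟩ := normFactor_mul_Phi hq hU
  obtain ⟨s2, t2, n2⟩ := normFactor_mul_Phi hq hU'
  obtain ⟨s3, t3, n3⟩ := normFactor_mul_Phi hq hV
  have hp0 : q ^ 2 ≠ 0 := pow_ne_zero 2 hq0
  generalize q ^ 2 = p at *
  set K := (a₂ + a₀ / a₂ - p * a₀ / a₁ - a₁ / p) * p * (1 - a₀) * (1 - p * a₀) * ∏ i, (1 - d i)
    with hK
  have h₀ := zU.a₀_ne
  have h₁ := zU.a₁_ne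
  have h₂ := zU.a₂_ne
  -- Multiplying `a₀` by `p²` and `a₇` by `p` moves the second progression one step back.
  have harg : ∀ n : ℕ, p * d 4 / (p ^ 2 * a₀) * p ^ n = d 4 / a₀ * p ^ n / p := by
    intro n; field_simp
  have sum1 : (1 - p * a₀ / a₁) * ∑' n, firstTerm p a₀ (a₁ / p) (p * a₂) d n -
      (1 - a₀ / a₂) * ∑' n, firstTerm p a₀ a₁ a₂ d n =
      K * ∑' n, firstTerm p (p ^ 2 * a₀) a₁ (p * a₂) (fun i => p * d i) n := by
    -- After the zeroth terms cancel, term `n + 1` on the left corresponds to term `n` of the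
    -- shifted series.
    rw [s1.tsum_eq_zero_add, s2.tsum_eq_zero_add, mul_add, mul_add, firstTerm_zero,
      firstTerm_zero, normFactor_up hp hp0 h₁ h₂, add_sub_add_left_eq_sub, ← tsum_mul_left,
      ← tsum_mul_left, ← tsum_mul_left, ← Summable.tsum_sub]
    · exact tsum_congr fun n => firstTerm_up hp hp0 h₁ h₂ n
    · exact ((summable_nat_add_iff 1).2 s2).mul_left _
    · exact ((summable_nat_add_iff 1).2 s1).mul_left _
  have sum2 : (1 - p * a₀ / a₁) *
        ∑' n, secondTerm p a₀ (a₁ / p) (p * a₂) d n (d 4 / a₀ * p ^ n) -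
      (1 - a₀ / a₂) * ∑' n, secondTerm p a₀ a₁ a₂ d n (d 4 / a₀ * p ^ n) =
      K * ∑' n, secondTerm p (p ^ 2 * a₀) a₁ (p * a₂) (fun i => p * d i) n
        (p * d 4 / (p ^ 2 * a₀) * p ^ n) := by
    -- Here the index does not move: the shift is already contained in the argument `x / p`.
    rw [← tsum_mul_left, ← tsum_mul_left, ← tsum_mul_left, ← Summable.tsum_sub]
    · refine tsum_congr fun n => ?_
      rw [harg]
      refine secondTerm_up hp hp0 h₁ h₂ n (by field_simp) ?_ ?_
      · have := qPochInf_pow_ne_zero hp zU'.upper₁' n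
        convert this using 2; ring
      · have := qPochInf_pow_ne_zero hp zU.upper₂' n
        convert this using 2; ring
    · exact t2.mul_left _
    · exact t1.mul_left _
  have total : (1 - a₀ / a₂) * normFactor p a₀ a₁ a₂ d *
      (Phi q (paramVec a₀ (a₁ / p) (p * a₂) d) - Phi q (paramVec a₀ a₁ a₂ d)) =
      K * (normFactor p (p ^ 2 * a₀) a₁ (p * a₂) (fun i => p * d i) *
        Phi q (paramVec (p ^ 2 * a₀) a₁ (p * a₂) fun i => p * d i)) := by
    have hN := normFactor_up hp (a₀ := a₀) (d := d) hp0 h₁ h₂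
    linear_combination sum1 + sum2 + (1 - p * a₀ / a₁) * n2 - (1 - a₀ / a₂) * n1 - K * n3 -
      Phi q (paramVec a₀ (a₁ / p) (p * a₂) d) * hN
  have hN := normFactor_shift hp (a₀ := a₀) (a₁ := a₁) (a₂ := a₂) (d := d) hp0
  have hne : normFactor p (p ^ 2 * a₀) a₁ (p * a₂) (fun i => p * d i) ≠ 0 := by
    refine mul_ne_zero (mul_ne_zero (mul_ne_zero (mul_ne_zero zV.one_sub_ne
      (qPochInf_self_ne_zero hp)) zV.lower₁) zV.lower₂) (Finset.prod_ne_zero_iff.2 fun i _ =>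
        zV.lower_d i)
  refine mul_left_cancel₀ (mul_ne_zero zU.one_sub_ne hne) ?_
  rw [hK] at total
  linear_combination (1 - p ^ 2 * a₀) * total - (1 - a₀ / a₂) *
    (Phi q (paramVec a₀ (a₁ / p) (p * a₂) d) - Phi q (paramVec a₀ a₁ a₂ d)) * hN

/-! ### The downward contiguity relation, by telescoping. -/

section Downward

/-- `F` and `B` stand for `∏ (1 - d i z)` and `∏ (1 - z / d i)`, with `∏ d i` eliminated by
balancing. On the right, the two degree-eight products in `X` are exchanged by `X ↦ 1/(a₀ X)` up to
`a₀⁴ X⁸`. Balancing makes their leading coefficients agree, so their difference is divisible by `X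
(1 - a₀ X²)`. The quotient is a quartic symmetric under the same involution, determined by three
values: the left side is its interpolation at `X = 1`, `p / a₁`, `p / a₂`. -/
lemma down_identity_aux {p a₀ a₁ a₂ X σ₁ σ₂ σ₃ σ₄ : ℂ} (hp : p ≠ 0) (h₀ : a₀ ≠ 0) (h₁ : a₁ ≠ 0)
    (h₂ : a₂ ≠ 0) (F B : ℂ → ℂ)
    (hF : ∀ z, F z = 1 - σ₁ * z + σ₂ * z ^ 2 - σ₃ * z ^ 3 + σ₄ * z ^ 4 -
      p ^ 2 * a₀ ^ 3 / (a₁ * a₂) * z ^ 5)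
    (hB : ∀ z, B z = 1 - a₁ * a₂ / (p ^ 2 * a₀ ^ 3) *
      (σ₄ * z - σ₃ * z ^ 2 + σ₂ * z ^ 3 - σ₁ * z ^ 4 + z ^ 5)) :
    X * (1 - a₀ * X ^ 2) * (-(a₁ ^ 2 * B (p * a₀ / a₁) * (1 - p * a₀ / a₂)) *
          ((1 - X) * (1 - a₀ * X)) * ((1 - a₂ * X / p) * (1 - p * a₀ * X / a₂)) +
        a₂ ^ 2 * B (p * a₀ / a₂) * (1 - p * a₀ / a₁) *
          ((1 - X) * (1 - a₀ * X)) * ((1 - a₁ * X / p) * (1 - p * a₀ * X / a₁)) +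
        p * (a₁ - a₂) * F 1 * ((1 - a₁ * X / p) * (1 - p * a₀ * X / a₁)) *
          ((1 - a₂ * X / p) * (1 - p * a₀ * X / a₂))) =
    p * (a₁ - a₂) * (1 - p * a₀ / a₁) * (1 - p * a₀ / a₂) *
      ((1 - a₀ * X) * (1 - a₁ * X / p) * (1 - a₂ * X / p) * F X -
        (1 - X) * (1 - p * a₀ * X / a₁) * (1 - p * a₀ * X / a₂) * B (a₀ * X)) := by
  simp only [hF, hB]
  field_simp
  ring

/-- This is `down_identity` at the start `y = d₄ / a₀` of the second progression, where the last
product vanishes, after division by `(1 - d₄) y (1 - a₀ y²)`. It is checked directly because these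
divisors need not be nonzero. -/
lemma down_identity_zero_aux {p a₀ a₁ a₂ y σ₁ σ₂ σ₃ : ℂ} (hp : p ≠ 0) (h₀ : a₀ ≠ 0) (h₁ : a₁ ≠ 0)
    (h₂ : a₂ ≠ 0) (hy : y ≠ 0) (F B : ℂ → ℂ)
    (hF : ∀ z, F z = 1 - σ₁ * z + σ₂ * z ^ 2 - σ₃ * z ^ 3 +
      p ^ 2 * a₀ ^ 2 / (a₁ * a₂ * y) * z ^ 4)
    (hB : ∀ z, B z = 1 - a₁ * a₂ * y / (p ^ 2 * a₀ ^ 2) *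
      (σ₃ * z - σ₂ * z ^ 2 + σ₁ * z ^ 3 - z ^ 4)) :
    -(a₁ ^ 2 * (B (p * a₀ / a₁) * (1 - p / (a₁ * y))) * (1 - p * a₀ / a₂)) *
          (1 - y) * ((1 - a₂ * y / p) * (1 - p * a₀ * y / a₂)) +
        a₂ ^ 2 * (B (p * a₀ / a₂) * (1 - p / (a₂ * y))) * (1 - p * a₀ / a₁) *
          (1 - y) * ((1 - a₁ * y / p) * (1 - p * a₀ * y / a₁)) +
        p * (a₁ - a₂) * F 1 * ((1 - a₁ * y / p) * (1 - p * a₀ * y / a₁)) *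
          ((1 - a₂ * y / p) * (1 - p * a₀ * y / a₂)) =
    p * (a₁ - a₂) * (1 - p * a₀ / a₁) * (1 - p * a₀ / a₂) / y *
      ((1 - a₁ * y / p) * (1 - a₂ * y / p) * F y) := by
  simp only [hF, hB]
  field_simp
  ring

variable {p a₀ a₁ a₂ : ℂ} {d : Fin 5 → ℂ}

lemma down_identity (hp : p ≠ 0) (h₀ : a₀ ≠ 0) (h₁ : a₁ ≠ 0) (h₂ : a₂ ≠ 0) (hd : ∀ i, d i ≠ 0)
    (hbal : a₁ * a₂ * ∏ i, d i = p ^ 2 * a₀ ^ 3) (X : ℂ) :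
    X * (1 - a₀ * X ^ 2) *
      (-(a₁ ^ 2 * (∏ i, (1 - p * a₀ / a₁ / d i)) * (1 - p * a₀ / a₂)) *
          ((1 - X) * (1 - a₀ * X)) * ((1 - a₂ * X / p) * (1 - p * a₀ * X / a₂)) +
        a₂ ^ 2 * (∏ i, (1 - p * a₀ / a₂ / d i)) * (1 - p * a₀ / a₁) *
          ((1 - X) * (1 - a₀ * X)) * ((1 - a₁ * X / p) * (1 - p * a₀ * X / a₁)) +
        p * (a₁ - a₂) * (∏ i, (1 - d i)) * ((1 - a₁ * X / p) * (1 - p * a₀ * X / a₁)) *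
          ((1 - a₂ * X / p) * (1 - p * a₀ * X / a₂))) =
    p * (a₁ - a₂) * (1 - p * a₀ / a₁) * (1 - p * a₀ / a₂) *
      ((1 - a₀ * X) * (1 - a₁ * X / p) * (1 - a₂ * X / p) * (∏ i, (1 - d i * X)) -
        (1 - X) * (1 - p * a₀ * X / a₁) * (1 - p * a₀ * X / a₂) *
          ∏ i, (1 - a₀ * X / d i)) := by
  have hpr : p ^ 2 * a₀ ^ 3 / (a₁ * a₂) = ∏ i, d i := by rw [← hbal]; field_simp
  have hpr' : a₁ * a₂ / (p ^ 2 * a₀ ^ 3) = (∏ i, d i)⁻¹ := by rw [← hpr]; field_simp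
  have n0 := hd 0
  have n1 := hd 1
  have n2 := hd 2
  have n3 := hd 3
  have n4 := hd 4
  have key := down_identity_aux (X := X)
    (σ₁ := d 0 + d 1 + d 2 + d 3 + d 4)
    (σ₂ := d 0 * d 1 + d 0 * d 2 + d 0 * d 3 + d 0 * d 4 + d 1 * d 2 + d 1 * d 3 + d 1 * d 4 +
      d 2 * d 3 + d 2 * d 4 + d 3 * d 4)
    (σ₃ := d 0 * d 1 * d 2 + d 0 * d 1 * d 3 + d 0 * d 1 * d 4 + d 0 * d 2 * d 3 +
      d 0 * d 2 * d 4 + d 0 * d 3 * d 4 + d 1 * d 2 * d 3 + d 1 * d 2 * d 4 + d 1 * d 3 * d 4 +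
      d 2 * d 3 * d 4)
    (σ₄ := d 0 * d 1 * d 2 * d 3 + d 0 * d 1 * d 2 * d 4 + d 0 * d 1 * d 3 * d 4 +
      d 0 * d 2 * d 3 * d 4 + d 1 * d 2 * d 3 * d 4) hp h₀ h₁ h₂
    (fun z => ∏ i, (1 - d i * z)) (fun z => ∏ i, (1 - z / d i))
    (by intro z; rw [hpr]; simp only [Fin.prod_univ_five]; ring)
    (by intro z; rw [hpr']; simp only [Fin.prod_univ_five]; field_simp; ring)
  simpa only [mul_one] using key

lemma down_identity_zero (hp : p ≠ 0) (h₀ : a₀ ≠ 0) (h₁ : a₁ ≠ 0) (h₂ : a₂ ≠ 0)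
    (hd : ∀ i, d i ≠ 0) (hbal : a₁ * a₂ * ∏ i, d i = p ^ 2 * a₀ ^ 3) {y : ℂ} (hy : a₀ * y = d 4) :
    -(a₁ ^ 2 * (∏ i, (1 - p * a₀ / a₁ / d i)) * (1 - p * a₀ / a₂)) *
          (1 - y) * ((1 - a₂ * y / p) * (1 - p * a₀ * y / a₂)) +
        a₂ ^ 2 * (∏ i, (1 - p * a₀ / a₂ / d i)) * (1 - p * a₀ / a₁) *
          (1 - y) * ((1 - a₁ * y / p) * (1 - p * a₀ * y / a₁)) +
        p * (a₁ - a₂) * (∏ i : Fin 4, (1 - d i.castSucc)) *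
          ((1 - a₁ * y / p) * (1 - p * a₀ * y / a₁)) *
          ((1 - a₂ * y / p) * (1 - p * a₀ * y / a₂)) =
    p * (a₁ - a₂) * (1 - p * a₀ / a₁) * (1 - p * a₀ / a₂) / y *
      ((1 - a₁ * y / p) * (1 - a₂ * y / p) * ∏ i : Fin 4, (1 - d i.castSucc * y)) := by
  have hy0 : y ≠ 0 := right_ne_zero_of_mul (hy ▸ hd 4)
  rw [Fin.prod_univ_castSucc, show Fin.last 4 = 4 from rfl] at hbal
  have hpr : p ^ 2 * a₀ ^ 2 / (a₁ * a₂ * y) = ∏ i : Fin 4, d i.castSucc := by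
    rw [div_eq_iff (by positivity)]
    refine mul_left_cancel₀ h₀ ?_
    linear_combination -hbal - a₁ * a₂ * (∏ i : Fin 4, d i.castSucc) * hy
  have hpr' : a₁ * a₂ * y / (p ^ 2 * a₀ ^ 2) = (∏ i : Fin 4, d i.castSucc)⁻¹ := by
    rw [← hpr]; field_simp
  have n0 := hd (Fin.castSucc 0)
  have n1 := hd (Fin.castSucc 1)
  have n2 := hd (Fin.castSucc 2)
  have n3 := hd (Fin.castSucc 3)
  have key := down_identity_zero_aux (y := y)
    (σ₁ := d (Fin.castSucc 0) + d (Fin.castSucc 1) + d (Fin.castSucc 2) + d (Fin.castSucc 3))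
    (σ₂ := d (Fin.castSucc 0) * d (Fin.castSucc 1) + d (Fin.castSucc 0) * d (Fin.castSucc 2) +
      d (Fin.castSucc 0) * d (Fin.castSucc 3) + d (Fin.castSucc 1) * d (Fin.castSucc 2) +
      d (Fin.castSucc 1) * d (Fin.castSucc 3) + d (Fin.castSucc 2) * d (Fin.castSucc 3))
    (σ₃ := d (Fin.castSucc 0) * d (Fin.castSucc 1) * d (Fin.castSucc 2) +
      d (Fin.castSucc 0) * d (Fin.castSucc 1) * d (Fin.castSucc 3) +
      d (Fin.castSucc 0) * d (Fin.castSucc 2) * d (Fin.castSucc 3) +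
      d (Fin.castSucc 1) * d (Fin.castSucc 2) * d (Fin.castSucc 3)) hp h₀ h₁ h₂ hy0
    (fun z => ∏ i : Fin 4, (1 - d i.castSucc * z)) (fun z => ∏ i : Fin 4, (1 - z / d i.castSucc))
    (by intro z; rw [hpr]; simp only [Fin.prod_univ_four]; ring)
    (by intro z; rw [hpr']; simp only [Fin.prod_univ_four]; field_simp; ring)
  have e : ∀ a ≠ 0, ∏ i, (1 - p * a₀ / a / d i) =
      (∏ i : Fin 4, (1 - p * a₀ / a / d i.castSucc)) * (1 - p / (a * y)) := by
    intro a ha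
    rw [Fin.prod_univ_castSucc, show Fin.last 4 = 4 from rfl, ← hy]
    congr 2
    field_simp
  rw [e _ h₁, e _ h₂]
  simpa only [mul_one] using key

/-- Telescoping quantity for the first series, with `X = p ^ (n + 1)`. -/
def firstBoundary (p a₀ a₁ a₂ : ℂ) (d : Fin 5 → ℂ) (n : ℕ) (X : ℂ) : ℂ :=
  qPoch (p * a₀) p n * qPochInf X p * (qPoch a₁ p n * qPochInf (p * a₀ * X / a₁) p) *
    (qPoch a₂ p n * qPochInf (p * a₀ * X / a₂) p) *
    ((∏ i, qPoch (p * d i) p n) * ∏ i, qPochInf (a₀ * X / d i) p)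

/-- Telescoping quantity for the second series. -/
def secondBoundary (p a₀ a₁ a₂ : ℂ) (d : Fin 5 → ℂ) (n : ℕ) (X : ℂ) : ℂ :=
  -(qPochInf (p * a₀) p / qPochInf (d 4 * X) p * qPochInf X p) *
    (qPochInf a₁ p / qPochInf (a₁ * X / p) p * qPochInf (p * a₀ * X / a₁) p) *
    (qPochInf a₂ p / qPochInf (a₂ * X / p) p * qPochInf (p * a₀ * X / a₂) p) *
    ((∏ i : Fin 4, qPochInf (p * d i.castSucc) p / qPochInf (d i.castSucc * X) p) *
      qPoch (p * d 4) p n * ∏ i, qPochInf (a₀ * X / d i) p)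

/-- Common factor of the terms of the first series in the downward relation. -/
def firstCore (p a₀ a₁ a₂ : ℂ) (d : Fin 5 → ℂ) (n : ℕ) (X : ℂ) : ℂ :=
  qPoch (p * a₀) p n * qPochInf (p * X) p *
    (qPoch a₁ p n * qPochInf (p * (p * a₀ * X / a₁)) p) *
    (qPoch a₂ p n * qPochInf (p * (p * a₀ * X / a₂)) p) *
    ((∏ i, qPoch (p * d i) p n) * ∏ i, qPochInf (p * a₀ * X / d i) p)

/-- Common factor of the terms of the second series in the downward relation. -/
def secondCore (p a₀ a₁ a₂ : ℂ) (d : Fin 5 → ℂ) (x : ℂ) : ℂ :=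
  -(qPochInf (p * a₀) p / qPochInf (d 4 * x) p * qPochInf (p * x) p) *
    (qPochInf a₁ p / qPochInf (a₁ * x / p) p * qPochInf (p * (p * a₀ * x / a₁)) p) *
    (qPochInf a₂ p / qPochInf (a₂ * x / p) p * qPochInf (p * (p * a₀ * x / a₂)) p) *
    ((∏ i : Fin 4, qPochInf (p * d i.castSucc) p / qPochInf (d i.castSucc * x) p) *
      ∏ i, qPochInf (p * a₀ * x / d i) p)

lemma firstTerm_swap (n : ℕ) : firstTerm p a₀ a₂ a₁ d n = firstTerm p a₀ a₁ a₂ d n := by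
  simp only [firstTerm]; ring

lemma secondTerm_swap (n : ℕ) (x : ℂ) :
    secondTerm p a₀ a₂ a₁ d n x = secondTerm p a₀ a₁ a₂ d n x := by
  simp only [secondTerm]; ring

lemma firstCore_swap (n : ℕ) (x : ℂ) :
    firstCore p a₀ a₂ a₁ d n x = firstCore p a₀ a₁ a₂ d n x := by
  simp only [firstCore]; ring

lemma secondCore_swap (x : ℂ) :
    secondCore p a₀ a₂ a₁ d x = secondCore p a₀ a₁ a₂ d x := by
  simp only [secondCore]; ring

lemma normFactor_swap : normFactor p a₀ a₂ a₁ d = normFactor p a₀ a₁ a₂ d := by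
  simp only [normFactor]; ring

/-- This lemma and `firstBoundary_eq` write the two ends of a telescoping step over the common
factor `firstCore`. With `firstTerm_succ_core` and `firstTerm_shift_core` doing the same for the
terms, only `down_identity` remains. -/
lemma firstBoundary_succ (n : ℕ) (hp0 : p ≠ 0) :
    firstBoundary p a₀ a₁ a₂ d (n + 1) (p * p ^ (n + 1)) =
    (1 - a₀ * p ^ (n + 1)) * (1 - a₁ * p ^ (n + 1) / p) * (1 - a₂ * p ^ (n + 1) / p) *
      (∏ i, (1 - d i * p ^ (n + 1))) * firstCore p a₀ a₁ a₂ d n (p ^ (n + 1)) := by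
  have e2 : ∀ a, qPoch a p (n + 1) = qPoch a p n * (1 - a * p ^ (n + 1) / p) := by
    intro a
    rw [qPoch_succ, pow_succ]; field_simp
  have e3 : ∀ a, qPoch (p * a) p (n + 1) = qPoch (p * a) p n * (1 - a * p ^ (n + 1)) := by
    intro a
    rw [qPoch_succ, pow_succ]; ring
  simp only [firstBoundary, firstCore, e3, Finset.prod_mul_distrib]
  rw [e2 a₁, e2 a₂]
  simp only [show ∀ X c, p * a₀ * (p * X) / c = p * (p * a₀ * X / c) from fun X c => by ring,
    show ∀ X c, a₀ * (p * X) / c = p * a₀ * X / c from fun X c => by ring]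
  ring

variable (hp : ‖p‖ < 1)
include hp

lemma firstTerm_succ_core (n : ℕ) (hp0 : p ≠ 0) :
    firstTerm p a₀ a₁ a₂ d (n + 1) = (1 - a₀) * (∏ i, (1 - d i)) *
      ((1 - a₁ * p ^ (n + 1) / p) * (1 - p * a₀ * p ^ (n + 1) / a₁)) *
      ((1 - a₂ * p ^ (n + 1) / p) * (1 - p * a₀ * p ^ (n + 1) / a₂)) *
      (p ^ (n + 1) * (1 - a₀ * (p ^ (n + 1)) ^ 2)) * firstCore p a₀ a₁ a₂ d n (p ^ (n + 1)) := by
  have e2 : ∀ a, qPoch a p (n + 1) = qPoch a p n * (1 - a * p ^ (n + 1) / p) := by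
    intro a
    rw [qPoch_succ, pow_succ]; field_simp
  simp only [firstTerm, firstCore, prod_qPoch_succ]
  rw [e2 a₁, e2 a₂, qPoch_succ' a₀, qPochInf_succ hp (p * a₀ * p ^ (n + 1) / a₁),
    qPochInf_succ hp (p * a₀ * p ^ (n + 1) / a₂)]
  ring

lemma firstTerm_shift_core (n : ℕ) (hp0 : p ≠ 0) :
    p * (1 - p * a₀) * (1 - a₂) * firstTerm p (p ^ 2 * a₀) a₁ (p * a₂) (fun i => p * d i) n =
      ((1 - p ^ (n + 1)) * (1 - a₀ * p ^ (n + 1))) *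
      ((1 - a₂ * p ^ (n + 1) / p) * (1 - p * a₀ * p ^ (n + 1) / a₂)) *
      (p ^ (n + 1) * (1 - a₀ * (p ^ (n + 1)) ^ 2)) * firstCore p a₀ a₁ a₂ d n (p ^ (n + 1)) := by
  have hX : p ^ n = p ^ (n + 1) / p := by rw [pow_succ]; field_simp
  have e0 : (1 - p * a₀) * qPoch (p ^ 2 * a₀) p n = qPoch (p * a₀) p n * (1 - a₀ * p ^ (n + 1)) := by
    have := one_sub_mul_qPoch (p * a₀) p n
    rw [show p * (p * a₀) = p ^ 2 * a₀ by ring] at this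
    rw [this]; ring
  have e2 : (1 - a₂) * qPoch (p * a₂) p n = qPoch a₂ p n * (1 - a₂ * p ^ (n + 1) / p) := by
    rw [one_sub_mul_qPoch, pow_succ]; field_simp
  simp only [firstTerm, firstCore, hX]
  set X := p ^ (n + 1)
  have c : ∀ c, p * (p ^ 2 * a₀) * (X / p) / (p * c) = p * a₀ * X / c := by
    intro c; rw [← mul_div_mul_left _ c hp0]; congr 1; field_simp
  simp only [c]
  rw [show p * (p ^ 2 * a₀) * (X / p) / a₁ = p * (p * a₀ * X / a₁) by field_simp,
    show p * (X / p) = X by field_simp, qPochInf_succ hp X,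
    qPochInf_succ hp (p * a₀ * X / a₂),
    show X / p * (1 - p ^ 2 * a₀ * (X / p) ^ 2) = X / p * (1 - a₀ * X ^ 2) by field_simp]
  have hpp : p * (X / p) = X := by field_simp
  generalize X / p = Z at *
  generalize a₂ * X / p = m at *
  generalize qPochInf (p * (p * a₀ * X / a₁)) p = r1
  generalize qPochInf (p * (p * a₀ * X / a₂)) p = r2
  generalize ∏ i, qPochInf (p * a₀ * X / d i) p = r3
  generalize ∏ i, qPoch (p * d i) p n = r4
  generalize qPochInf (p * X) p = r6
  calc _ = (p * Z) * ((1 - p * a₀) * qPoch (p ^ 2 * a₀) p n) * ((1 - a₂) * qPoch (p * a₂) p n) *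
        ((1 - X) * r6 * (1 - a₀ * X ^ 2) * (qPoch a₁ p n * r1) * (1 - p * a₀ * X / a₂) * r2 *
          (r4 * r3)) := by ring
    _ = _ := by rw [hpp, e0, e2]; ring

lemma firstBoundary_eq (n : ℕ) (X : ℂ) : firstBoundary p a₀ a₁ a₂ d n X =
    (1 - X) * (1 - p * a₀ * X / a₁) * (1 - p * a₀ * X / a₂) * (∏ i, (1 - a₀ * X / d i)) *
      firstCore p a₀ a₁ a₂ d n X := by
  simp only [firstBoundary, firstCore]
  rw [qPochInf_succ hp X, qPochInf_succ hp (p * a₀ * X / a₁), qPochInf_succ hp (p * a₀ * X / a₂),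
    prod_qPochInf_succ hp fun i => a₀ * X / d i]
  simp only [show ∀ c, p * (a₀ * X / c) = p * a₀ * X / c from fun c => by ring]
  ring

end Downward

section Downward

variable {p a₀ a₁ a₂ : ℂ} {d : Fin 5 → ℂ}

/-- The upper parameters now enter through infinite products in denominators. Their nonvanishing is
what allows a factor to be split off. -/
lemma secondBoundary_mul_core (hp : ‖p‖ < 1) {x : ℂ} (n : ℕ)
    (u₁ : qPochInf (a₁ * x / p) p ≠ 0) (u₂ : qPochInf (a₂ * x / p) p ≠ 0)
    (u_d : ∀ i, qPochInf (d i * x) p ≠ 0) :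
    secondBoundary p a₀ a₁ a₂ d n (p * x) =
      (1 - a₁ * x / p) * (1 - a₂ * x / p) * (∏ i, (1 - d i * x)) * secondCore p a₀ a₁ a₂ d x *
        qPoch (p * d 4) p n := by
  have key : ∀ c, qPochInf c p ≠ 0 → 1 / qPochInf (p * c) p = (1 - c) / qPochInf c p := by
    intro c hc
    have := hc
    rw [qPochInf_succ hp] at this
    rw [div_eq_div_iff (right_ne_zero_of_mul this) hc, qPochInf_succ hp c]; ring
  have e1 : ∀ c a, qPochInf (c * x / p) p ≠ 0 →
      a / qPochInf (c * (p * x) / p) p = a * ((1 - c * x / p) / qPochInf (c * x / p) p) := by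
    intro c a hc
    rw [← key _ hc, div_eq_mul_one_div, show c * (p * x) / p = p * (c * x / p) by ring]
  have e2 : ∀ i a, a / qPochInf (d i * (p * x)) p = a * ((1 - d i * x) / qPochInf (d i * x) p) := by
    intro i a
    rw [← key _ (u_d i), div_eq_mul_one_div, show d i * (p * x) = p * (d i * x) by ring]
  have e3 : ∏ i, (1 - d i * x) = (∏ i : Fin 4, (1 - d i.castSucc * x)) * (1 - d 4 * x) :=
    Fin.prod_univ_castSucc _
  have e4 : ∏ i : Fin 4, qPochInf (p * d i.castSucc) p *
      ((1 - d i.castSucc * x) / qPochInf (d i.castSucc * x) p) =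
      (∏ i : Fin 4, (1 - d i.castSucc * x)) *
        ∏ i : Fin 4, qPochInf (p * d i.castSucc) p / qPochInf (d i.castSucc * x) p := by
    rw [← Finset.prod_mul_distrib]
    exact Finset.prod_congr rfl fun i _ => by ring
  simp only [secondBoundary, secondCore, e2]
  rw [e1 _ _ u₁, e1 _ _ u₂, e3, e4]
  simp only [show ∀ c, p * a₀ * (p * x) / c = p * (p * a₀ * x / c) from fun c => by ring,
    show ∀ c, a₀ * (p * x) / c = p * a₀ * x / c from fun c => by ring]
  ring

lemma secondBoundary_eq (hp : ‖p‖ < 1) (n : ℕ) (X : ℂ) : secondBoundary p a₀ a₁ a₂ d n X =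
    (1 - X) * (1 - p * a₀ * X / a₁) * (1 - p * a₀ * X / a₂) * (∏ i, (1 - a₀ * X / d i)) *
      secondCore p a₀ a₁ a₂ d X * qPoch (p * d 4) p n := by
  simp only [secondBoundary, secondCore]
  rw [qPochInf_succ hp X, qPochInf_succ hp (p * a₀ * X / a₁), qPochInf_succ hp (p * a₀ * X / a₂),
    prod_qPochInf_succ hp fun i => a₀ * X / d i]
  simp only [show ∀ c, p * (a₀ * X / c) = p * a₀ * X / c from fun c => by ring]
  ring

lemma secondTerm_core (hp : ‖p‖ < 1) (hp0 : p ≠ 0) {x : ℂ} (n : ℕ)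
    (u₁ : qPochInf (a₁ * x / p) p ≠ 0) (u₂ : qPochInf (a₂ * x / p) p ≠ 0) :
    secondTerm p a₀ a₁ a₂ d n x = (1 - a₀) * (∏ i : Fin 4, (1 - d i.castSucc)) *
      ((1 - a₁ * x / p) * (1 - p * a₀ * x / a₁)) * ((1 - a₂ * x / p) * (1 - p * a₀ * x / a₂)) *
      (x * (1 - a₀ * x ^ 2)) * secondCore p a₀ a₁ a₂ d x * qPoch (d 4) p n := by
  have key : ∀ c a, qPochInf (c * x / p) p ≠ 0 →
      a / qPochInf (c * x) p = a * ((1 - c * x / p) / qPochInf (c * x / p) p) := by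
    intro c a hc
    have h := qPochInf_succ hp (c * x / p)
    rw [mul_div_cancel₀ _ hp0] at h
    have h2 := hc
    rw [h] at h2
    rw [div_eq_mul_one_div]
    congr 1
    rw [div_eq_div_iff (right_ne_zero_of_mul h2) hc, h]; ring
  have e5 : ∏ i : Fin 4, qPochInf (d i.castSucc) p / qPochInf (d i.castSucc * x) p =
      (∏ i : Fin 4, (1 - d i.castSucc)) *
        ∏ i : Fin 4, qPochInf (p * d i.castSucc) p / qPochInf (d i.castSucc * x) p := by
    rw [← Finset.prod_mul_distrib]
    refine Finset.prod_congr rfl fun i _ => ?_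
    rw [qPochInf_succ hp (d i.castSucc)]; ring
  simp only [secondTerm, secondCore]
  rw [key _ _ u₁, key _ _ u₂, e5, qPochInf_succ hp a₀, qPochInf_succ hp (p * a₀ * x / a₁),
    qPochInf_succ hp (p * a₀ * x / a₂)]
  ring

lemma secondTerm_shift_core (hp : ‖p‖ < 1) (hp0 : p ≠ 0) {x : ℂ} (n : ℕ)
    (u₂ : qPochInf (a₂ * x / p) p ≠ 0) :
    p * (1 - p * a₀) * (1 - a₂) *
        secondTerm p (p ^ 2 * a₀) a₁ (p * a₂) (fun i => p * d i) n (x / p) =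
      (1 - x) * ((1 - a₂ * x / p) * (1 - p * a₀ * x / a₂)) *
      (x * (1 - a₀ * x ^ 2)) * secondCore p a₀ a₁ a₂ d x * qPoch (p * d 4) p n := by
  have key : ∀ c a, qPochInf (c * x / p) p ≠ 0 →
      a / qPochInf (c * x) p = a * ((1 - c * x / p) / qPochInf (c * x / p) p) := by
    intro c a hc
    have h := qPochInf_succ hp (c * x / p)
    rw [mul_div_cancel₀ _ hp0] at h
    have h2 := hc
    rw [h] at h2
    rw [div_eq_mul_one_div]
    congr 1
    rw [div_eq_div_iff (right_ne_zero_of_mul h2) hc, h]; ring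
  have c1 : ∀ c, p * c * (x / p) = c * x := by intro c; field_simp
  have c2 : ∀ c, p ^ 2 * a₀ * x / (p * c) = p * a₀ * x / c := by
    intro c; rw [← mul_div_mul_left _ c hp0]; congr 1; ring
  simp only [secondTerm, secondCore, c1, c2]
  rw [show p ^ 2 * a₀ * x / a₁ = p * (p * a₀ * x / a₁) by ring,
    show a₁ * (x / p) = a₁ * x / p by ring, key _ _ u₂, qPochInf_succ hp (p * a₀),
    show p * (p * a₀) = p ^ 2 * a₀ by ring, qPochInf_succ hp a₂,
    qPochInf_succ hp (p * a₀ * x / a₂), show p * (x / p) = x by field_simp, qPochInf_succ hp x,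
    show x / p * (1 - p ^ 2 * a₀ * (x / p) ^ 2) = x / p * (1 - a₀ * x ^ 2) by field_simp]
  have hpp : p * (x / p) = x := by field_simp
  generalize x / p = z at *
  generalize a₁ * x / p = m1 at *
  generalize a₂ * x / p = m2 at *
  rw [show ∀ A B C D E F G : ℂ, p * A * B * (-(z * C) * D * E * F * G) =
    (p * z) * (-(A * B * C * D * E * F * G)) from fun A B C D E F G => by ring, hpp]
  ring

/-- Combination of terms of the first series that telescopes. -/
lemma firstTerm_down (hp : ‖p‖ < 1) (hp0 : p ≠ 0) (h₀ : a₀ ≠ 0) (h₁ : a₁ ≠ 0) (h₂ : a₂ ≠ 0)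
    (hd : ∀ i, d i ≠ 0) (hbal : a₁ * a₂ * ∏ i, d i = p ^ 2 * a₀ ^ 3) (n : ℕ) :
    (1 - a₀) * (-(a₁ ^ 2 * (∏ i, (1 - p * a₀ / a₁ / d i)) * (1 - p * a₀ / a₂)) *
          (p * (1 - p * a₀) * (1 - a₂) *
            firstTerm p (p ^ 2 * a₀) a₁ (p * a₂) (fun i => p * d i) n) +
        a₂ ^ 2 * (∏ i, (1 - p * a₀ / a₂ / d i)) * (1 - p * a₀ / a₁) *
          (p * (1 - p * a₀) * (1 - a₁) *
            firstTerm p (p ^ 2 * a₀) (p * a₁) a₂ (fun i => p * d i) n)) +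
      p * (a₁ - a₂) * firstTerm p a₀ a₁ a₂ d (n + 1) =
    (1 - a₀) * (p * (a₁ - a₂) * (1 - p * a₀ / a₁) * (1 - p * a₀ / a₂)) *
      (firstBoundary p a₀ a₁ a₂ d (n + 1) (p * p ^ (n + 1)) -
        firstBoundary p a₀ a₁ a₂ d n (p ^ (n + 1))) := by
  rw [← firstTerm_swap (a₁ := p * a₁), firstTerm_shift_core hp n hp0,
    firstTerm_shift_core hp n hp0, firstCore_swap (a₁ := a₁), firstTerm_succ_core hp n hp0,
    firstBoundary_succ n hp0, firstBoundary_eq hp]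
  have key := down_identity hp0 h₀ h₁ h₂ hd hbal (p ^ (n + 1))
  generalize firstCore p a₀ a₁ a₂ d n (p ^ (n + 1)) = R
  generalize p ^ (n + 1) = X at key ⊢
  generalize p * (a₁ - a₂) * (1 - p * a₀ / a₁) * (1 - p * a₀ / a₂) = K at key ⊢
  generalize a₁ ^ 2 * (∏ i, (1 - p * a₀ / a₁ / d i)) * (1 - p * a₀ / a₂) = A at key ⊢
  generalize a₂ ^ 2 * (∏ i, (1 - p * a₀ / a₂ / d i)) * (1 - p * a₀ / a₁) = B at key ⊢
  generalize (1 - a₁ * X / p) * (1 - p * a₀ * X / a₁) = E₁ at key ⊢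
  generalize (1 - a₂ * X / p) * (1 - p * a₀ * X / a₂) = E₂ at key ⊢
  generalize 1 - p * a₀ * X / a₁ = c₃ at key ⊢
  generalize 1 - p * a₀ * X / a₂ = c₄ at key ⊢
  generalize 1 - a₁ * X / p = c₅ at key ⊢
  generalize 1 - a₂ * X / p = c₆ at key ⊢
  generalize 1 - X = c₇ at key ⊢
  generalize 1 - a₀ * X ^ 2 = c₈ at key ⊢
  generalize p * (a₁ - a₂) = k at key ⊢
  generalize ∏ i, (1 - d i) = Q at key ⊢
  generalize ∏ i, (1 - d i * X) = Q₁ at key ⊢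
  generalize ∏ i, (1 - a₀ * X / d i) = Q₂ at key ⊢
  linear_combination (1 - a₀) * R * key

/-- Combination of terms of the second series that telescopes. -/
lemma secondTerm_down (hp : ‖p‖ < 1) (hp0 : p ≠ 0) (h₀ : a₀ ≠ 0) (h₁ : a₁ ≠ 0) (h₂ : a₂ ≠ 0)
    (hd : ∀ i, d i ≠ 0) (hbal : a₁ * a₂ * ∏ i, d i = p ^ 2 * a₀ ^ 3) (n : ℕ) {X : ℂ}
    (hX : d 4 * p ^ (n + 1) = a₀ * X)
    (u₁ : qPochInf (a₁ * X / p) p ≠ 0) (u₂ : qPochInf (a₂ * X / p) p ≠ 0)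
    (u_d : ∀ i, qPochInf (d i * X) p ≠ 0) :
    (1 - a₀) * (-(a₁ ^ 2 * (∏ i, (1 - p * a₀ / a₁ / d i)) * (1 - p * a₀ / a₂)) *
          (p * (1 - p * a₀) * (1 - a₂) *
            secondTerm p (p ^ 2 * a₀) a₁ (p * a₂) (fun i => p * d i) (n + 1) (X / p)) +
        a₂ ^ 2 * (∏ i, (1 - p * a₀ / a₂ / d i)) * (1 - p * a₀ / a₁) *
          (p * (1 - p * a₀) * (1 - a₁) *
            secondTerm p (p ^ 2 * a₀) (p * a₁) a₂ (fun i => p * d i) (n + 1) (X / p))) +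
      p * (a₁ - a₂) * secondTerm p a₀ a₁ a₂ d (n + 1) X =
    (1 - a₀) * (p * (a₁ - a₂) * (1 - p * a₀ / a₁) * (1 - p * a₀ / a₂)) *
      (secondBoundary p a₀ a₁ a₂ d (n + 1) (p * X) - secondBoundary p a₀ a₁ a₂ d n X) := by
  have e1 : qPoch (p * d 4) p (n + 1) = qPoch (p * d 4) p n * (1 - a₀ * X) := by
    rw [qPoch_succ, ← hX]; ring
  have e2 : ∏ i, (1 - d i) = (∏ i : Fin 4, (1 - d i.castSucc)) * (1 - d 4) :=
    Fin.prod_univ_castSucc _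
  rw [← secondTerm_swap (a₁ := p * a₁), secondTerm_shift_core hp hp0 _ u₂,
    secondTerm_shift_core hp hp0 _ u₁, secondCore_swap (a₁ := a₁), secondTerm_core hp hp0 _ u₁ u₂,
    secondBoundary_mul_core hp _ u₁ u₂ u_d, secondBoundary_eq hp, e1, qPoch_succ' (d 4)]
  have key := down_identity hp0 h₀ h₁ h₂ hd hbal X
  rw [e2] at key
  generalize secondCore p a₀ a₁ a₂ d X = R
  generalize qPoch (p * d 4) p n = S
  generalize p * (a₁ - a₂) * (1 - p * a₀ / a₁) * (1 - p * a₀ / a₂) = K at key ⊢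
  generalize a₁ ^ 2 * (∏ i, (1 - p * a₀ / a₁ / d i)) * (1 - p * a₀ / a₂) = A at key ⊢
  generalize a₂ ^ 2 * (∏ i, (1 - p * a₀ / a₂ / d i)) * (1 - p * a₀ / a₁) = B at key ⊢
  generalize (1 - a₁ * X / p) * (1 - p * a₀ * X / a₁) = E₁ at key ⊢
  generalize (1 - a₂ * X / p) * (1 - p * a₀ * X / a₂) = E₂ at key ⊢
  generalize 1 - p * a₀ * X / a₁ = c₃ at key ⊢
  generalize 1 - p * a₀ * X / a₂ = c₄ at key ⊢
  generalize 1 - a₁ * X / p = c₅ at key ⊢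
  generalize 1 - a₂ * X / p = c₆ at key ⊢
  generalize 1 - X = c₇ at key ⊢
  generalize 1 - a₀ * X ^ 2 = c₈ at key ⊢
  generalize p * (a₁ - a₂) = k at key ⊢
  generalize ∏ i : Fin 4, (1 - d i.castSucc) = Q at key ⊢
  generalize ∏ i, (1 - d i * X) = Q₁ at key ⊢
  generalize ∏ i, (1 - a₀ * X / d i) = Q₂ at key ⊢
  linear_combination (1 - a₀) * R * S * key

/-- The second telescoping sum starts with no lower boundary term: the would-be contribution
contains `1 - a₀ y / d₄ = 0`. -/
lemma secondTerm_down_zero (hp : ‖p‖ < 1) (hp0 : p ≠ 0) (h₀ : a₀ ≠ 0) (h₁ : a₁ ≠ 0) (h₂ : a₂ ≠ 0)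
    (hd : ∀ i, d i ≠ 0) (hbal : a₁ * a₂ * ∏ i, d i = p ^ 2 * a₀ ^ 3) {y : ℂ} (hy : a₀ * y = d 4)
    (u₁ : qPochInf (a₁ * y / p) p ≠ 0) (u₂ : qPochInf (a₂ * y / p) p ≠ 0)
    (u_d : ∀ i, qPochInf (d i * y) p ≠ 0) :
    (1 - a₀) * (-(a₁ ^ 2 * (∏ i, (1 - p * a₀ / a₁ / d i)) * (1 - p * a₀ / a₂)) *
          (p * (1 - p * a₀) * (1 - a₂) *
            secondTerm p (p ^ 2 * a₀) a₁ (p * a₂) (fun i => p * d i) 0 (y / p)) +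
        a₂ ^ 2 * (∏ i, (1 - p * a₀ / a₂ / d i)) * (1 - p * a₀ / a₁) *
          (p * (1 - p * a₀) * (1 - a₁) *
            secondTerm p (p ^ 2 * a₀) (p * a₁) a₂ (fun i => p * d i) 0 (y / p))) +
      p * (a₁ - a₂) * secondTerm p a₀ a₁ a₂ d 0 y =
    (1 - a₀) * (p * (a₁ - a₂) * (1 - p * a₀ / a₁) * (1 - p * a₀ / a₂)) *
      secondBoundary p a₀ a₁ a₂ d 0 (p * y) := by
  have hy0 : y ≠ 0 := right_ne_zero_of_mul (hy ▸ hd 4)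
  have e2 : ∏ i, (1 - d i * y) = (∏ i : Fin 4, (1 - d i.castSucc * y)) * (1 - a₀ * y ^ 2) := by
    rw [Fin.prod_univ_castSucc, show Fin.last 4 = 4 from rfl, ← hy]; ring
  rw [← secondTerm_swap (a₁ := p * a₁), secondTerm_shift_core hp hp0 _ u₂,
    secondTerm_shift_core hp hp0 _ u₁, secondCore_swap (a₁ := a₁), secondTerm_core hp hp0 _ u₁ u₂,
    secondBoundary_mul_core hp _ u₁ u₂ u_d, e2, qPoch_zero, qPoch_zero]
  have key := down_identity_zero hp0 h₀ h₁ h₂ hd hbal hy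
  rw [div_mul_eq_mul_div, eq_div_iff hy0] at key
  generalize secondCore p a₀ a₁ a₂ d y = R
  generalize p * (a₁ - a₂) * (1 - p * a₀ / a₁) * (1 - p * a₀ / a₂) = K at key ⊢
  generalize a₁ ^ 2 * (∏ i, (1 - p * a₀ / a₁ / d i)) * (1 - p * a₀ / a₂) = A at key ⊢
  generalize a₂ ^ 2 * (∏ i, (1 - p * a₀ / a₂ / d i)) * (1 - p * a₀ / a₁) = B at key ⊢
  generalize (1 - a₁ * y / p) * (1 - p * a₀ * y / a₁) = E₁ at key ⊢
  generalize (1 - a₂ * y / p) * (1 - p * a₀ * y / a₂) = E₂ at key ⊢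
  generalize 1 - p * a₀ * y / a₁ = c₃ at key ⊢
  generalize 1 - p * a₀ * y / a₂ = c₄ at key ⊢
  generalize 1 - a₁ * y / p = c₅ at key ⊢
  generalize 1 - a₂ * y / p = c₆ at key ⊢
  generalize 1 - y = c₇ at key ⊢
  generalize 1 - a₀ * y ^ 2 = c₈ at key ⊢
  generalize p * (a₁ - a₂) = k at key ⊢
  generalize ∏ i : Fin 4, (1 - d i.castSucc) = Q at key ⊢
  generalize ∏ i : Fin 4, (1 - d i.castSucc * y) = Q₁ at key ⊢
  linear_combination (1 - a₀) * R * c₈ * key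

lemma tendsto_firstBoundary (hp : ‖p‖ < 1) :
    Tendsto (fun n => firstBoundary p a₀ a₁ a₂ d n (p ^ (n + 1))) atTop
      (𝓝 (qPochInf (p * a₀) p * qPochInf a₁ p * qPochInf a₂ p * ∏ i, qPochInf (p * d i) p)) := by
  have h : ∀ c e, Tendsto (fun n : ℕ => qPochInf (c * p ^ (n + 1) / e) p) atTop (𝓝 1) := by
    intro c e
    have := tendsto_qPochInf_pow hp (p * c / e)
    refine this.congr fun n => ?_
    rw [pow_succ]; congr 1; ring
  have h1 : Tendsto (fun n : ℕ => qPochInf (p ^ (n + 1)) p) atTop (𝓝 1) := by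
    simpa only [one_mul, div_one] using h 1 1
  have := (((tendsto_qPoch hp (p * a₀)).mul h1).mul ((tendsto_qPoch hp a₁).mul
    (h (p * a₀) a₁))).mul ((tendsto_qPoch hp a₂).mul (h (p * a₀) a₂)) |>.mul
    ((tendsto_finsetProd Finset.univ fun i _ => tendsto_qPoch hp (p * d i)).mul
      (tendsto_finsetProd Finset.univ fun i _ => h a₀ (d i)))
  simpa only [firstBoundary, mul_one, Finset.prod_const_one] using this

/-- The limit is opposite to that in `tendsto_firstBoundary` and independent of `y`, which is why
the two series of `Φ` must be taken together. -/
lemma tendsto_secondBoundary (hp : ‖p‖ < 1) (y : ℂ) :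
    Tendsto (fun n => secondBoundary p a₀ a₁ a₂ d n (y * p ^ (n + 1))) atTop
      (𝓝 (-(qPochInf (p * a₀) p * qPochInf a₁ p * qPochInf a₂ p *
        ∏ i, qPochInf (p * d i) p))) := by
  have h : ∀ c e, Tendsto (fun n : ℕ => qPochInf (c * (y * p ^ (n + 1)) / e) p) atTop (𝓝 1) := by
    intro c e
    have := tendsto_qPochInf_pow hp (p * y * c / e)
    refine this.congr fun n => ?_
    rw [pow_succ]; congr 1; ring
  have h1 : ∀ c, Tendsto (fun n : ℕ => qPochInf (c * (y * p ^ (n + 1))) p) atTop (𝓝 1) := by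
    intro c; simpa only [div_one] using h c 1
  have h2 : Tendsto (fun n : ℕ => qPochInf (y * p ^ (n + 1)) p) atTop (𝓝 1) := by
    simpa only [one_mul] using h1 1
  have hdiv : ∀ {f : ℕ → ℂ} (a : ℂ), Tendsto f atTop (𝓝 1) →
      Tendsto (fun n => a / f n) atTop (𝓝 a) := by
    intro f a hf
    have := (tendsto_const_nhds (x := a)).div hf one_ne_zero
    rwa [div_one] at this
  have := ((((hdiv (qPochInf (p * a₀) p) (h1 (d 4))).mul h2).neg).mul
    ((hdiv (qPochInf a₁ p) (h a₁ p)).mul (h (p * a₀) a₁))).mul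
    ((hdiv (qPochInf a₂ p) (h a₂ p)).mul (h (p * a₀) a₂)) |>.mul
    (((tendsto_finsetProd Finset.univ fun (i : Fin 4) _ =>
      hdiv (qPochInf (p * d i.castSucc) p) (h1 (d i.castSucc))).mul (tendsto_qPoch hp (p * d 4))).mul
      (tendsto_finsetProd Finset.univ fun i _ => h a₀ (d i)))
  rw [Fin.prod_univ_castSucc (n := 4), show Fin.last 4 = 4 from rfl]
  refine (congrArg (fun l => Tendsto _ atTop (𝓝 l)) ?_).mp this
  simp only [mul_one, Finset.prod_const_one]
  ring

lemma sum_eq_of_telescope {f g : ℕ → ℂ} {c l : ℂ} (hf : Summable f) (h0 : f 0 = c * g 0)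
    (h : ∀ n, f (n + 1) = c * (g (n + 1) - g n)) (hg : Tendsto g atTop (𝓝 l)) :
    ∑' n, f n = c * l := by
  have hs : ∀ n, ∑ k ∈ Finset.range (n + 1), f k = c * g n := by
    intro n
    induction n with
    | zero => simpa using h0
    | succ n ih => rw [Finset.sum_range_succ, ih, h]; ring
  refine tendsto_nhds_unique ((tendsto_add_atTop_iff_nat 1).2 hf.hasSum.tendsto_sum_nat) ?_
  simp only [hs]
  exact hg.const_mul c

end Downward

/-- The contiguity relation between `Φ(p² a₀; a₁, p a₂, p a₃, …)`, `Φ(p² a₀; p a₁, a₂, p a₃, …)`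
and `Φ(a₀; a₁, a₂, a₃, …)`, with `p = q ^ 2`. -/
theorem Phi_down {q a₀ a₁ a₂ : ℂ} {d : Fin 5 → ℂ} (hq0 : q ≠ 0) (hq : ‖q‖ < 1)
    (hbal : a₁ * a₂ * ∏ i, d i = (q ^ 2) ^ 2 * a₀ ^ 3)
    (hU : PhiDefined q (paramVec a₀ a₁ a₂ d))
    (hV : PhiDefined q (paramVec ((q ^ 2) ^ 2 * a₀) a₁ (q ^ 2 * a₂) fun i => q ^ 2 * d i))
    (hV' : PhiDefined q (paramVec ((q ^ 2) ^ 2 * a₀) (q ^ 2 * a₁) a₂ fun i => q ^ 2 * d i)) :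
    (1 - q ^ 2 * a₀) * (1 - (q ^ 2) ^ 2 * a₀) *
      (a₁ ^ 2 * (∏ i, (1 - q ^ 2 * a₀ / a₁ / d i)) * (1 - q ^ 2 * a₀ / a₂) *
          (1 - (q ^ 2) ^ 2 * a₀ / a₂) * (1 - a₂) *
          Phi q (paramVec ((q ^ 2) ^ 2 * a₀) a₁ (q ^ 2 * a₂) fun i => q ^ 2 * d i) -
        a₂ ^ 2 * (∏ i, (1 - q ^ 2 * a₀ / a₂ / d i)) * (1 - q ^ 2 * a₀ / a₁) *
          (1 - (q ^ 2) ^ 2 * a₀ / a₁) * (1 - a₁) *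
          Phi q (paramVec ((q ^ 2) ^ 2 * a₀) (q ^ 2 * a₁) a₂ fun i => q ^ 2 * d i)) =
    (a₁ - a₂) * (1 - q ^ 2 * a₀ / a₁) * (1 - (q ^ 2) ^ 2 * a₀ / a₁) * (1 - q ^ 2 * a₀ / a₂) *
      (1 - (q ^ 2) ^ 2 * a₀ / a₂) * (∏ i, (1 - q ^ 2 * a₀ / d i)) *
      Phi q (paramVec a₀ a₁ a₂ d) := by
  have hp := norm_sq_lt_one hq
  have zU := hU.phiNonzero hq
  have zV := hV.phiNonzero hq
  have zV' := hV'.phiNonzero hq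
  obtain ⟨s1, t1, n1⟩ := normFactor_mul_Phi hq hU
  obtain ⟨s2, t2, n2⟩ := normFactor_mul_Phi hq hV
  obtain ⟨s3, t3, n3⟩ := normFactor_mul_Phi hq hV'
  have hp0 : q ^ 2 ≠ 0 := pow_ne_zero 2 hq0
  generalize q ^ 2 = p at *
  have h₀ := zU.a₀_ne
  have h₁ := zU.a₁_ne
  have h₂ := zU.a₂_ne
  have harg : ∀ n : ℕ, p * d 4 / (p ^ 2 * a₀) * p ^ n = d 4 / a₀ * p ^ n / p := by
    intro n; field_simp
  simp only [harg] at t2 t3 n2 n3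
  have v₁ : ∀ n : ℕ, qPochInf (a₁ * (d 4 / a₀ * p ^ n) / p) p ≠ 0 := by
    intro n
    convert qPochInf_pow_ne_zero hp zV.upper₁' n using 2
    field_simp
  have v₂ : ∀ n : ℕ, qPochInf (a₂ * (d 4 / a₀ * p ^ n) / p) p ≠ 0 := by
    intro n
    convert qPochInf_pow_ne_zero hp zV'.upper₂' n using 2
    field_simp
  have v_d : ∀ (n : ℕ) i, qPochInf (d i * (d 4 / a₀ * p ^ n)) p ≠ 0 := by
    intro n i
    convert qPochInf_pow_ne_zero hp (zU.upper_d' i) n using 2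
    ring
  set A := a₁ ^ 2 * (∏ i, (1 - p * a₀ / a₁ / d i)) * (1 - p * a₀ / a₂) with hA
  set B := a₂ ^ 2 * (∏ i, (1 - p * a₀ / a₂ / d i)) * (1 - p * a₀ / a₁) with hB
  set K := p * (a₁ - a₂) * (1 - p * a₀ / a₁) * (1 - p * a₀ / a₂) with hK
  set l := qPochInf (p * a₀) p * qPochInf a₁ p * qPochInf a₂ p * ∏ i, qPochInf (p * d i) p
  have sum1 : (1 - a₀) * (-A * (p * (1 - p * a₀) * (1 - a₂) *
        ∑' n, firstTerm p (p ^ 2 * a₀) a₁ (p * a₂) (fun i => p * d i) n) +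
      B * (p * (1 - p * a₀) * (1 - a₁) *
        ∑' n, firstTerm p (p ^ 2 * a₀) (p * a₁) a₂ (fun i => p * d i) n)) +
      p * (a₁ - a₂) * ∑' n, firstTerm p a₀ a₁ a₂ d n = (1 - a₀) * K * l := by
    have s1' := (summable_nat_add_iff 1).2 s1
    have hs := ((((s2.mul_left (p * (1 - p * a₀) * (1 - a₂))).mul_left (-A)).add
      ((s3.mul_left (p * (1 - p * a₀) * (1 - a₁))).mul_left B)).mul_left (1 - a₀)).add
      (s1'.mul_left (p * (a₁ - a₂)))
    have h := hs.hasSum.tendsto_sum_nat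
    -- Term `n + 1` of the unshifted series is paired with term `n` of the shifted ones. The
    -- unpaired zeroth term is exactly the initial boundary term.
    have h0 : p * (a₁ - a₂) * firstTerm p a₀ a₁ a₂ d 0 =
        (1 - a₀) * K * firstBoundary p a₀ a₁ a₂ d 0 p := by
      simp only [firstTerm_zero, normFactor, firstBoundary, qPoch_zero, Finset.prod_const_one,
        one_mul, show ∀ c, a₀ * p / c = p * a₀ / c from fun c => by ring]
      rw [qPochInf_succ hp (p * a₀ / a₁), qPochInf_succ hp (p * a₀ / a₂),
        show p * (p * a₀ / a₁) = p * a₀ * p / a₁ by ring,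
        show p * (p * a₀ / a₂) = p * a₀ * p / a₂ by ring, hK]
      ring
    have hN : ∀ N : ℕ, ∑ n ∈ Finset.range N, ((1 - a₀) * (-A * (p * (1 - p * a₀) * (1 - a₂) *
        firstTerm p (p ^ 2 * a₀) a₁ (p * a₂) (fun i => p * d i) n) +
        B * (p * (1 - p * a₀) * (1 - a₁) *
          firstTerm p (p ^ 2 * a₀) (p * a₁) a₂ (fun i => p * d i) n)) +
        p * (a₁ - a₂) * firstTerm p a₀ a₁ a₂ d (n + 1)) =
        (1 - a₀) * K * firstBoundary p a₀ a₁ a₂ d N (p ^ (N + 1)) -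
          p * (a₁ - a₂) * firstTerm p a₀ a₁ a₂ d 0 := by
      intro N
      induction N with
      | zero => rw [h0]; simp
      | succ N ih =>
        rw [Finset.sum_range_succ, ih, firstTerm_down hp hp0 h₀ h₁ h₂ zU.d_ne hbal,
          show p * p ^ (N + 1) = p ^ (N + 1 + 1) by ring]
        ring
    have lim := tendsto_nhds_unique h
      (((((tendsto_firstBoundary (a₀ := a₀) (a₁ := a₁) (a₂ := a₂) (d := d) hp).const_mul
        ((1 - a₀) * K)).sub_const (p * (a₁ - a₂) * firstTerm p a₀ a₁ a₂ d 0))).congr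
        fun N => (hN N).symm)
    rw [Summable.tsum_add, tsum_mul_left, Summable.tsum_add, tsum_mul_left, tsum_mul_left,
      tsum_mul_left, tsum_mul_left, tsum_mul_left] at lim
    · rw [s1.tsum_eq_zero_add]
      linear_combination lim
    · exact (s2.mul_left _).mul_left _
    · exact (s3.mul_left _).mul_left _
    · exact (((s2.mul_left _).mul_left _).add ((s3.mul_left _).mul_left _)).mul_left _
    · exact s1'.mul_left _
  have sum2 : (1 - a₀) * (-A * (p * (1 - p * a₀) * (1 - a₂) *
        ∑' n, secondTerm p (p ^ 2 * a₀) a₁ (p * a₂) (fun i => p * d i) n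
          (d 4 / a₀ * p ^ n / p)) +
      B * (p * (1 - p * a₀) * (1 - a₁) *
        ∑' n, secondTerm p (p ^ 2 * a₀) (p * a₁) a₂ (fun i => p * d i) n
          (d 4 / a₀ * p ^ n / p))) +
      p * (a₁ - a₂) * ∑' n, secondTerm p a₀ a₁ a₂ d n (d 4 / a₀ * p ^ n) =
      (1 - a₀) * K * -l := by
    have hs := ((((t2.mul_left (p * (1 - p * a₀) * (1 - a₂))).mul_left (-A)).add
      ((t3.mul_left (p * (1 - p * a₀) * (1 - a₁))).mul_left B)).mul_left (1 - a₀)).add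
      (t1.mul_left (p * (a₁ - a₂)))
    have lim := sum_eq_of_telescope hs (c := (1 - a₀) * K)
      (g := fun n => secondBoundary p a₀ a₁ a₂ d n (d 4 / a₀ * p ^ (n + 1))) ?_ ?_
      (tendsto_secondBoundary hp _)
    · rw [Summable.tsum_add, tsum_mul_left, Summable.tsum_add, tsum_mul_left, tsum_mul_left,
        tsum_mul_left, tsum_mul_left, tsum_mul_left] at lim
      · exact lim
      · exact (t2.mul_left _).mul_left _
      · exact (t3.mul_left _).mul_left _
      · exact (((t2.mul_left _).mul_left _).add ((t3.mul_left _).mul_left _)).mul_left _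
      · exact t1.mul_left _
    · have := secondTerm_down_zero hp hp0 h₀ h₁ h₂ zU.d_ne hbal (y := d 4 / a₀)
        (by field_simp) (by simpa using v₁ 0) (by simpa using v₂ 0) (by simpa using v_d 0)
      simpa [mul_comm p (d 4 / a₀)] using this
    · intro n
      have := secondTerm_down hp hp0 h₀ h₁ h₂ zU.d_ne hbal n (X := d 4 / a₀ * p ^ (n + 1))
        (by field_simp) (v₁ _) (v₂ _) (v_d _)
      rw [show p * (d 4 / a₀ * p ^ (n + 1)) = d 4 / a₀ * p ^ (n + 1 + 1) by ring] at this
      exact this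
  -- The contributions `l` and `-l` at infinity cancel, so the relation for `Φ` is homogeneous
  -- although neither series satisfies it separately in general.
  have total : (1 - a₀) * (-A * (p * (1 - p * a₀) * (1 - a₂) *
        (normFactor p (p ^ 2 * a₀) a₁ (p * a₂) (fun i => p * d i) *
          Phi q (paramVec (p ^ 2 * a₀) a₁ (p * a₂) fun i => p * d i))) +
      B * (p * (1 - p * a₀) * (1 - a₁) *
        (normFactor p (p ^ 2 * a₀) (p * a₁) a₂ (fun i => p * d i) *
          Phi q (paramVec (p ^ 2 * a₀) (p * a₁) a₂ fun i => p * d i)))) +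
      p * (a₁ - a₂) * (normFactor p a₀ a₁ a₂ d * Phi q (paramVec a₀ a₁ a₂ d)) = 0 := by
    rw [n1, n2, n3]
    linear_combination sum1 + sum2
  have hN := normFactor_shift hp (a₀ := a₀) (a₁ := a₁) (a₂ := a₂) (d := d) hp0
  have hN' := normFactor_shift hp (a₀ := a₀) (a₁ := a₂) (a₂ := a₁) (d := d) hp0
  rw [normFactor_swap, normFactor_swap (a₁ := p * a₁)] at hN'
  have hne : normFactor p a₀ a₁ a₂ d ≠ 0 := by
    refine mul_ne_zero (mul_ne_zero (mul_ne_zero (mul_ne_zero zU.one_sub_ne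
      (qPochInf_self_ne_zero hp)) zU.lower₁) zU.lower₂) (Finset.prod_ne_zero_iff.2 fun i _ =>
        zU.lower_d i)
  refine mul_left_cancel₀ (mul_ne_zero hne hp0) ?_
  clear_value A B K l
  clear sum1 sum2 n1 n2 n3
  generalize Phi q (paramVec (p ^ 2 * a₀) a₁ (p * a₂) fun i => p * d i) = V at *
  generalize Phi q (paramVec (p ^ 2 * a₀) (p * a₁) a₂ fun i => p * d i) = V' at *
  generalize Phi q (paramVec a₀ a₁ a₂ d) = U at *
  generalize normFactor p a₀ a₁ a₂ d = N at *
  generalize normFactor p (p ^ 2 * a₀) a₁ (p * a₂) (fun i => p * d i) = M at *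
  generalize normFactor p (p ^ 2 * a₀) (p * a₁) a₂ (fun i => p * d i) = M' at *
  generalize ∏ i, (1 - p * a₀ / d i) = D at *
  generalize 1 - p * a₀ / a₁ = c₁ at *
  generalize 1 - p * a₀ / a₂ = c₂ at *
  generalize 1 - p ^ 2 * a₀ / a₁ = e₁ at *
  generalize 1 - p ^ 2 * a₀ / a₂ = e₂ at *
  generalize 1 - p ^ 2 * a₀ = w at *
  linear_combination (-(c₁ * c₂ * D * e₁ * e₂)) * total +
    (A * p * (1 - p * a₀) * (1 - a₂) * V * e₂) * hN -
    (B * p * (1 - p * a₀) * (1 - a₁) * V' * e₁) * hN'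

/-! ### Curves of bidegree `(1, 1)` -/

/-- The form of bidegree `(1, 1)`, homogenised as a linear form in `(1, f, g, f g)`, through the
points `(b t + 1 / (b t), s / b + b / s)` for four values of `b` with elementary symmetric
functions `e₁, e₂, e₃, s² / t²`. -/
def curve (e₁ e₂ e₃ s t w x y z : ℂ) : ℂ :=
  (s ^ 2 * t ^ 2 - 1) * (t / s * e₂ - s * t - 1 / (s * t)) * w - t ^ 2 * (s * e₁ - e₃ / s) * x +
    t * (e₁ - e₃ * t ^ 2) * y + (s ^ 2 * t ^ 2 - 1) * z

/-- The determinant is alternating in the three parameters, so a Vandermonde factor splits off. What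
is left is the (1,1)-curve, symmetric in all four parameters because the fourth intersection is
determined by the product `s² / t²`. -/
lemma riccatiDet_eq_curve {b : ℕ → ℂ} {s t : ℂ} {i j k l : ℕ} (hs : s ≠ 0) (ht : t ≠ 0)
    (hi : b i ≠ 0) (hj : b j ≠ 0) (hk : b k ≠ 0) (h : b i * b j * b k * b l * t ^ 2 = s ^ 2)
    (w x y z : ℂ) :
    riccatiDet b s t i j k w x y z * (s * t * b i * b j * b k) =
      (b i - b j) * (b i - b k) * (b j - b k) *
        curve (b i + b j + b k + b l)
          (b i * b j + b i * b k + b i * b l + b j * b k + b j * b l + b k * b l)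
          (b i * b j * b k + b i * b j * b l + b i * b k * b l + b j * b k * b l) s t w x y z := by
  have hl : b l = s ^ 2 / (b i * b j * b k * t ^ 2) := by
    rw [eq_div_iff (by simp [hi, hj, hk, ht]), ← h]; ring
  rw [hl]
  simp only [riccatiDet, Matrix.det_succ_row_zero, Fin.sum_univ_succ]
  simp [fPt, gPt, curve, Fin.succAbove]
  generalize b i = B at hi ⊢
  generalize b j = C at hj ⊢
  generalize b k = D at hk ⊢
  field_simp
  ring

/-! ### The equation from two curves -/

/-- The quartic of the equation and its companion, for roots split into two groups of four. -/
lemma cleared_eq_of_curves {x y y' u u' o₁ o₂ o₃ h₁ h₂ h₃ : ℂ} (hu : u ≠ 0) (hu' : u' ≠ 0)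
    (hc : (u ^ 2 - 1) * (o₂ - u ^ 2 - 1) - (u ^ 2 * o₁ - o₃) * x + u * (o₁ - o₃) * y +
      u * (u ^ 2 - 1) * (x * y) = 0)
    (hc' : (u' ^ 2 - 1) * (h₂ - u' ^ 2 - 1) - (u' ^ 2 * h₁ - h₃) * x + u' * (h₁ - h₃) * y' +
      u' * (u' ^ 2 - 1) * (x * y') = 0)
    (hne : u ^ 2 = 1 → o₁ ≠ o₃) {Q Q' : ℂ}
    (hQ : Q = x ^ 4 - (o₁ + h₁) * x ^ 3 + ((o₂ + h₂ + o₁ * h₁) - 3 - u ^ 2 * u' ^ 2) * x ^ 2 +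
      ((u ^ 2 * h₃ + u' ^ 2 * o₃) - (o₃ + h₃ + o₁ * h₂ + o₂ * h₁) + 2 * (o₁ + h₁)) * x +
      (u ^ 2 * u' ^ 2 - (u ^ 2 * h₂ + u' ^ 2 * o₂ + o₃ * h₃) +
        (u ^ 2 + u' ^ 2 + o₁ * h₃ + o₃ * h₁ + o₂ * h₂) - (o₂ + h₂ + o₁ * h₁) + 1))
    (hQ' : Q' = u ^ 2 * u' ^ 2 * x ^ 4 - (u ^ 2 * h₃ + u' ^ 2 * o₃) * x ^ 3 +
      ((u ^ 2 * h₂ + u' ^ 2 * o₂ + o₃ * h₃) - 3 * (u ^ 2 * u' ^ 2) - 1) * x ^ 2 +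
      ((o₁ + h₁) - (u ^ 2 * h₁ + u' ^ 2 * o₁ + o₂ * h₃ + o₃ * h₂) +
        2 * (u ^ 2 * h₃ + u' ^ 2 * o₃)) * x +
      (u ^ 2 * u' ^ 2 - (u ^ 2 * h₂ + u' ^ 2 * o₂ + o₃ * h₃) +
        (u ^ 2 + u' ^ 2 + o₁ * h₃ + o₃ * h₁ + o₂ * h₂) - (o₂ + h₂ + o₁ * h₁) + 1)) :
    lhsNum x y y' u u' * Q' = Q * (lhsDen x y y' u u' * (u ^ 2 * u' ^ 2)) := by
  have hden : lhsDen x y y' u u' * (u ^ 2 * u' ^ 2) =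
      u * u' * ((y' - u' * x) * (y - u * x)) - (u' ^ 2 - 1) * (u ^ 2 - 1) := by
    rw [lhsDen]; field_simp
  rw [hden, lhsNum]
  set D := (u ^ 2 - 1) * x + (o₁ - o₃) with hD
  set D' := (u' ^ 2 - 1) * x + (h₁ - h₃) with hD'
  set N := (y' * u' - x) * (y * u - x) - (u' ^ 2 - 1) * (u ^ 2 - 1) with hN
  set M := u * u' * ((y' - u' * x) * (y - u * x)) - (u' ^ 2 - 1) * (u ^ 2 - 1) with hM
  -- Each curve is affine in `y` (respectively `y'`) with coefficient `u * D` (respectively `u' *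
  -- D'`). Multiplying `N` and `M` by `D * D'` removes `y` and `y'`, and the results are `Q` and
  -- `Q'` times `(u² - 1)(u'² - 1)`.
  have c1 : D * (y * u - x) = -((u ^ 2 - 1) * (x ^ 2 - o₁ * x + o₂ - u ^ 2 - 1)) := by
    rw [hD]; linear_combination hc
  have c2 : D' * (y' * u' - x) = -((u' ^ 2 - 1) * (x ^ 2 - h₁ * x + h₂ - u' ^ 2 - 1)) := by
    rw [hD']; linear_combination hc'
  have c3 : D * (u * (y - u * x)) =
      -((u ^ 2 - 1) * (u ^ 2 * x ^ 2 - o₃ * x + o₂ - u ^ 2 - 1)) := by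
    rw [hD]; linear_combination hc
  have c4 : D' * (u' * (y' - u' * x)) =
      -((u' ^ 2 - 1) * (u' ^ 2 * x ^ 2 - h₃ * x + h₂ - u' ^ 2 - 1)) := by
    rw [hD']; linear_combination hc'
  have k1 : N * (D * D') = (u ^ 2 - 1) * (u' ^ 2 - 1) * Q := by
    have : N * (D * D') = (D' * (y' * u' - x)) * (D * (y * u - x)) -
        (u' ^ 2 - 1) * (u ^ 2 - 1) * (D * D') := by rw [hN]; ring
    rw [this, c1, c2, hD, hD', hQ]; ring
  have k2 : M * (D * D') = (u ^ 2 - 1) * (u' ^ 2 - 1) * Q' := by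
    have : M * (D * D') = (D' * (u' * (y' - u' * x))) * (D * (u * (y - u * x))) -
        (u' ^ 2 - 1) * (u ^ 2 - 1) * (D * D') := by rw [hM]; ring
    rw [this, c3, c4, hD, hD', hQ']; ring
  -- When `u² = 1`, `hne` keeps the first curve nontrivial. It forces `y u = x` and `y = u x`, so
  -- both `N` and `M` vanish.
  by_cases h1 : u ^ 2 - 1 = 0
  · have h0 : o₁ - o₃ ≠ 0 := sub_ne_zero.2 (hne (sub_eq_zero.1 h1))
    have hDne : D ≠ 0 := by rw [hD, h1]; simpa using h0
    have e1 : y * u - x = 0 := by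
      rw [h1, zero_mul, neg_zero] at c1
      exact (mul_eq_zero.1 c1).resolve_left hDne
    have e2 : y - u * x = 0 := by
      rw [h1, zero_mul, neg_zero] at c3
      exact (mul_eq_zero.1 ((mul_eq_zero.1 c3).resolve_left hDne)).resolve_left hu
    rw [hN, hM, e1, e2, h1]; ring
  by_cases h2 : u' ^ 2 - 1 = 0
  -- Here the second form vanishes identically and says nothing about `y'`. Instead `Q` and `Q'`
  -- acquire a common quadratic factor, and the first curve alone gives the equation.
  · by_cases h3 : h₁ - h₃ = 0
    · have f1 : Q = (x ^ 2 - 2 - h₁ * x + h₂) * (x ^ 2 - o₁ * x + o₂ - u ^ 2 - 1) := by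
        rw [hQ, show u' ^ 2 = 1 from sub_eq_zero.1 h2, ← sub_eq_zero.1 h3]; ring
      have f2 : Q' = (x ^ 2 - 2 - h₁ * x + h₂) * (u ^ 2 * x ^ 2 - o₃ * x + o₂ - u ^ 2 - 1) := by
        rw [hQ', show u' ^ 2 = 1 from sub_eq_zero.1 h2, ← sub_eq_zero.1 h3]; ring
      by_cases h4 : D = 0
      · rw [h4, zero_mul, zero_eq_neg] at c1 c3
        rw [f1, f2, (mul_eq_zero.1 c1).resolve_left h1, (mul_eq_zero.1 c3).resolve_left h1]
        ring
      · refine mul_left_cancel₀ h4 ?_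
        have e : u' * (y' - u' * x) = y' * u' - x := by linear_combination -x * h2
        have hN' : N = (y' * u' - x) * (y * u - x) := by rw [hN, h2]; ring
        have hM' : M = (y' * u' - x) * (u * (y - u * x)) := by rw [hM, h2, ← e]; ring
        rw [hN', hM', f1, f2]
        linear_combination (y' * u' - x) * (x ^ 2 - 2 - h₁ * x + h₂) *
          ((u ^ 2 * x ^ 2 - o₃ * x + o₂ - u ^ 2 - 1) * c1 -
            (x ^ 2 - o₁ * x + o₂ - u ^ 2 - 1) * c3)
    · have hDne : D' ≠ 0 := by rw [hD', h2]; simpa using h3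
      have e1 : y' * u' - x = 0 := by
        rw [h2, zero_mul, neg_zero] at c2
        exact (mul_eq_zero.1 c2).resolve_left hDne
      have e2 : y' - u' * x = 0 := by
        rw [h2, zero_mul, neg_zero] at c4
        exact (mul_eq_zero.1 ((mul_eq_zero.1 c4).resolve_left hDne)).resolve_left hu'
      rw [hN, hM, e1, e2, h2]; ring
  -- If `D * D'` vanishes, `k1` and `k2` give `Q = Q' = 0`. Otherwise it can be cancelled.
  by_cases h3 : D * D' = 0
  · rw [h3, mul_zero] at k1 k2
    have hk := mul_ne_zero h1 h2
    rw [(mul_eq_zero.1 k1.symm).resolve_left hk, (mul_eq_zero.1 k2.symm).resolve_left hk]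
    ring
  · refine mul_left_cancel₀ h3 ?_
    linear_combination Q' * k1 - Q * k2

lemma FracEq.of_mul_eq {a b c d : ℂ} (h : a * d = c * b) : FracEq a b c d :=
  ⟨h, fun hb hd => by rw [div_eq_div_iff hb hd, h]⟩

/-- Two curves of bidegree `(1, 1)` imply the `q`-Painlevé equation. -/
theorem fracEq_of_curves {x y y' u u' o₁ o₂ o₃ h₁ h₂ h₃ T : ℂ} {m : ℕ → ℂ} (hu : u ≠ 0)
    (hu' : u' ≠ 0) (hT : T ≠ 0)
    (hc : (u ^ 2 - 1) * (o₂ - u ^ 2 - 1) - (u ^ 2 * o₁ - o₃) * x + u * (o₁ - o₃) * y +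
      u * (u ^ 2 - 1) * (x * y) = 0)
    (hc' : (u' ^ 2 - 1) * (h₂ - u' ^ 2 - 1) - (u' ^ 2 * h₁ - h₃) * x + u' * (h₁ - h₃) * y' +
      u' * (u' ^ 2 - 1) * (x * y') = 0)
    (hne : u ^ 2 = 1 → o₁ ≠ o₃) (hT8 : T ^ 8 = u ^ 2 * u' ^ 2)
    (m1 : m 1 * T = o₁ + h₁) (m2 : m 2 * T ^ 2 = o₂ + h₂ + o₁ * h₁)
    (m3 : m 3 * T ^ 3 = o₃ + h₃ + o₁ * h₂ + o₂ * h₁)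
    (m4 : m 4 * T ^ 4 = u ^ 2 + u' ^ 2 + o₁ * h₃ + o₃ * h₁ + o₂ * h₂)
    (m5 : m 5 * T ^ 5 = u ^ 2 * h₁ + u' ^ 2 * o₁ + o₂ * h₃ + o₃ * h₂)
    (m6 : m 6 * T ^ 6 = u ^ 2 * h₂ + u' ^ 2 * o₂ + o₃ * h₃)
    (m7 : m 7 * T ^ 7 = u ^ 2 * h₃ + u' ^ 2 * o₃) :
    FracEq (lhsNum x y y' u u') (lhsDen x y y' u u') (quarticP x T m)
      (quarticP x T⁻¹ (revM m)) := by
  have key := cleared_eq_of_curves (Q := quarticP x T m)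
    (Q' := T ^ 8 * quarticP x T⁻¹ (revM m)) hu hu' hc hc' hne ?_ ?_
  · refine FracEq.of_mul_eq (mul_left_cancel₀ (pow_ne_zero 8 hT) ?_)
    rw [← hT8] at key
    linear_combination key
  · rw [quarticP, ← m1, ← m2, ← m3, ← m4, ← m6, ← m7, ← hT8]; ring
  · rw [quarticP, ← m1, ← m2, ← m4, ← m5, ← m6, ← m7, ← hT8]
    simp only [revM, Nat.reduceSub]
    field_simp
    ring

lemma esymm_cons (a : ℂ) (S : Multiset ℂ) (k : ℕ) :
    (a ::ₘ S).esymm (k + 1) = S.esymm (k + 1) + a * S.esymm k := by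
  simp [Multiset.esymm, Multiset.powersetCard_cons, Multiset.map_map,
    Multiset.sum_map_mul_left]

/-- The elementary symmetric functions of `b₁, …, b₈` in terms of those of the two groups of
four. -/
lemma mSym_eq (b : ℕ → ℂ) {e₁ e₂ e₃ e₄ h₁ h₂ h₃ h₄ : ℂ}
    (he₁ : e₁ = b 1 + b 3 + b 5 + b 7)
    (he₂ : e₂ = b 1 * b 3 + b 1 * b 5 + b 1 * b 7 + b 3 * b 5 + b 3 * b 7 + b 5 * b 7)
    (he₃ : e₃ = b 1 * b 3 * b 5 + b 1 * b 3 * b 7 + b 1 * b 5 * b 7 + b 3 * b 5 * b 7)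
    (he₄ : e₄ = b 1 * b 3 * b 5 * b 7)
    (hh₁ : h₁ = b 8 + b 6 + b 4 + b 2)
    (hh₂ : h₂ = b 8 * b 6 + b 8 * b 4 + b 8 * b 2 + b 6 * b 4 + b 6 * b 2 + b 4 * b 2)
    (hh₃ : h₃ = b 8 * b 6 * b 4 + b 8 * b 6 * b 2 + b 8 * b 4 * b 2 + b 6 * b 4 * b 2)
    (hh₄ : h₄ = b 2 * b 4 * b 6 * b 8) :
    mSym b 1 = e₁ + h₁ ∧ mSym b 2 = e₂ + h₂ + e₁ * h₁ ∧
    mSym b 3 = e₃ + h₃ + e₁ * h₂ + e₂ * h₁ ∧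
    mSym b 4 = e₄ + h₄ + e₁ * h₃ + e₃ * h₁ + e₂ * h₂ ∧
    mSym b 5 = e₄ * h₁ + h₄ * e₁ + e₂ * h₃ + e₃ * h₂ ∧
    mSym b 6 = e₄ * h₂ + h₄ * e₂ + e₃ * h₃ ∧ mSym b 7 = e₄ * h₃ + h₄ * e₃ := by
  have hS : (Finset.Icc 1 8).val.map b =
      b 1 ::ₘ b 2 ::ₘ b 3 ::ₘ b 4 ::ₘ b 5 ::ₘ b 6 ::ₘ b 7 ::ₘ b 8 ::ₘ 0 := rfl
  have z0 : ∀ S : Multiset ℂ, S.esymm 0 = 1 := by intro S; simp [Multiset.esymm]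
  have zs : ∀ k, (0 : Multiset ℂ).esymm (k + 1) = 0 := by
    intro k; simp [Multiset.esymm, Multiset.powersetCard_zero_right]
  have c : ∀ (a : ℂ) (S : Multiset ℂ),
      (a ::ₘ S).esymm 1 = S.esymm 1 + a ∧ (a ::ₘ S).esymm 2 = S.esymm 2 + a * S.esymm 1 ∧
      (a ::ₘ S).esymm 3 = S.esymm 3 + a * S.esymm 2 ∧
      (a ::ₘ S).esymm 4 = S.esymm 4 + a * S.esymm 3 ∧
      (a ::ₘ S).esymm 5 = S.esymm 5 + a * S.esymm 4 ∧
      (a ::ₘ S).esymm 6 = S.esymm 6 + a * S.esymm 5 ∧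
      (a ::ₘ S).esymm 7 = S.esymm 7 + a * S.esymm 6 := by
    intro a S
    refine ⟨?_, esymm_cons _ _ _, esymm_cons _ _ _, esymm_cons _ _ _, esymm_cons _ _ _,
      esymm_cons _ _ _, esymm_cons _ _ _⟩
    rw [esymm_cons a S 0, z0, mul_one]
  subst he₁ he₂ he₃ he₄ hh₁ hh₂ hh₃ hh₄
  simp only [mSym, hS, c, zs 0, zs 1, zs 2, zs 3, zs 4, zs 5, zs 6]
  refine ⟨?_, ?_, ?_, ?_, ?_, ?_, ?_⟩ <;> ring

/-! ### The Riccati equation in the coordinate `z`. -/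

/-- Eliminating `f` from two forms of bidegree `(1, 1)`. -/
lemma bilinear_of_curves {A B C D A' B' C' D' f g g' z z' f₁ g₁ g₈ f₈ g₁' g₈' : ℂ}
    (h₁ : A + B * f₁ + C * g₁ + D * (f₁ * g₁) = 0)
    (h₈ : A' + B' * f₈ + C' * g₈' + D' * (f₈ * g₈') = 0)
    (h : A + B * f + C * g + D * (f * g) = 0)
    (hg : (1 - z) * g = g₁ - z * g₈) (hg' : (1 - z') * g' = g₁' - z' * g₈') :
    ((B + D * g₁) - z * (B + D * g₈)) * (1 - z') * (A' + B' * f + C' * g' + D' * (f * g')) =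
      (B + D * g₁) * (A' + B' * f₁ + C' * g₁' + D' * (f₁ * g₁')) +
      (-((B + D * g₈) * (A' + B' * f₁ + C' * g₁' + D' * (f₁ * g₁'))) +
        (g₈ - g₁) * (C + D * f₁) * (B' + D' * g₁')) * z -
      (B' + D' * g₈') * (f₁ - f₈) * (B + D * g₁) * z' -
      (B' + D' * g₈') * (A + B * f₈ + C * g₈ + D * (f₈ * g₈)) * (z * z') := by
  obtain rfl : A = -(B * f₁ + C * g₁ + D * (f₁ * g₁)) := by linear_combination h₁
  obtain rfl : A' = -(B' * f₈ + C' * g₈' + D' * (f₈ * g₈')) := by linear_combination h₈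
  -- The odd curve solved for `f`, with `g` replaced by its expression in `z`.
  have hF : f * ((B + D * g₁) - z * (B + D * g₈)) =
      -((-(B * f₁ + C * g₁ + D * (f₁ * g₁)) + C * g₁) -
        z * (-(B * f₁ + C * g₁ + D * (f₁ * g₁)) + C * g₈)) := by
    linear_combination (1 - z) * h - (C + D * f) * hg
  linear_combination ((1 - z') * B' + D' * (g₁' - z' * g₈')) * hF +
    ((B + D * g₁) - z * (B + D * g₈)) * (C' + D' * f) * hg'

/-- The left bracket is the relation obtained by eliminating `f` between the two explicit curves;
the right one is the relation supplied by contiguity. They agree coefficient by coefficient in `1,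
z, z', z z'`. The `σ` and `τ` stand for the elementary symmetric functions of `b₃, b₅, b₇` and of
`b₂, b₄, b₆`, the third ones being fixed by the constraints. The separate variable `b₂` is only a
normalisation, and its powers cancel on the right. -/
lemma riccati_identity {r s b₁ b₂ b₈ σ₁ σ₂ τ₁ τ₂ z z' A B C D A' B' C' D' : ℂ} (hr : r ≠ 0)
    (hs : s ≠ 0) (h₁ : b₁ ≠ 0) (h₂ : b₂ ≠ 0) (h₈ : b₈ ≠ 0)
    (hA : A = ((s * (r * s)) ^ 2 - 1) * (r * (b₁ * σ₁ + σ₂) - s * (r * s) - 1 / (s * (r * s))))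
    (hB : B = -((r * s) ^ 2 * (s * (b₁ + σ₁) - (b₁ * σ₂ + 1 / (r ^ 2 * b₁)) / s)))
    (hC : C = (r * s) * ((b₁ + σ₁) - (b₁ * σ₂ + 1 / (r ^ 2 * b₁)) * (r * s) ^ 2))
    (hD : D = (s * (r * s)) ^ 2 - 1)
    (hA' : A' = ((r ^ 2 * s * (r * s)) ^ 2 - 1) *
      (1 / r * (b₈ * τ₁ + τ₂) - r ^ 2 * s * (r * s) - 1 / (r ^ 2 * s * (r * s))))
    (hB' : B' = -((r * s) ^ 2 * (r ^ 2 * s * (b₈ + τ₁) - (b₈ * τ₂ + r ^ 2 / b₈) / (r ^ 2 * s))))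
    (hC' : C' = (r * s) * ((b₈ + τ₁) - (b₈ * τ₂ + r ^ 2 / b₈) * (r * s) ^ 2))
    (hD' : D' = (r ^ 2 * s * (r * s)) ^ 2 - 1)
    {f₁ f₈ g₁ g₈ g₁' g₈' : ℂ}
    (hf₁ : f₁ = b₁ * (r * s) + 1 / (b₁ * (r * s))) (hf₈ : f₈ = b₈ * (r * s) + 1 / (b₈ * (r * s)))
    (hg₁ : g₁ = s / b₁ + b₁ / s) (hg₈ : g₈ = s / b₈ + b₈ / s)
    (hg₁' : g₁' = r ^ 2 * s / b₁ + b₁ / (r ^ 2 * s))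
    (hg₈' : g₈' = r ^ 2 * s / b₈ + b₈ / (r ^ 2 * s)) {L Λ Ω E₈ J H₈ : ℂ}
    (hL : L = 1 - (s ^ 2 / b₁ * σ₂ - (s ^ 2 / b₁) ^ 2 * σ₁ + (s ^ 2 / b₁) ^ 3) * (r ^ 2 * b₁))
    (hΛ : Λ = 1 - τ₁ / b₁ + τ₂ / b₁ ^ 2 - r ^ 2 / b₈ / b₁ ^ 3)
    (hΩ : Ω = 1 - σ₁ / b₈ + σ₂ / b₈ ^ 2 - 1 / (r ^ 2 * b₁) / b₈ ^ 3)
    (hE₈ : E₈ = 1 - ((r ^ 2 * s) ^ 2 / b₈ * τ₂ - ((r ^ 2 * s) ^ 2 / b₈) ^ 2 * τ₁ +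
      ((r ^ 2 * s) ^ 2 / b₈) ^ 3) * (b₈ / r ^ 2))
    (hJ : J = 1 - (1 / (b₁ * (r * s) ^ 2) * σ₂ - (1 / (b₁ * (r * s) ^ 2)) ^ 2 * σ₁ +
      (1 / (b₁ * (r * s) ^ 2)) ^ 3) * (r ^ 2 * b₁))
    (hH₈ : H₈ = 1 - (1 / (b₈ * (r * s) ^ 2) * τ₂ - (1 / (b₈ * (r * s) ^ 2)) ^ 2 * τ₁ +
      (1 / (b₈ * (r * s) ^ 2)) ^ 3) * (b₈ / r ^ 2)) :
    (1 - 1 / (r ^ 2 * b₁ * b₈ * s ^ 2)) *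
      ((B + D * g₁) * (A' + B' * f₁ + C' * g₁' + D' * (f₁ * g₁')) +
      (-((B + D * g₈) * (A' + B' * f₁ + C' * g₁' + D' * (f₁ * g₁'))) +
        (g₈ - g₁) * (C + D * f₁) * (B' + D' * g₁')) * z -
      (B' + D' * g₈') * (f₁ - f₈) * (B + D * g₁) * z' -
      (B' + D' * g₈') * (A + B * f₈ + C * g₈ + D * (f₈ * g₈)) * (z * z')) =
    -(b₁ * b₂ ^ 3 * b₈ ^ 5 * (r * s) ^ 3 * s ^ 2 / r ^ 2) * (1 - b₈ / b₁) *
      (((1 / (b₂ * b₈ * (r * s) ^ 2)) ^ 2 * E₈ * (1 - 1 / (r ^ 2 * b₁ * b₈ * s ^ 2)) * z' -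
        b₁ / (b₂ * b₈ ^ 2 * r ^ 2 * s ^ 2) * Λ *
          (1 / (b₂ * b₈ * (r * s) ^ 2) - (r ^ 2 * s) ^ 2 / (b₂ * b₈))) *
        (b₁ * r ^ 2 / (b₂ * b₈ ^ 2 * s ^ 2) * L * (1 - 1 / (r ^ 2 * b₁ * b₈ * s ^ 2)) +
          ((r ^ 2 * s) ^ 2 / (b₂ * b₈) - (r ^ 2) ^ 2 / (b₂ * b₈ * (r * s) ^ 2)) * Ω * z) -
        b₁ / (b₂ * b₈ ^ 2 * r ^ 2 * s ^ 2) * ((r ^ 2 * s) ^ 2 / (b₂ * b₈)) ^ 2 * J * H₈ *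
          (1 - s ^ 2 / (b₁ * b₈)) * (1 - (r ^ 2) ^ 2 * s ^ 2 / (b₁ * b₈)) * z) := by
  subst hA hB hC hD hA' hB' hC' hD' hf₁ hf₈ hg₁ hg₈ hg₁' hg₈' hL hΛ hΩ hE₈ hJ hH₈
  field_simp
  ring

/-! ### The contiguity relations at the parameters of the solution. -/

lemma phiBalanced_of_defined {q a₀ a₁ a₂ : ℂ} {d : Fin 5 → ℂ} (hq : ‖q‖ < 1)
    (h : PhiDefined q (paramVec a₀ a₁ a₂ d))
    (hbal : a₁ * a₂ * ∏ i, d i = (q ^ 2) ^ 2 * a₀ ^ 3) (hq0 : q ≠ 0) :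
    PhiBalanced q (paramVec a₀ a₁ a₂ d) := by
  have hz := h.phiNonzero hq
  have h0 := hz.a₀_ne
  have h4 := hz.d_ne 4
  have e1 : (phiParams (paramVec a₀ a₁ a₂ d)).prod = (q ^ 2) ^ 2 * a₀ ^ 3 := by
    rw [← hbal]
    simp only [phiParams, paramVec, Matrix.cons_val, List.prod_cons, List.prod_nil,
      Fin.prod_univ_five]
    ring
  have e2 : (phiParams' (paramVec a₀ a₁ a₂ d)).prod = (q ^ 2) ^ 2 * d 4 ^ 6 / a₀ ^ 3 := by
    have : (phiParams' (paramVec a₀ a₁ a₂ d)).prod =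
        (a₁ * a₂ * ∏ i, d i) * d 4 ^ 6 / a₀ ^ 6 := by
      simp only [phiParams', paramVec, Matrix.cons_val, List.prod_cons, List.prod_nil,
        Fin.prod_univ_five]
      field_simp
    rw [this, hbal]
    field_simp
  refine ⟨vwpBalanced_of_prod (norm_sq_lt_one hq) rfl h.lower_ne ?_ ?_,
    vwpBalanced_of_prod (norm_sq_lt_one hq) rfl h.lower_ne' ?_ ?_⟩
  · rw [e1]; simp [hq0, h0]
  · rw [e1]; simp only [paramVec, Matrix.cons_val]; ring
  · rw [e2]; simp [hq0, h0, h4]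
  · rw [e2]; simp only [paramVec, Matrix.cons_val]; field_simp

/-- The parameters `a₃, …, a₇`. -/
def dParams (b : ℕ → ℂ) : Fin 5 → ℂ := ![b 3 / b 8, b 4 / b 1, b 5 / b 8, b 6 / b 1, b 7 / b 8]

lemma aParams_eq (q : ℂ) (b : ℕ → ℂ) (s t : ℂ) : aParams q b s t =
    paramVec (1 / (q * b 1 * b 2 * b 8 ^ 2)) (q ^ 2 / (b 2 * b 8 * t ^ 2)) (s ^ 2 / (b 2 * b 8))
      (dParams b) := rfl

lemma shiftParams_eq (q a₀ a₁ a₂ : ℂ) (d : Fin 5 → ℂ) : shiftParams q (paramVec a₀ a₁ a₂ d) =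
    paramVec ((q ^ 2) ^ 2 * a₀) a₁ (q ^ 2 * a₂) fun i => q ^ 2 * d i := by
  rw [← pow_mul]
  rfl

/-- Combination of the two contiguity relations into a bilinear relation for the quotients
`z = λ V / U` and `z' = λ' V' / U'`. -/
lemma bilinear_of_contiguity {U U' V V' z z' l l' w x₀ x₁ x₁' x₂ y₁ D c c' L L' Λ Ω E₈ J H₈ α β κ
    P₁ P₂ : ℂ} (hU : U ≠ 0) (hx₁ : x₁ ≠ 0) (hx₁' : x₁' ≠ 0) (hx₂ : x₂ ≠ 0) (hD : D ≠ 0)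
    (hy₁ : y₁ ≠ 0)
    (up : x₀ * x₁ * x₁' * x₂ * D * (U' - U) = κ * (Λ * Ω) * w * V)
    (down : w * (α ^ 2 * P₁ * x₀ * x₂ * V' - β ^ 2 * P₂ * x₁' * y₁ * V) =
      (α - β) * x₁' * y₁ * x₀ * x₂ * D * U')
    (hP₁ : P₁ = L' * E₈) (hP₂ : P₂ = J * H₈)
    (hl : l * (x₁ * x₁' * x₂ * D) = c * w * L * Λ)
    (hl' : l' * (x₁' * y₁ * x₀ * D) = c' * w * L' * Λ)
    (hz : z * U = l * V) (hz' : z' * U' = l' * V') :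
    (α ^ 2 * E₈ * x₀ * z' - c' * Λ * (α - β)) * (c * L * x₀ + κ * Ω * z) -
      c' * β ^ 2 * J * H₈ * x₁ * x₁' * z = 0 := by
  have A : c * L * x₀ * (U' - U) = κ * Ω * (z * U) := by
    refine mul_left_cancel₀ (mul_ne_zero (mul_ne_zero (mul_ne_zero hx₁ hx₁') hx₂) hD) ?_
    linear_combination c * L * up - κ * Ω * V * hl - κ * Ω * (x₁ * x₁' * x₂ * D) * hz
  have B : α ^ 2 * E₈ * x₀ * (c * L * x₀) * (z' * U') - β ^ 2 * J * H₈ * c' * x₁ * x₁' * (z * U) =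
      (α - β) * x₀ * U' * (c * L) * (c' * Λ) := by
    refine mul_left_cancel₀ (mul_ne_zero (mul_ne_zero (mul_ne_zero hx₁' hy₁) hx₂) hD) ?_
    rw [hP₁, hP₂] at down
    linear_combination c * L * c' * Λ * down +
      α ^ 2 * E₈ * x₀ * x₂ * (c * L) * V' * hl' - β ^ 2 * J * H₈ * x₁' * y₁ * c' * V * hl +
      α ^ 2 * E₈ * x₀ * x₂ * (c * L) * (x₁' * y₁ * x₀ * D) * hz' -
      β ^ 2 * J * H₈ * x₁' * y₁ * c' * (x₁ * x₁' * x₂ * D) * hz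
  refine mul_left_cancel₀ hU ?_
  linear_combination B - (α ^ 2 * E₈ * x₀ * z' - c' * Λ * (α - β)) * A

section Relation

variable {r s : ℂ} {b : ℕ → ℂ}

lemma b_ne_zero (hr : r ≠ 0) (hodd : r ^ 2 * b 1 * b 3 * b 5 * b 7 = 1)
    (heven : b 2 * b 4 * b 6 * b 8 = r ^ 2) :
    b 1 ≠ 0 ∧ b 2 ≠ 0 ∧ b 3 ≠ 0 ∧ b 4 ≠ 0 ∧ b 5 ≠ 0 ∧ b 6 ≠ 0 ∧ b 7 ≠ 0 ∧ b 8 ≠ 0 := by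
  have h1 : r ^ 2 * b 1 * b 3 * b 5 * b 7 ≠ 0 := by rw [hodd]; exact one_ne_zero
  have h2 : b 2 * b 4 * b 6 * b 8 ≠ 0 := by rw [heven]; exact pow_ne_zero 2 hr
  simp only [ne_eq, mul_eq_zero, not_or] at h1 h2
  tauto

lemma aParams_balanced (hr : r ≠ 0) (hs : s ≠ 0) (hodd : r ^ 2 * b 1 * b 3 * b 5 * b 7 = 1)
    (heven : b 2 * b 4 * b 6 * b 8 = r ^ 2) :
    (r ^ 2) ^ 2 / (b 2 * b 8 * (r * s) ^ 2) * (s ^ 2 / (b 2 * b 8)) * ∏ i, dParams b i =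
      ((r ^ 2) ^ 2) ^ 2 * (1 / (r ^ 2 * b 1 * b 2 * b 8 ^ 2)) ^ 3 := by
  obtain ⟨n1, n2, n3, n4, n5, n6, n7, n8⟩ := b_ne_zero hr hodd heven
  simp only [dParams, Fin.prod_univ_five, Matrix.cons_val]
  generalize b 1 = b₁ at *
  generalize b 2 = b₂ at *
  generalize b 3 = b₃ at *
  generalize b 4 = b₄ at *
  generalize b 5 = b₅ at *
  generalize b 6 = b₆ at *
  generalize b 7 = b₇ at *
  generalize b 8 = b₈ at *
  obtain rfl : b₇ = 1 / (r ^ 2 * b₁ * b₃ * b₅) := by field_simp; linear_combination hodd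
  obtain rfl : b₂ = r ^ 2 / (b₄ * b₆ * b₈) := by field_simp; linear_combination heven
  field_simp

/-- The product `∏ (1 - p a₀ / a_i)` over `i = 3, …, 7`. -/
def dFactor (b : ℕ → ℂ) : ℂ :=
  (1 - b 4 * b 6 / (b 1 * b 3)) * (1 - b 6 / b 8) * (1 - b 4 * b 6 / (b 1 * b 5)) *
    (1 - b 4 / b 8) * (1 - b 4 * b 6 / (b 1 * b 7))

/-- The product `∏ (1 - x / b_i)` over `i = 3, 5, 7`. -/
def oddFactor (b : ℕ → ℂ) (x : ℂ) : ℂ := (1 - x / b 3) * (1 - x / b 5) * (1 - x / b 7)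

/-- The product `∏ (1 - x / b_i)` over `i = 2, 4, 6`. -/
def evenFactor (b : ℕ → ℂ) (x : ℂ) : ℂ := (1 - x / b 2) * (1 - x / b 4) * (1 - x / b 6)

/-- The product `∏ (1 - b_i / x)` over `i = 3, 5, 7`. -/
def oddFactor' (b : ℕ → ℂ) (x : ℂ) : ℂ := (1 - b 3 / x) * (1 - b 5 / x) * (1 - b 7 / x)

/-- The product `∏ (1 - b_i / x)` over `i = 2, 4, 6`. -/
def evenFactor' (b : ℕ → ℂ) (x : ℂ) : ℂ := (1 - b 2 / x) * (1 - b 4 / x) * (1 - b 6 / x)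

/-- The constraints turn each `1 - b_j b_k t²` into `1 - s²/(b₁ b_i)` and `b₄ b₆` into `q/(b₂ b₈)`.
This brings `λ` to the products that occur in the contiguity relations. -/
lemma lam_mul (hr : r ≠ 0) (hs : s ≠ 0) (hodd : r ^ 2 * b 1 * b 3 * b 5 * b 7 = 1)
    (heven : b 2 * b 4 * b 6 * b 8 = r ^ 2) (h1 : 1 - s ^ 2 / (b 1 * b 8) ≠ 0)
    (h2 : 1 - (r ^ 2) ^ 2 * s ^ 2 / (b 1 * b 8) ≠ 0)
    (h3 : 1 - r ^ 2 / (b 1 * b 8 * s ^ 2) ≠ 0) (h4 : dFactor b ≠ 0) :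
    lam (r ^ 2) b s (r * s) * ((1 - s ^ 2 / (b 1 * b 8)) *
      (1 - (r ^ 2) ^ 2 * s ^ 2 / (b 1 * b 8)) * (1 - r ^ 2 / (b 1 * b 8 * s ^ 2)) * dFactor b) =
    b 1 * r ^ 2 / (b 2 * b 8 ^ 2 * s ^ 2) *
      ((1 - b 4 * b 6 / (b 1 * b 8)) * (1 - (r ^ 2) ^ 2 * (b 4 * b 6 / (b 1 * b 8)))) *
      oddFactor b (s ^ 2 / b 1) * evenFactor' b (b 1) := by
  obtain ⟨n1, n2, n3, n4, n5, n6, n7, n8⟩ := b_ne_zero hr hodd heven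
  have e : ∀ i j k, r ^ 2 * b 1 * b i * b j * b k = 1 → b i ≠ 0 →
      1 - b j * b k * (r * s) ^ 2 = 1 - s ^ 2 / b 1 / b i := by
    intro i j k h hi
    field_simp
    linear_combination -s ^ 2 * h
  have hc : b 1 * b 4 * b 6 / (b 8 * s ^ 2) = b 1 * r ^ 2 / (b 2 * b 8 ^ 2 * s ^ 2) := by
    rw [← heven]
    field_simp
  rw [lam, e 7 3 5 (by rw [← hodd]; ring) n7, e 5 3 7 (by rw [← hodd]; ring) n5,
    e 3 5 7 hodd n3, hc]
  rw [Finset.prod_insert (by decide), Finset.prod_insert (by decide), Finset.prod_singleton,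
    Finset.prod_insert (by decide), Finset.prod_insert (by decide), Finset.prod_singleton]
  simp only [oddFactor, evenFactor', dFactor, ne_eq, mul_eq_zero, not_or] at h4 ⊢
  obtain ⟨⟨⟨⟨h5, h6⟩, h7⟩, h8⟩, h9⟩ := h4
  generalize 1 - s ^ 2 / (b 1 * b 8) = x₁ at *
  generalize 1 - (r ^ 2) ^ 2 * s ^ 2 / (b 1 * b 8) = x₂ at *
  generalize 1 - r ^ 2 / (b 1 * b 8 * s ^ 2) = x₃ at *
  generalize 1 - b 4 * b 6 / (b 1 * b 3) = x₄ at *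
  generalize 1 - b 4 * b 6 / (b 1 * b 5) = x₅ at *
  generalize 1 - b 4 * b 6 / (b 1 * b 7) = x₆ at *
  generalize 1 - b 4 / b 8 = x₇ at *
  generalize 1 - b 6 / b 8 = x₈ at *
  generalize 1 - b 4 * b 6 / (b 1 * b 8) = y₁
  generalize 1 - (r ^ 2) ^ 2 * (b 4 * b 6 / (b 1 * b 8)) = y₂
  field_simp

/-- The relation between `z(t)` and `z(q t)`. -/
lemma zRelation (hq : ‖r ^ 2‖ < 1) (hr : r ≠ 0) (hs : s ≠ 0)
    (hodd : r ^ 2 * b 1 * b 3 * b 5 * b 7 = 1) (heven : b 2 * b 4 * b 6 * b 8 = r ^ 2)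
    (hU : PhiDefined (r ^ 2) (aParams (r ^ 2) b s (r * s)))
    (hU' : PhiDefined (r ^ 2) (aParams (r ^ 2) b (r ^ 2 * s) (r * (r ^ 2 * s))))
    (hV : PhiDefined (r ^ 2) (shiftParams (r ^ 2) (aParams (r ^ 2) b s (r * s))))
    (hV' : PhiDefined (r ^ 2)
      (shiftParams (r ^ 2) (aParams (r ^ 2) b (r ^ 2 * s) (r * (r ^ 2 * s)))))
    (h0 : Phi (r ^ 2) (aParams (r ^ 2) b s (r * s)) ≠ 0)
    (h0' : Phi (r ^ 2) (aParams (r ^ 2) b (r ^ 2 * s) (r * (r ^ 2 * s))) ≠ 0) {z z' : ℂ}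
    (hz : z = lam (r ^ 2) b s (r * s) * (Phi (r ^ 2) (shiftParams (r ^ 2)
      (aParams (r ^ 2) b s (r * s))) / Phi (r ^ 2) (aParams (r ^ 2) b s (r * s))))
    (hz' : z' = lam (r ^ 2) b (r ^ 2 * s) (r * (r ^ 2 * s)) * (Phi (r ^ 2) (shiftParams (r ^ 2)
      (aParams (r ^ 2) b (r ^ 2 * s) (r * (r ^ 2 * s)))) /
        Phi (r ^ 2) (aParams (r ^ 2) b (r ^ 2 * s) (r * (r ^ 2 * s))))) :
    1 - 1 / (r ^ 2 * b 1 * b 8 * s ^ 2) ≠ 0 ∧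
    ((1 / (b 2 * b 8 * (r * s) ^ 2)) ^ 2 * evenFactor b ((r ^ 2 * s) ^ 2 / b 8) *
        (1 - 1 / (r ^ 2 * b 1 * b 8 * s ^ 2)) * z' -
      b 1 / (b 2 * b 8 ^ 2 * r ^ 2 * s ^ 2) * evenFactor' b (b 1) *
        (1 / (b 2 * b 8 * (r * s) ^ 2) - (r ^ 2 * s) ^ 2 / (b 2 * b 8))) *
      (b 1 * r ^ 2 / (b 2 * b 8 ^ 2 * s ^ 2) * oddFactor b (s ^ 2 / b 1) *
          (1 - 1 / (r ^ 2 * b 1 * b 8 * s ^ 2)) +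
        ((r ^ 2 * s) ^ 2 / (b 2 * b 8) - (r ^ 2) ^ 2 / (b 2 * b 8 * (r * s) ^ 2)) *
          oddFactor' b (b 8) * z) -
      b 1 / (b 2 * b 8 ^ 2 * r ^ 2 * s ^ 2) * ((r ^ 2 * s) ^ 2 / (b 2 * b 8)) ^ 2 *
        oddFactor b (1 / (b 1 * (r * s) ^ 2)) * evenFactor b (1 / (b 8 * (r * s) ^ 2)) *
        (1 - s ^ 2 / (b 1 * b 8)) * (1 - (r ^ 2) ^ 2 * s ^ 2 / (b 1 * b 8)) * z = 0 := by
  obtain ⟨n1, n2, n3, n4, n5, n6, n7, n8⟩ := b_ne_zero hr hodd heven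
  have hp := norm_sq_lt_one hq
  set a₀ := 1 / (r ^ 2 * b 1 * b 2 * b 8 ^ 2) with ha₀
  set a₁ := (r ^ 2) ^ 2 / (b 2 * b 8 * (r * s) ^ 2) with ha₁
  set a₂ := s ^ 2 / (b 2 * b 8) with ha₂
  -- Replacing `t` by `q t` changes only two parameters: `a₁` becomes `a₁ / q² = α` and `a₂` becomes
  -- `q² a₂ = β`.
  set α := 1 / (b 2 * b 8 * (r * s) ^ 2) with hα
  set β := (r ^ 2 * s) ^ 2 / (b 2 * b 8) with hβ
  have eU : aParams (r ^ 2) b s (r * s) = paramVec a₀ a₁ a₂ (dParams b) := rfl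
  have eα : (r ^ 2) ^ 2 / (b 2 * b 8 * (r * (r ^ 2 * s)) ^ 2) = α := by
    rw [hα]; field_simp
  have eα' : a₁ / (r ^ 2) ^ 2 = α := by rw [hα, ha₁]; field_simp
  have eβ' : (r ^ 2) ^ 2 * a₂ = β := by rw [hβ, ha₂]; field_simp
  have eα'' : (r ^ 2) ^ 2 * α = a₁ := by rw [hα, ha₁]; field_simp
  have eU' : aParams (r ^ 2) b (r ^ 2 * s) (r * (r ^ 2 * s)) = paramVec a₀ α β (dParams b) := by
    rw [aParams_eq, eα]
  have hl := lam_mul (s := s) hr hs hodd heven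
  have hl' := lam_mul (s := r ^ 2 * s) hr (mul_ne_zero (pow_ne_zero 2 hr) hs) hodd heven
  have hbal := aParams_balanced (s := r ^ 2 * s) hr (mul_ne_zero (pow_ne_zero 2 hr) hs) hodd heven
  rw [eα, ← ha₀, ← hβ] at hbal
  rw [eU, shiftParams_eq] at hV hz
  rw [eU] at hU h0
  rw [eU', shiftParams_eq] at hV' hz'
  rw [eU'] at hU' h0'
  have zU := hU.phiNonzero hq
  have zU' := hU'.phiNonzero hq
  have hV₂ := hV
  rw [eβ', ← eα''] at hV₂
  have hU'₂ := hU'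
  rw [← eα', ← eβ'] at hU'₂
  -- The upward relation is based at `t`, the downward one at `q t`. Since `q² α = a₁` and `q² a₂ =
  -- β`, the same shifted value `V` at `t` occurs in both.
  have up := Phi_up (pow_ne_zero 2 hr) hq hU hU'₂ hV
  have down := Phi_down (pow_ne_zero 2 hr) hq hbal hU' hV' hV₂
  rw [eα', eβ'] at up
  rw [eα''] at down
  rw [eβ'] at hz
  have f₁ : (r ^ 2) ^ 2 * a₀ / a₁ = s ^ 2 / (b 1 * b 8) := by rw [ha₀, ha₁]; field_simp
  have f₂ : ((r ^ 2) ^ 2) ^ 2 * a₀ / a₁ = (r ^ 2) ^ 2 * s ^ 2 / (b 1 * b 8) := by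
    rw [ha₀, ha₁]; field_simp
  have f₃ : a₀ / a₂ = 1 / (r ^ 2 * b 1 * b 8 * s ^ 2) := by rw [ha₀, ha₂]; field_simp
  have f₄ : (r ^ 2) ^ 2 * a₀ / a₂ = r ^ 2 / (b 1 * b 8 * s ^ 2) := by
    rw [ha₀, ha₂]; field_simp
  have f₅ : (r ^ 2) ^ 2 * a₀ / α = (r ^ 2 * s) ^ 2 / (b 1 * b 8) := by rw [ha₀, hα]; field_simp
  have f₆ : ((r ^ 2) ^ 2) ^ 2 * a₀ / α = (r ^ 2) ^ 2 * (r ^ 2 * s) ^ 2 / (b 1 * b 8) := by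
    rw [ha₀, hα]; field_simp
  have f₇ : (r ^ 2) ^ 2 * a₀ / β = 1 / (r ^ 2 * b 1 * b 8 * s ^ 2) := by
    rw [ha₀, hβ]; field_simp
  have f₈ : ((r ^ 2) ^ 2) ^ 2 * a₀ / β = r ^ 2 / (b 1 * b 8 * s ^ 2) := by
    rw [ha₀, hβ]; field_simp
  have f₉ : (r ^ 2) ^ 2 * a₀ = b 4 * b 6 / (b 1 * b 8) := by
    rw [ha₀, ← heven]; field_simp
  have g₁ : (r ^ 2) ^ 2 * s ^ 2 / (b 1 * b 8) = (r ^ 2 * s) ^ 2 / (b 1 * b 8) := by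
    rw [mul_pow]
  have g₂ : r ^ 2 / (b 1 * b 8 * (r ^ 2 * s) ^ 2) = 1 / (r ^ 2 * b 1 * b 8 * s ^ 2) := by
    field_simp
  have eD : ∏ i, (1 - (r ^ 2) ^ 2 * a₀ / dParams b i) = dFactor b := by
    rw [f₉]
    simp only [dFactor, dParams, Fin.prod_univ_five, Matrix.cons_val, div_div_div_eq]
    field_simp
  have x₁ : 1 - s ^ 2 / (b 1 * b 8) ≠ 0 := by
    have := one_sub_ne_zero_of_qPochInf hp zU.lower₁ 0
    rwa [pow_zero, one_mul, f₁] at this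
  have x₁' : 1 - (r ^ 2) ^ 2 * s ^ 2 / (b 1 * b 8) ≠ 0 := by
    have := one_sub_ne_zero_of_qPochInf hp zU'.lower₁ 0
    rwa [pow_zero, one_mul, f₅, ← g₁] at this
  have y₁ : 1 - (r ^ 2) ^ 2 * (r ^ 2 * s) ^ 2 / (b 1 * b 8) ≠ 0 := by
    have := one_sub_ne_zero_of_qPochInf hp zU'.lower₁ 1
    rwa [pow_one, f₅, ← mul_div_assoc] at this
  have x₀ : 1 - 1 / (r ^ 2 * b 1 * b 8 * s ^ 2) ≠ 0 := by
    have := one_sub_ne_zero_of_qPochInf hp zU'.lower₂ 0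
    rwa [pow_zero, one_mul, f₇] at this
  have x₂ : 1 - r ^ 2 / (b 1 * b 8 * s ^ 2) ≠ 0 := by
    have := one_sub_ne_zero_of_qPochInf hp zU.lower₂ 0
    rwa [pow_zero, one_mul, f₄] at this
  have D : dFactor b ≠ 0 := by
    rw [← eD]
    refine Finset.prod_ne_zero_iff.2 fun i _ => ?_
    have := one_sub_ne_zero_of_qPochInf hp (zU.lower_d i) 0
    rwa [pow_zero, one_mul] at this
  have hL := hl x₁ x₁' x₂ D
  have hL' := hl' (by rwa [← g₁]) y₁ (by rwa [g₂]) D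
  have eα₀ : b 1 * r ^ 2 / (b 2 * b 8 ^ 2 * (r ^ 2 * s) ^ 2) =
      b 1 / (b 2 * b 8 ^ 2 * r ^ 2 * s ^ 2) := by field_simp
  rw [← g₁, g₂, eα₀] at hL'
  -- The products over `a₃, …, a₇` lack the factor belonging to `b₂`. It is supplied by `1 - β`
  -- here, by `1 - α` in `e₂` and by the four-term coefficient in `e₃`.
  have e₁ : (∏ i, (1 - (r ^ 2 * s) ^ 2 / (b 1 * b 8) / dParams b i)) * (1 - β) =
      oddFactor b ((r ^ 2 * s) ^ 2 / b 1) * evenFactor b ((r ^ 2 * s) ^ 2 / b 8) := by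
    simp only [oddFactor, evenFactor, dParams, Fin.prod_univ_five, Matrix.cons_val, hβ]
    field_simp
  have e₂ : (∏ i, (1 - 1 / (r ^ 2 * b 1 * b 8 * s ^ 2) / dParams b i)) * (1 - α) =
      oddFactor b (1 / (b 1 * (r * s) ^ 2)) * evenFactor b (1 / (b 8 * (r * s) ^ 2)) := by
    simp only [oddFactor, evenFactor, dParams, Fin.prod_univ_five, Matrix.cons_val, hα]
    field_simp
  have e₃ : (r ^ 2) ^ 2 * (a₂ + a₀ / a₂ - s ^ 2 / (b 1 * b 8) - α) * (∏ i, (1 - dParams b i)) =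
      (β - a₁) * (evenFactor' b (b 1) * oddFactor' b (b 8)) := by
    have : (r ^ 2) ^ 2 * (a₂ + a₀ / a₂ - s ^ 2 / (b 1 * b 8) - α) =
        (β - a₁) * (1 - b 2 / b 1) := by
      rw [← eα'', ← eβ', f₃, hα, ha₂]; field_simp; ring
    rw [this]
    simp only [oddFactor', evenFactor', dParams, Fin.prod_univ_five, Matrix.cons_val]
    ring
  have f₁₀ : ((r ^ 2) ^ 2) ^ 2 * a₀ = (r ^ 2) ^ 2 * (b 4 * b 6 / (b 1 * b 8)) := by
    rw [← f₉]; ring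
  rw [eD, f₁, f₂, f₄, f₉, f₁₀] at up
  rw [eD, f₅, f₆, f₇, f₈, f₉, f₁₀] at down
  rw [f₁₀] at hz hz'
  refine ⟨x₀, bilinear_of_contiguity (w := (1 - b 4 * b 6 / (b 1 * b 8)) *
    (1 - (r ^ 2) ^ 2 * (b 4 * b 6 / (b 1 * b 8)))) (l := lam (r ^ 2) b s (r * s))
    (l' := lam (r ^ 2) b (r ^ 2 * s) (r * (r ^ 2 * s)))
    h0 x₁ x₁' x₂ D y₁ (up := ?_) (down := ?_) (hP₁ := e₁) (hP₂ := e₂) (hl := hL) (hl' := ?_)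
    (hz := by rw [hz, mul_assoc, div_mul_cancel₀ _ h0])
    (hz' := by rw [hz', mul_assoc, div_mul_cancel₀ _ h0'])⟩
  · rw [← e₃, ← f₃]
    linear_combination up
  · rw [g₁]
    linear_combination down
  · linear_combination hL'

end Relation

/-! ### The even curve passes through `(f, ḡ)`. -/

lemma curve_apply_point {b σ₁ σ₂ σ₃ s t : ℂ} (hb : b ≠ 0) (hs : s ≠ 0) (ht : t ≠ 0)
    (h : b * σ₃ * t ^ 2 = s ^ 2) :
    curve (b + σ₁) (b * σ₁ + σ₂) (b * σ₂ + σ₃) s t 1 (b * t + 1 / (b * t)) (s / b + b / s)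
      ((b * t + 1 / (b * t)) * (s / b + b / s)) = 0 := by
  obtain rfl : σ₃ = s ^ 2 / (b * t ^ 2) := by
    rw [eq_div_iff (mul_ne_zero hb (pow_ne_zero 2 ht)), ← h]; ring
  rw [curve]
  field_simp
  ring

/-- The coefficients of `1`, `f`, `g`, `f g` in a curve. -/
lemma curve_eq {k e₁ e₂ e₃ s t : ℂ} (hs : s ≠ 0) (h : t = k * s) (w x y z : ℂ) :
    curve e₁ e₂ e₃ s t w x y z =
      ((s * t) ^ 2 - 1) * (k * e₂ - s * t - 1 / (s * t)) * w + -(t ^ 2 * (s * e₁ - e₃ / s)) * x +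
        t * (e₁ - e₃ * t ^ 2) * y + ((s * t) ^ 2 - 1) * z := by
  rw [curve, show t / s = k by rw [h, mul_div_cancel_right₀ _ hs]]
  ring

section Relation

variable {r s : ℂ} {b : ℕ → ℂ}

lemma oddFactor_eq (hr : r ≠ 0) (hodd : r ^ 2 * b 1 * b 3 * b 5 * b 7 = 1)
    (heven : b 2 * b 4 * b 6 * b 8 = r ^ 2) (x : ℂ) :
    oddFactor b x = 1 - (x * (b 3 * b 5 + b 3 * b 7 + b 5 * b 7) - x ^ 2 * (b 3 + b 5 + b 7) +
      x ^ 3) * (r ^ 2 * b 1) := by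
  obtain ⟨n1, n2, n3, n4, n5, n6, n7, n8⟩ := b_ne_zero hr hodd heven
  have : r ^ 2 * b 1 = 1 / (b 3 * b 5 * b 7) := by field_simp; linear_combination hodd
  rw [this, oddFactor]
  field_simp
  ring

lemma evenFactor_eq (hr : r ≠ 0) (hodd : r ^ 2 * b 1 * b 3 * b 5 * b 7 = 1)
    (heven : b 2 * b 4 * b 6 * b 8 = r ^ 2) (x : ℂ) :
    evenFactor b x = 1 - (x * (b 2 * b 4 + b 2 * b 6 + b 4 * b 6) - x ^ 2 * (b 2 + b 4 + b 6) +
      x ^ 3) * (b 8 / r ^ 2) := by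
  obtain ⟨n1, n2, n3, n4, n5, n6, n7, n8⟩ := b_ne_zero hr hodd heven
  rw [← heven, evenFactor]
  field_simp
  ring

lemma oddFactor'_eq (hr : r ≠ 0) (hodd : r ^ 2 * b 1 * b 3 * b 5 * b 7 = 1)
    (heven : b 2 * b 4 * b 6 * b 8 = r ^ 2) {x : ℂ} (hx : x ≠ 0) :
    oddFactor' b x = 1 - (b 3 + b 5 + b 7) / x + (b 3 * b 5 + b 3 * b 7 + b 5 * b 7) / x ^ 2 -
      1 / (r ^ 2 * b 1) / x ^ 3 := by
  obtain ⟨n1, n2, n3, n4, n5, n6, n7, n8⟩ := b_ne_zero hr hodd heven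
  have : 1 / (r ^ 2 * b 1) = b 3 * b 5 * b 7 := by field_simp; linear_combination -hodd
  rw [this, oddFactor']
  field_simp
  ring

lemma evenFactor'_eq (hr : r ≠ 0) (hodd : r ^ 2 * b 1 * b 3 * b 5 * b 7 = 1)
    (heven : b 2 * b 4 * b 6 * b 8 = r ^ 2) {x : ℂ} (hx : x ≠ 0) :
    evenFactor' b x = 1 - (b 2 + b 4 + b 6) / x + (b 2 * b 4 + b 2 * b 6 + b 4 * b 6) / x ^ 2 -
      r ^ 2 / b 8 / x ^ 3 := by
  obtain ⟨n1, n2, n3, n4, n5, n6, n7, n8⟩ := b_ne_zero hr hodd heven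
  rw [← heven, evenFactor']
  field_simp
  ring

/-- The form vanishing on the curve through the points of index `1, 3, 5, 7`. -/
def oddCurve (b : ℕ → ℂ) (s t w x y z : ℂ) : ℂ :=
  curve (b 1 + b 3 + b 5 + b 7)
    (b 1 * b 3 + b 1 * b 5 + b 1 * b 7 + b 3 * b 5 + b 3 * b 7 + b 5 * b 7)
    (b 1 * b 3 * b 5 + b 1 * b 3 * b 7 + b 1 * b 5 * b 7 + b 3 * b 5 * b 7) s t w x y z

/-- The form vanishing on the curve through the points of index `2, 4, 6, 8`. -/
def evenCurve (b : ℕ → ℂ) (s t w x y z : ℂ) : ℂ :=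
  curve (b 8 + b 6 + b 4 + b 2)
    (b 8 * b 6 + b 8 * b 4 + b 8 * b 2 + b 6 * b 4 + b 6 * b 2 + b 4 * b 2)
    (b 8 * b 6 * b 4 + b 8 * b 6 * b 2 + b 8 * b 4 * b 2 + b 6 * b 4 * b 2) s t w x y z

/-- By `bilinear_of_curves` the even form at `(f, ḡ)`, times a nonzero factor, is the Riccati
expression in `z`, `z'`. `riccati_identity` identifies the latter with the relation of `zRelation`.
-/
lemma evenCurve_eq_zero (hq : ‖r ^ 2‖ < 1) (hr : r ≠ 0) (hs : s ≠ 0)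
    (hodd : r ^ 2 * b 1 * b 3 * b 5 * b 7 = 1) (heven : b 2 * b 4 * b 6 * b 8 = r ^ 2)
    (hU : PhiDefined (r ^ 2) (aParams (r ^ 2) b s (r * s)))
    (hU' : PhiDefined (r ^ 2) (aParams (r ^ 2) b (r ^ 2 * s) (r * (r ^ 2 * s))))
    (hV : PhiDefined (r ^ 2) (shiftParams (r ^ 2) (aParams (r ^ 2) b s (r * s))))
    (hV' : PhiDefined (r ^ 2)
      (shiftParams (r ^ 2) (aParams (r ^ 2) b (r ^ 2 * s) (r * (r ^ 2 * s)))))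
    (h0 : Phi (r ^ 2) (aParams (r ^ 2) b s (r * s)) ≠ 0)
    (h0' : Phi (r ^ 2) (aParams (r ^ 2) b (r ^ 2 * s) (r * (r ^ 2 * s))) ≠ 0) {z z' f g g' : ℂ}
    (hz : z = lam (r ^ 2) b s (r * s) * (Phi (r ^ 2) (shiftParams (r ^ 2)
      (aParams (r ^ 2) b s (r * s))) / Phi (r ^ 2) (aParams (r ^ 2) b s (r * s))))
    (hz' : z' = lam (r ^ 2) b (r ^ 2 * s) (r * (r ^ 2 * s)) * (Phi (r ^ 2) (shiftParams (r ^ 2)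
      (aParams (r ^ 2) b (r ^ 2 * s) (r * (r ^ 2 * s)))) /
        Phi (r ^ 2) (aParams (r ^ 2) b (r ^ 2 * s) (r * (r ^ 2 * s)))))
    (z1 : z ≠ 1) (z1' : z' ≠ 1) (hg : (1 - z) * g = gPt b s 1 - z * gPt b s 8)
    (hg' : (1 - z') * g' = gPt b (r ^ 2 * s) 1 - z' * gPt b (r ^ 2 * s) 8)
    (hc : oddCurve b s (r * s) 1 f g (f * g) = 0) (hne : oddCurve b s (r * s) 0 1 0 g ≠ 0) :
    evenCurve b (r ^ 2 * s) (r * s) 1 f g' (f * g') = 0 := by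
  obtain ⟨x₀, rel⟩ := zRelation hq hr hs hodd heven hU hU' hV hV' h0 h0' hz hz'
  obtain ⟨n1, n2, n3, n4, n5, n6, n7, n8⟩ := b_ne_zero hr hodd heven
  have e3 : b 3 * b 5 * b 7 = 1 / (r ^ 2 * b 1) := by field_simp; linear_combination hodd
  have h3 : b 2 * b 4 * b 6 = r ^ 2 / b 8 := by field_simp; linear_combination heven
  have hO : ∀ w x y z, oddCurve b s (r * s) w x y z = curve (b 1 + (b 3 + b 5 + b 7))
      (b 1 * (b 3 + b 5 + b 7) + (b 3 * b 5 + b 3 * b 7 + b 5 * b 7))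
      (b 1 * (b 3 * b 5 + b 3 * b 7 + b 5 * b 7) + 1 / (r ^ 2 * b 1)) s (r * s) w x y z := by
    intro w x y z
    rw [← e3, oddCurve]
    congr 1 <;> ring
  have hE : ∀ w x y z, evenCurve b (r ^ 2 * s) (r * s) w x y z = curve (b 8 + (b 2 + b 4 + b 6))
      (b 8 * (b 2 + b 4 + b 6) + (b 2 * b 4 + b 2 * b 6 + b 4 * b 6))
      (b 8 * (b 2 * b 4 + b 2 * b 6 + b 4 * b 6) + r ^ 2 / b 8) (r ^ 2 * s) (r * s) w x y z := by
    intro w x y z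
    rw [← h3, evenCurve]
    congr 1 <;> ring
  have p₁ := curve_apply_point (b := b 1) (σ₁ := b 3 + b 5 + b 7)
    (σ₂ := b 3 * b 5 + b 3 * b 7 + b 5 * b 7) (σ₃ := 1 / (r ^ 2 * b 1)) (s := s) (t := r * s)
    n1 hs (mul_ne_zero hr hs) (by field_simp)
  have p₈ := curve_apply_point (b := b 8) (σ₁ := b 2 + b 4 + b 6)
    (σ₂ := b 2 * b 4 + b 2 * b 6 + b 4 * b 6) (σ₃ := r ^ 2 / b 8) (s := r ^ 2 * s) (t := r * s)
    n8 (mul_ne_zero (pow_ne_zero 2 hr) hs) (mul_ne_zero hr hs) (by field_simp)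
  rw [hO] at hc hne
  rw [hE]
  have hs' : r ^ 2 * s ≠ 0 := mul_ne_zero (pow_ne_zero 2 hr) hs
  have ht : r * s = 1 / r * (r ^ 2 * s) := by field_simp
  rw [curve_eq hs rfl, mul_one] at hc p₁
  rw [curve_eq hs' ht, mul_one] at p₈ ⊢
  rw [curve_eq hs rfl] at hne
  have key := riccati_identity (z := z) (z' := z') hr hs n1 n2 n8 rfl rfl rfl rfl rfl rfl rfl rfl
    rfl rfl rfl rfl rfl rfl (oddFactor_eq hr hodd heven _) (evenFactor'_eq hr hodd heven n1)
    (oddFactor'_eq hr hodd heven n8) (evenFactor_eq hr hodd heven _)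
    (oddFactor_eq hr hodd heven _) (evenFactor_eq hr hodd heven _)
  rw [rel, mul_zero] at key
  have key' := bilinear_of_curves p₁ p₈ hc hg hg'
  simp only [gPt] at key' hg
  rw [(mul_eq_zero.1 key).resolve_left x₀] at key'
  refine (mul_eq_zero.1 key').resolve_left (mul_ne_zero ?_ (sub_ne_zero.2 z1'.symm))
  -- The factor in question equals `1 - z` times the coefficient of `f` in the odd curve at `g`.
  intro h
  refine mul_ne_zero (sub_ne_zero.2 z1.symm) hne ?_
  linear_combination h + ((s * (r * s)) ^ 2 - 1) * hg

end Relation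

/-! ### From the two curves to the two Painlevé equations. -/

lemma riccatiDet_affine (b : ℕ → ℂ) (s t : ℂ) (i j k : ℕ) (f g : ℂ) :
    riccatiDet b s t i j k 1 f g (f * g) =
      riccatiDet b s t i j k 1 0 g 0 + f * riccatiDet b s t i j k 0 1 0 g := by
  simp only [riccatiDet, Matrix.det_succ_row_zero, Fin.sum_univ_succ]
  simp [Fin.succAbove]
  ring

section Equations

variable {r s : ℂ} {b : ℕ → ℂ}

lemma firstEq_of_curves {f g g' : ℂ} (hr : r ≠ 0) (hs : s ≠ 0)
    (hodd : r ^ 2 * b 1 * b 3 * b 5 * b 7 = 1) (heven : b 2 * b 4 * b 6 * b 8 = r ^ 2)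
    (hc : oddCurve b s (r * s) 1 f g (f * g) = 0) (hne : oddCurve b s (r * s) 0 1 0 g ≠ 0)
    (hc' : evenCurve b (r ^ 2 * s) (r * s) 1 f g' (f * g') = 0) :
    FirstEq (r ^ 2) b s (r * s) f g g' := by
  have he₄ : 1 / r ^ 2 = b 1 * b 3 * b 5 * b 7 := by field_simp; linear_combination -hodd
  obtain ⟨m1, m2, m3, m4, m5, m6, m7⟩ := mSym_eq b rfl rfl rfl he₄ rfl rfl rfl heven.symm
  rw [oddCurve] at hc hne
  rw [evenCurve] at hc'
  generalize b 1 + b 3 + b 5 + b 7 = e₁ at *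
  generalize b 1 * b 3 + b 1 * b 5 + b 1 * b 7 + b 3 * b 5 + b 3 * b 7 + b 5 * b 7 = e₂ at *
  generalize b 1 * b 3 * b 5 + b 1 * b 3 * b 7 + b 1 * b 5 * b 7 + b 3 * b 5 * b 7 = e₃ at *
  generalize b 8 + b 6 + b 4 + b 2 = h₁ at *
  generalize b 8 * b 6 + b 8 * b 4 + b 8 * b 2 + b 6 * b 4 + b 6 * b 2 + b 4 * b 2 = h₂ at *
  generalize b 8 * b 6 * b 4 + b 8 * b 6 * b 2 + b 8 * b 4 * b 2 + b 6 * b 4 * b 2 = h₃ at *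
  have ht : r * s ≠ 0 := mul_ne_zero hr hs
  have hq : r ^ 2 ≠ 0 := pow_ne_zero 2 hr
  -- These are the elementary symmetric functions of the `b_i t`, odd and even indices apart. The
  -- fourth ones are `(s t)²` and `(q s t)²` by the constraints.
  refine fracEq_of_curves (o₁ := e₁ * (r * s)) (o₂ := e₂ * (r * s) ^ 2) (o₃ := e₃ * (r * s) ^ 3)
    (h₁ := h₁ * (r * s)) (h₂ := h₂ * (r * s) ^ 2) (h₃ := h₃ * (r * s) ^ 3) (mul_ne_zero hs ht)
    (mul_ne_zero (mul_ne_zero hq hs) ht) ht ?_ ?_ ?_ (by ring) ?_ ?_ ?_ ?_ ?_ ?_ ?_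
  · rw [← mul_zero (s * (r * s)), ← hc, curve]
    field_simp
  · rw [← mul_zero (r ^ 2 * s * (r * s)), ← hc', curve]
    field_simp
  -- If `(s t)² = 1` and `o₁ = o₃`, the coefficient of `f` in the odd curve would vanish.
  · intro hu h
    apply hne
    have : e₁ = e₃ * (r * s) ^ 2 := mul_right_cancel₀ ht (by linear_combination h)
    have h0 : s * e₁ - e₃ / s = e₃ / s * ((s * (r * s)) ^ 2 - 1) := by rw [this]; field_simp
    rw [curve, h0]
    linear_combination (g - (r * s) ^ 2 * (e₃ / s)) * hu
  · rw [m1]; ring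
  · rw [m2]; ring
  · rw [m3]; ring
  · rw [m4]; field_simp
  · rw [m5]; field_simp
  · rw [m6]; field_simp
  · rw [m7]; field_simp

lemma secondEq_of_curves {f f' g : ℂ} (hr : r ≠ 0) (hs : s ≠ 0)
    (hodd : r ^ 2 * b 1 * b 3 * b 5 * b 7 = 1) (heven : b 2 * b 4 * b 6 * b 8 = r ^ 2)
    (hc : oddCurve b s (r * s) 1 f g (f * g) = 0) (hne : oddCurve b s (r * s) 0 1 0 g ≠ 0)
    (hc' : evenCurve b s (s / r) 1 f' g (f' * g) = 0) :
    SecondEq (r ^ 2) b s (r * s) g f f' := by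
  have he₄ : 1 / r ^ 2 = b 1 * b 3 * b 5 * b 7 := by field_simp; linear_combination -hodd
  obtain ⟨m1, m2, m3, m4, m5, m6, m7⟩ := mSym_eq b rfl rfl rfl he₄ rfl rfl rfl heven.symm
  rw [oddCurve] at hc hne
  rw [evenCurve] at hc'
  generalize b 1 + b 3 + b 5 + b 7 = e₁ at *
  generalize b 1 * b 3 + b 1 * b 5 + b 1 * b 7 + b 3 * b 5 + b 3 * b 7 + b 5 * b 7 = e₂ at *
  generalize b 1 * b 3 * b 5 + b 1 * b 3 * b 7 + b 1 * b 5 * b 7 + b 3 * b 5 * b 7 = e₃ at *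
  generalize b 8 + b 6 + b 4 + b 2 = h₁ at *
  generalize b 8 * b 6 + b 8 * b 4 + b 8 * b 2 + b 6 * b 4 + b 6 * b 2 + b 4 * b 2 = h₂ at *
  generalize b 8 * b 6 * b 4 + b 8 * b 6 * b 2 + b 8 * b 4 * b 2 + b 6 * b 4 * b 2 = h₃ at *
  have ht : r * s ≠ 0 := mul_ne_zero hr hs
  have hq : r ^ 2 ≠ 0 := pow_ne_zero 2 hr
  have hrev : quarticP g s⁻¹ (mSym b) = quarticP g s⁻¹ (revM (revM (mSym b))) := by
    simp [quarticP, revM]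
  have ht' : r * s / r ^ 2 = s / r := by field_simp
  rw [SecondEq, hrev, ht']
  -- In the second equation the roles of `f` and `g` are exchanged, and these are the elementary
  -- symmetric functions of the `s / b_i`. Inverting the `b_i` reverses the order of the `e_k` and
  -- `h_k`, and dividing by the products `1/q` and `q` gives the powers of `r`.
  refine fracEq_of_curves (o₁ := r ^ 2 * e₃ * s) (o₂ := r ^ 2 * e₂ * s ^ 2)
    (o₃ := r ^ 2 * e₁ * s ^ 3) (h₁ := h₃ * s / r ^ 2) (h₂ := h₂ * s ^ 2 / r ^ 2)
    (h₃ := h₁ * s ^ 3 / r ^ 2) (mul_ne_zero hs ht) (mul_ne_zero hs (div_ne_zero hs hr)) hs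
    ?_ ?_ ?_ (by field_simp) ?_ ?_ ?_ ?_ ?_ ?_ ?_
  · rw [← mul_zero (s * (r * s)), ← hc, curve]
    field_simp
    ring
  · rw [← mul_zero (s * (s / r)), ← hc', curve]
    field_simp
    ring
  · intro hu h
    apply hne
    have : e₃ = e₁ * s ^ 2 := mul_right_cancel₀ (mul_ne_zero hq hs) (by linear_combination h)
    have h0 : s * e₁ - e₃ / s = 0 := by rw [this]; field_simp; ring
    rw [curve, h0]
    linear_combination g * hu
  · simp only [revM, Nat.reduceSub]; rw [m7]; field_simp; ring
  · simp only [revM, Nat.reduceSub]; rw [m6]; field_simp; ring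
  · simp only [revM, Nat.reduceSub]; rw [m5]; field_simp; ring
  · simp only [revM, Nat.reduceSub]; rw [m4]; field_simp; ring
  · simp only [revM, Nat.reduceSub]; rw [m3]; field_simp; ring
  · simp only [revM, Nat.reduceSub]; rw [m2]; field_simp; ring
  · simp only [revM, Nat.reduceSub]; rw [m1]; field_simp; ring

end Equations

/-! ### Consequences of regularity. -/

section Regular

variable {r s : ℂ} {b : ℕ → ℂ}

lemma Regular.s_ne {q t : ℂ} (h : Regular q r b t) (ht : t = r * s) : s ≠ 0 :=
  right_ne_zero_of_mul (ht ▸ h.t_ne)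

lemma Regular.gSol_mul {q t : ℂ} (hr : r ≠ 0) (h : Regular q r b t) (ht : t = r * s) :
    (1 - zSol q r b t) * gSol q r b t = gPt b s 1 - zSol q r b t * gPt b s 8 := by
  have hts : t / r = s := by rw [ht, mul_div_cancel_left₀ _ hr]
  rw [gSol, hts, mul_div_cancel₀ _ (sub_ne_zero.2 h.z_ne.symm)]

lemma Regular.riccatiDet_eq_zero {q t : ℂ} (hr : r ≠ 0) (h : Regular q r b t) (ht : t = r * s) :
    riccatiDet b s t 1 3 5 1 (fSol q r b t) (gSol q r b t) (fSol q r b t * gSol q r b t) = 0 := by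
  have hts : t / r = s := by rw [ht, mul_div_cancel_left₀ _ hr]
  have hd := h.fSolDen_ne
  have : fSolDen q r b t = riccatiDet b s t 1 3 5 0 1 0 (gSol q r b t) := by rw [fSolDen, hts]
  rw [riccatiDet_affine, ← this, fSol, hts, div_mul_cancel₀ _ hd, add_neg_cancel]

lemma oddCurve_eq_riccatiDet (hr : r ≠ 0) (hs : s ≠ 0)
    (hodd : r ^ 2 * b 1 * b 3 * b 5 * b 7 = 1) (heven : b 2 * b 4 * b 6 * b 8 = r ^ 2)
    (w x y z : ℂ) : riccatiDet b s (r * s) 1 3 5 w x y z * (s * (r * s) * b 1 * b 3 * b 5) =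
      (b 1 - b 3) * (b 1 - b 5) * (b 3 - b 5) * oddCurve b s (r * s) w x y z := by
  obtain ⟨n1, n2, n3, n4, n5, n6, n7, n8⟩ := b_ne_zero hr hodd heven
  exact riccatiDet_eq_curve hs (mul_ne_zero hr hs) n1 n3 n5
    (by linear_combination s ^ 2 * hodd) w x y z

/-- The nonvanishing coefficient of `f` in the determinant also forces `b₁, b₃, b₅` to be distinct,
so the determinant and the odd curve carry the same information. -/
lemma Regular.oddCurve_ne_zero (hr : r ≠ 0) (hodd : r ^ 2 * b 1 * b 3 * b 5 * b 7 = 1)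
    (heven : b 2 * b 4 * b 6 * b 8 = r ^ 2) (h : Regular (r ^ 2) r b (r * s)) :
    (b 1 - b 3) * (b 1 - b 5) * (b 3 - b 5) *
      oddCurve b s (r * s) 0 1 0 (gSol (r ^ 2) r b (r * s)) ≠ 0 := by
  have hs := h.s_ne rfl
  obtain ⟨n1, n2, n3, n4, n5, n6, n7, n8⟩ := b_ne_zero hr hodd heven
  have hd := h.fSolDen_ne
  rw [fSolDen, mul_div_cancel_left₀ _ hr] at hd
  rw [← oddCurve_eq_riccatiDet hr hs hodd heven]
  simp [hd, hr, hs, n1, n3, n5]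

lemma Regular.oddCurve_eq_zero (hr : r ≠ 0) (hodd : r ^ 2 * b 1 * b 3 * b 5 * b 7 = 1)
    (heven : b 2 * b 4 * b 6 * b 8 = r ^ 2) (h : Regular (r ^ 2) r b (r * s)) :
    oddCurve b s (r * s) 1 (fSol (r ^ 2) r b (r * s)) (gSol (r ^ 2) r b (r * s))
      (fSol (r ^ 2) r b (r * s) * gSol (r ^ 2) r b (r * s)) = 0 := by
  have := oddCurve_eq_riccatiDet hr (h.s_ne rfl) hodd heven 1 (fSol (r ^ 2) r b (r * s))
    (gSol (r ^ 2) r b (r * s)) (fSol (r ^ 2) r b (r * s) * gSol (r ^ 2) r b (r * s))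
  rw [h.riccatiDet_eq_zero hr rfl, zero_mul] at this
  exact (mul_eq_zero.1 this.symm).resolve_left
    (left_ne_zero_of_mul (h.oddCurve_ne_zero hr hodd heven))

lemma Regular.evenCurve_eq_zero (hq : ‖r ^ 2‖ < 1) (hr : r ≠ 0)
    (hodd : r ^ 2 * b 1 * b 3 * b 5 * b 7 = 1) (heven : b 2 * b 4 * b 6 * b 8 = r ^ 2)
    (h : Regular (r ^ 2) r b (r * s)) (h' : Regular (r ^ 2) r b (r * (r ^ 2 * s))) :
    evenCurve b (r ^ 2 * s) (r * s) 1 (fSol (r ^ 2) r b (r * s))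
      (gSol (r ^ 2) r b (r * (r ^ 2 * s)))
      (fSol (r ^ 2) r b (r * s) * gSol (r ^ 2) r b (r * (r ^ 2 * s))) = 0 := by
  have e := mul_div_cancel_left₀ s hr
  have e' := mul_div_cancel_left₀ (r ^ 2 * s) hr
  have hU := h.phi_defined
  have hU' := h'.phi_defined
  have hV := h.phi_shift_defined
  have hV' := h'.phi_shift_defined
  have h0 := h.phi_ne
  have h0' := h'.phi_ne
  rw [e] at hU hV h0
  rw [e'] at hU' hV' h0'
  exact QPE8.evenCurve_eq_zero hq hr (h.s_ne rfl) hodd heven hU hU' hV hV' h0 h0'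
    (by rw [zSol, e]) (by rw [zSol, e']) h.z_ne h'.z_ne (h.gSol_mul hr rfl) (h'.gSol_mul hr rfl)
    (h.oddCurve_eq_zero hr hodd heven)
    (right_ne_zero_of_mul (h.oddCurve_ne_zero hr hodd heven))

/-- Only this implication is available in general: `b₄, b₆, b₈` may coincide, and then the
determinant vanishes identically. The Painlevé equations are therefore derived from the even curve
itself. -/
lemma riccatiDet_eq_zero_of_evenCurve (hr : r ≠ 0) (hodd : r ^ 2 * b 1 * b 3 * b 5 * b 7 = 1)
    (heven : b 2 * b 4 * b 6 * b 8 = r ^ 2) (hs : s ≠ 0) {w x y z : ℂ}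
    (h : evenCurve b (r ^ 2 * s) (r * s) w x y z = 0) :
    riccatiDet b (r ^ 2 * s) (r * s) 8 6 4 w x y z = 0 := by
  obtain ⟨n1, n2, n3, n4, n5, n6, n7, n8⟩ := b_ne_zero hr hodd heven
  have := riccatiDet_eq_curve (l := 2) (mul_ne_zero (pow_ne_zero 2 hr) hs) (mul_ne_zero hr hs)
    n8 n6 n4 (by linear_combination (r * s) ^ 2 * heven) w x y z
  rw [← evenCurve, h, mul_zero] at this
  exact (mul_eq_zero.1 this).resolve_right (by simp [hr, hs, n8, n6, n4])

lemma Regular.phiBalanced (hq : ‖r ^ 2‖ < 1) (hr : r ≠ 0)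
    (hodd : r ^ 2 * b 1 * b 3 * b 5 * b 7 = 1) (heven : b 2 * b 4 * b 6 * b 8 = r ^ 2)
    (h : Regular (r ^ 2) r b (r * s)) :
    PhiBalanced (r ^ 2) (aParams (r ^ 2) b s (r * s)) ∧
    PhiBalanced (r ^ 2) (shiftParams (r ^ 2) (aParams (r ^ 2) b s (r * s))) := by
  have e := mul_div_cancel_left₀ s hr
  have hU := h.phi_defined
  have hV := h.phi_shift_defined
  have hbal := aParams_balanced hr (h.s_ne rfl) hodd heven
  rw [e, aParams_eq] at hU hV
  rw [aParams_eq]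
  refine ⟨phiBalanced_of_defined hq hU hbal (pow_ne_zero 2 hr), ?_⟩
  rw [shiftParams_eq] at hV ⊢
  refine phiBalanced_of_defined hq hV ?_ (pow_ne_zero 2 hr)
  rw [Finset.prod_mul_distrib, Finset.prod_const, Finset.card_univ, Fintype.card_fin]
  -- The shift multiplies six of the seven parameters by `p = q²` and `a₀` by `p²`, so both sides of
  -- the balancing condition gain `p⁶`.
  linear_combination ((r ^ 2) ^ 2) ^ 6 * hbal

lemma Regular.gSol_sub_ne_zero {q t : ℂ} (hr : r ≠ 0) (h : Regular q r b t) (ht : t = r * s) :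
    gSol q r b t - gPt b s 8 ≠ 0 := by
  have h1 := h.gSol_mul hr ht
  have h2 := h.g_one_ne_g_eight
  rw [ht, mul_div_cancel_left₀ _ hr] at h2
  intro h3
  apply h2
  linear_combination (1 - zSol q r b t) * h3 - h1

lemma Regular.gSol_quotient {q t : ℂ} (hr : r ≠ 0) (h : Regular q r b t) (ht : t = r * s) :
    (gSol q r b t - gPt b s 1) / (gSol q r b t - gPt b s 8) = zSol q r b t := by
  rw [div_eq_iff (h.gSol_sub_ne_zero hr ht)]
  linear_combination h.gSol_mul hr ht

end Regular

end QPE8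

end

theorem mainTheorem2 (q r : ℂ) (hq0 : q ≠ 0) (hq1 : ‖q‖ < 1) (hr : r ^ 2 = q)
    (b : ℕ → ℂ) (hodd : q * b 1 * b 3 * b 5 * b 7 = 1) (heven : b 2 * b 4 * b 6 * b 8 = q)
    (f g : ℂ → ℂ) (hf : f = QPE8.fSol q r b) (hg : g = QPE8.gSol q r b)
    (t s : ℂ) (ht : t = r * s) (hreg : QPE8.Regular q r b t) :
    -- both values of `Φ` are combinations of convergent balanced series
    QPE8.PhiBalanced q (QPE8.aParams q b s t) ∧
    QPE8.PhiBalanced q (QPE8.shiftParams q (QPE8.aParams q b s t)) ∧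
    -- the hypergeometric formula for `g`
    g t - QPE8.gPt b s 8 ≠ 0 ∧
    (g t - QPE8.gPt b s 1) / (g t - QPE8.gPt b s 8) =
      QPE8.lam q b s t *
        (QPE8.Phi q (QPE8.shiftParams q (QPE8.aParams q b s t)) /
          QPE8.Phi q (QPE8.aParams q b s t)) ∧
    -- the first determinantal Riccati equation, which determines `f`
    QPE8.riccatiDet b s t 1 3 5 1 (f t) (g t) (f t * g t) = 0 ∧
    -- the second determinantal Riccati equation and the first Painlevé equation
    (QPE8.Regular q r b (q * t) →
      QPE8.riccatiDet b (q * s) t 8 6 4 1 (f t) (g (q * t)) (f t * g (q * t)) = 0 ∧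
      QPE8.FirstEq q b s t (f t) (g t) (g (q * t))) ∧
    -- the second Painlevé equation
    (QPE8.Regular q r b (t / q) →
      QPE8.SecondEq q b s t (g t) (f t) (f (t / q))) := by
  subst hr hf hg ht
  have hr0 : r ≠ 0 := fun h => hq0 (by simp [h])
  have hs := hreg.s_ne rfl
  obtain ⟨B, B'⟩ := hreg.phiBalanced hq1 hr0 hodd heven
  refine ⟨B, B', hreg.gSol_sub_ne_zero hr0 rfl, ?_, hreg.riccatiDet_eq_zero hr0 rfl, ?_, ?_⟩
  · rw [hreg.gSol_quotient hr0 rfl, QPE8.zSol, mul_div_cancel_left₀ _ hr0]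
  · intro hreg'
    rw [show r ^ 2 * (r * s) = r * (r ^ 2 * s) by ring] at hreg' ⊢
    have hE := hreg.evenCurve_eq_zero hq1 hr0 hodd heven hreg'
    exact ⟨QPE8.riccatiDet_eq_zero_of_evenCurve hr0 hodd heven hs hE,
      QPE8.firstEq_of_curves hr0 hs hodd heven (hreg.oddCurve_eq_zero hr0 hodd heven)
        (right_ne_zero_of_mul (hreg.oddCurve_ne_zero hr0 hodd heven)) hE⟩
  · intro hreg'
    -- With `s = q s'`, the even curve for the step from `t / q` to `t` contains the point with
    -- coordinates `f(t / q)` and `g(t)`. This is the second curve needed in the second equation.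
    obtain ⟨s', rfl⟩ : ∃ s', s = r ^ 2 * s' := ⟨s / r ^ 2, by field_simp⟩
    rw [show r * (r ^ 2 * s') / r ^ 2 = r * s' by field_simp] at hreg' ⊢
    have hE := hreg'.evenCurve_eq_zero hq1 hr0 hodd heven hreg
    refine QPE8.secondEq_of_curves hr0 hs hodd heven (hreg.oddCurve_eq_zero hr0 hodd heven)
      (right_ne_zero_of_mul (hreg.oddCurve_ne_zero hr0 hodd heven)) ?_
    rwa [show r ^ 2 * s' / r = r * s' by field_simp]
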